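/- Let $d\ge 1$ and let $D$ be a probability distribution on $\mathbb R^d$ with $\mathbb E\|\mathbf x\|^2<\infty$ whose second-moment matrix $\Sigma=\mathbb E_{\mathbf x\sim D}[\mathbf x\mathbf x^\top]$ is invertible. Let $K_D=\sup_{\mathbf x\in\mathrm{supp}(D)}\mathbf x^\top\Sigma^{-1}\mathbf x$, and let $\mathrm{VS}^d_D$ be the distribution on $(\mathbb R^d)^d$ of volume-rescaled size-$d$ samples, i.e. the measure with density $\det\big(\sum_{i=1}^d\mathbf x_i\mathbf x_i^\top\big)/(d!\,\det\Sigma)$ with respect to $D^d$. Let $\widehat\Sigma\in\mathbb R^{d\times d}$ be a symmetric matrix and $K$ a real number such that $$(1-\epsilon)\Sigma\preceq\widehat\Sigma\preceq(1+\epsilon)\Sigma,\qquad \epsilon=\frac1{\sqrt{2d}},\qquad K\ge\frac{K_D}{1-\epsilon}.$$ Determinantal rejection sampling with pool size $t=2d^2$ is the following algorithm, which has access to $D$ only by drawing i.i.d. samples. (1) Repeat: draw $\mathbf x\sim D$ and keep it with probability $\min\{1,\mathbf x^\top\widehat\Sigma^{-1}\mathbf x/K\}$, until $t$ points $\mathbf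 x_1,\dots,\mathbf x_t$ have been kept; let $\widetilde{\mathbf x}_j=\sqrt d\,\mathbf x_j/\sqrt{\mathbf x_j^\top\widehat\Sigma^{-1}\mathbf x_j}$ and $\widetilde\Sigma=\frac1t\sum_j\widetilde{\mathbf x}_j\widetilde{\mathbf x}_j^\top$; accept these $t$ points with probability $\min\{1,\det(\widetilde\Sigma\widehat\Sigma^{-1})\}$, otherwise discard them all and start again. (2) After acceptance, let $S=\{1,\dots,t\}$; while $|S|>d$, remove from $S$ a random index $i$, chosen with probability $\det\big(\sum_{j\in S\setminus i}\widetilde{\mathbf x}_j\widetilde{\mathbf x}_j^\top\big)\big/\big((|S|-d)\det\big(\sum_{j\in S}\widetilde{\mathbf x}_j\widetilde{\mathbf x}_j^\top\big)\big)$, which is implemented by proposing a uniformly random $i\in S$ and accepting it with probability $1-\widetilde{\mathbf x}_i^\top\big(\sum_{j\in S}\widetilde{\mathbf x}_j\widetilde{\mathbf x}_j^\top\big)^{-1}\widetilde{\mathbf x}_i$. (3) Return the $d$ points $\mathbf x_i$, $i\in S$. The sample complexity is the number of draws from $D$. The time complexity is the number of elementary operations (real arithmetic operations and square roots, writes and moves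 of array entries, Bernoulli and uniform-index random draws, and $d$ operations for each draw from $D$), where inverses and determinants are computed, and the inverse in step (2) is maintained, by Sherman--Morrison rank-one updates. Then the algorithm halts almost surely, and its output is distributed exactly according to $\mathrm{VS}^d_D$. Moreover, there is an absolute constant $C$ such that, for every $d,D,\widehat\Sigma,K$ as above and every $0<\delta\le\frac12$, with probability at least $1-\delta$ the algorithm uses at most $C\,K\,d\,\ln^2(1/\delta)$ samples from $D$ and at most $C\,K\,d^3\,\ln^2(1/\delta)$ time. -/

import Mathlib

noncomputable section

open MeasureTheory ProbabilityTheory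

namespace VolumeSampling

/-! ### The distributions -/

/-- `ℝ^d`; only its topology, its Borel sets and its linear structure are used. -/
abbrev Vec (d : ℕ) : Type := Fin d → ℝ

/-- Real `d × d` matrices. -/
abbrev Mat (d : ℕ) : Type := Matrix (Fin d) (Fin d) ℝ

/-- The second-moment matrix `Σ_D = E[x xᵀ]` of a distribution `D` on `ℝ^d`. -/
def secondMoment {d : ℕ} (D : Measure (Vec d)) : Mat d :=
  Matrix.of fun i j => ∫ x, x i * x j ∂D

/-- The conditioning number `K_D = sup {xᵀ Σ_D⁻¹ x : x ∈ supp D}`, with values in `[0, ∞]`. -/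
def condNumber {d : ℕ} (D : Measure (Vec d)) : ENNReal :=
  ⨆ x ∈ D.support, ENNReal.ofReal (x ⬝ᵥ (secondMoment D)⁻¹.mulVec x)

/-- Volume-rescaled size `k` sampling from `D`: the measure on `(ℝ^d)^k` whose density with
respect to `D^k` is `det (∑ xᵢ xᵢᵀ) / (d! (k choose d) det Σ_D)`. -/
def volumeRescaled {d : ℕ} (D : Measure (Vec d)) (k : ℕ) : Measure (Fin k → Vec d) :=
  (Measure.pi fun _ : Fin k => D).withDensity fun x =>
    ENNReal.ofReal ((∑ i, Matrix.vecMulVec (x i) (x i)).det /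
      ((d.factorial : ℝ) * (k.choose d : ℝ) * (secondMoment D).det))

/-! ### Deterministic computations with unit-cost real arithmetic -/

/-- A computed value together with the number of elementary operations spent on it. -/
structure Timed (α : Type) where
  val : α
  ops : ℕ

namespace Timed

instance : Monad Timed where
  pure a := ⟨a, 0⟩
  bind m f := ⟨(f m.val).val, m.ops + (f m.val).ops⟩

/-- One addition. -/
def add (x y : ℝ) : Timed ℝ := ⟨x + y, 1⟩
/-- One subtraction. -/
def sub (x y : ℝ) : Timed ℝ := ⟨x - y, 1⟩
/-- One multiplication. -/
def mul (x y : ℝ) : Timed ℝ := ⟨x * y, 1⟩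
/-- One division (with the convention `x / 0 = 0`). -/
def div (x y : ℝ) : Timed ℝ := ⟨x / y, 1⟩
/-- One square root. -/
def sqrt (x : ℝ) : Timed ℝ := ⟨√x, 1⟩

/-- Add up `n` computed terms, with one addition per term. -/
def sum {n : ℕ} (f : Fin n → Timed ℝ) : Timed ℝ :=
  ⟨∑ i, (f i).val, ∑ i, ((f i).ops + 1)⟩

/-- Fill an array of length `n` with computed entries, with one write per entry. -/
def tabulate {n : ℕ} {α : Type} (f : Fin n → Timed α) : Timed (Fin n → α) :=
  ⟨fun i => (f i).val, ∑ i, ((f i).ops + 1)⟩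

/-- `uᵀ v`. -/
def dot {d : ℕ} (u v : Vec d) : Timed ℝ := sum fun i => mul (u i) (v i)

/-- `M v`. -/
def mulVec {d : ℕ} (M : Mat d) (v : Vec d) : Timed (Vec d) := tabulate fun i => dot (M i) v

/-- `vᵀ M`. -/
def vecMul {d : ℕ} (v : Vec d) (M : Mat d) : Timed (Vec d) :=
  tabulate fun j => sum fun i => mul (v i) (M i j)

/-- `xᵀ M x`. -/
def quad {d : ℕ} (M : Mat d) (x : Vec d) : Timed ℝ := do
  let p ← mulVec M x
  dot x p

/-- Sherman–Morrison: from `M = B⁻¹` compute `c = 1 + vᵀ B⁻¹ u = det (B + u vᵀ) / det B` and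
`(B + u vᵀ)⁻¹ = M - (M u) (vᵀ M) / c`. -/
def rankOne {d : ℕ} (M : Mat d) (u v : Vec d) : Timed (Mat d × ℝ) := do
  let p ← mulVec M u
  let q ← vecMul v M
  let s ← dot v p
  let c ← add 1 s
  let N ← tabulate fun i => tabulate fun j => do
    let a ← mul (p i) (q j)
    let b ← div a c
    sub (M i j) b
  pure (N, c)

/-- The `k`-th step of `invDet`: the `k`-th row of the identity matrix is replaced by the `k`-th
row of `A`, and the inverse and the determinant are updated. -/
def invDetStep {d : ℕ} (A : Mat d) (st : Mat d × ℝ) (k : Fin d) : Timed (Mat d × ℝ) := do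
  let u ← tabulate fun i => pure (if i = k then (1 : ℝ) else 0)
  let v ← tabulate fun j => sub (A k j) (if j = k then 1 else 0)
  let Nc ← rankOne st.1 u v
  let δ ← mul st.2 Nc.2
  pure (Nc.1, δ)

/-- The inverse and the determinant of a positive definite matrix `A`, by `d` rank-one updates of
the identity matrix. For a singular positive semidefinite `A` the second component is `0`, and the
first one is of no use. -/
def invDet {d : ℕ} (A : Mat d) : Timed (Mat d × ℝ) := do
  let I ← tabulate fun i => tabulate fun j => pure (if i = j then (1 : ℝ) else 0)
  (List.finRange d).foldlM (invDetStep A) (I, 1)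

/-- `∑ₖ yₖ yₖᵀ`. -/
def gram {d n : ℕ} (y : Fin n → Vec d) : Timed (Mat d) :=
  tabulate fun i => tabulate fun j => sum fun k => mul (y k i) (y k j)

end Timed

/-! ### Randomized computations

A randomized computation with result in `α` is given by the joint law of its result, of the number
of samples it draws from the data distribution, and of the number of elementary operations it
performs. The missing mass is the probability that it runs forever. -/

/-- The law of (result, number of samples, number of elementary operations). -/
abbrev RandProg (α : Type) [MeasurableSpace α] : Type := Measure (α × (ℕ × ℕ))

section Programs

variable {α β : Type} [MeasurableSpace α] [MeasurableSpace β]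

/-- Return a value. -/
def ret (a : α) : RandProg α := Measure.dirac (a, (0, 0))

/-- Add `c` to the (samples, operations) counters. -/
def charge (c : ℕ × ℕ) (m : RandProg α) : RandProg α := m.map fun z => (z.1, c + z.2)

/-- Run `m`, then `f` on its result; the counters add up. -/
def andThen (m : RandProg α) (f : α → RandProg β) : RandProg β :=
  Measure.bind m fun z => charge z.2 (f z.1)

/-- Run a deterministic computation, then `f` on its result. -/
def compute {γ : Type} (m : Timed γ) (f : γ → RandProg β) : RandProg β :=
  charge (0, m.ops) (f m.val)

/-- The runs of `repeat body until flag` that end in exactly `n + 1` rounds, where each round of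
`body` produces a flag and a value. -/
def repeatExactly (body : RandProg (Bool × α)) : ℕ → RandProg α
  | 0 => (body.restrict {z | z.1.1 = true}).map fun z => (z.1.2, z.2)
  | n + 1 => Measure.bind (body.restrict {z | z.1.1 = false}) fun z =>
      charge z.2 (repeatExactly body n)

/-- `repeat body until flag`, returning the value of the last round. -/
def repeatUntil (body : RandProg (Bool × α)) : RandProg α :=
  Measure.sum fun n => repeatExactly body n

end Programs

/-- Toss a coin that shows `true` with probability `min {1, p}` (for `p ≥ 0`); one operation. -/
def coin (p : ℝ) : RandProg Bool :=
  (bernoulliMeasure true false (Set.projIcc (0 : ℝ) 1 zero_le_one p)).map fun b => (b, (0, 1))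

/-- A uniformly random index; one operation. -/
def randIndex (n : ℕ) : RandProg (Fin n) :=
  (uniformOn (Set.univ : Set (Fin n))).map fun i => (i, (0, 1))

/-- Draw a point from `D`: one sample, and `d` operations to store it. -/
def draw {d : ℕ} (D : Measure (Vec d)) : RandProg (Vec d) := D.map fun x => (x, (1, d))

/-! ### Volume sampling from a finite pool -/

/-- One trial of the removal step for a pool `y` of `n` vectors, where `M = (∑ yᵢ yᵢᵀ)⁻¹`: propose
a uniformly random index `p` and accept it with probability
`1 - y_pᵀ M y_p = det (∑_{j ≠ p} yⱼ yⱼᵀ) / det (∑ⱼ yⱼ yⱼᵀ)`. -/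
def removalTrial {d n : ℕ} (M : Mat d) (y : Fin n → Vec d) : RandProg (Bool × Fin n) :=
  andThen (randIndex n) fun p =>
    compute (do let l ← Timed.quad M (y p); Timed.sub 1 l) fun q =>
      andThen (coin q) fun a => ret (a, p)

/-- Reverse iterative sampling: starting with a pool of `d + r` pairs `(x, y)` and the matrix
`M = (∑ yᵢ yᵢᵀ)⁻¹`, remove `r` indices one after the other, the index `p` with probability
proportional to `det (∑_{j ≠ p} yⱼ yⱼᵀ)`, and return the vectors `x` at the remaining indices.
Closing the gap in the array of length `d + r + 1` is charged `d + r + 1` operations. -/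
def reverseSampling {d : ℕ} :
    (r : ℕ) → Mat d → (Fin (d + r) → Vec d × Vec d) → RandProg (Fin d → Vec d)
  | 0, _, z => ret fun i => (z i).1
  | r + 1, M, z =>
      andThen (repeatUntil (removalTrial M fun i => (z i).2)) fun p : Fin (d + r + 1) =>
        compute (do
            let u ← Timed.tabulate fun i => Timed.sub 0 ((z p).2 i)
            Timed.rankOne M u (z p).2) fun N =>
          charge (0, d + r + 1) (reverseSampling r N.1 fun i : Fin (d + r) => z (p.succAbove i))

/-- Volume sampling of `d` out of `d + r` indices with respect to the second components; the first
components at these indices are returned. -/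
def volSamp {d : ℕ} (r : ℕ) (z : Fin (d + r) → Vec d × Vec d) : RandProg (Fin d → Vec d) :=
  compute (do let G ← Timed.gram fun i => (z i).2; Timed.invDet G) fun N => reverseSampling r N.1 z

/-! ### Determinantal rejection sampling -/

/-- One pass through the body of the inner loop, where `S = Σ̂⁻¹`: draw `x ∼ D`, compute
`l = xᵀ Σ̂⁻¹ x` and accept `x` with probability `min {1, l / K}`. -/
def leverageTrial {d : ℕ} (D : Measure (Vec d)) (S : Mat d) (K : ℝ) :
    RandProg (Bool × (Vec d × ℝ)) :=
  andThen (draw D) fun x =>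
    compute (do
        let l ← Timed.quad S x
        let p ← Timed.div l K
        pure (l, p)) fun lp =>
      andThen (coin lp.2) fun a => ret (a, (x, lp.1))

/-- Repeat the trials until a point `x` is accepted, and return `x` together with its rescaled
version `(√d / √(xᵀ Σ̂⁻¹ x)) x`. -/
def leveragePoint {d : ℕ} (D : Measure (Vec d)) (S : Mat d) (K : ℝ) : RandProg (Vec d × Vec d) :=
  andThen (repeatUntil (leverageTrial D S K)) fun xl =>
    compute (do
        let a ← Timed.sqrt d
        let b ← Timed.sqrt xl.2
        let s ← Timed.div a b
        Timed.tabulate fun i => Timed.mul s (xl.1 i)) fun y =>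
      ret (xl.1, y)

/-- The inner loop: collect `k` accepted points. -/
def leveragePool {d : ℕ} (D : Measure (Vec d)) (S : Mat d) (K : ℝ) :
    (k : ℕ) → RandProg (Fin k → Vec d × Vec d)
  | 0 => ret Fin.elim0
  | k + 1 =>
      andThen (leveragePool D S K k) fun z =>
        andThen (leveragePoint D S K) fun w =>
          charge (0, 1) (ret (Fin.snoc (α := fun _ => Vec d × Vec d) z w))

/-- One round of the outer loop, where `S = Σ̂⁻¹` and `δ = det Σ̂`: collect `t` points, form
`Σ̃ = (1/t) ∑ x̃ⱼ x̃ⱼᵀ`, and accept with probability `min {1, det (Σ̃ Σ̂⁻¹)}`. -/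
def poolTrial {d : ℕ} (D : Measure (Vec d)) (S : Mat d) (δ K : ℝ) (t : ℕ) :
    RandProg (Bool × (Fin t → Vec d × Vec d)) :=
  andThen (leveragePool D S K t) fun z =>
    compute (do
        let G ← Timed.gram fun k => (z k).2
        let T ← Timed.tabulate fun i => Timed.tabulate fun j => Timed.div (G i j) t
        let N ← Timed.invDet T
        Timed.div N.2 δ) fun q =>
      andThen (coin q) fun a => ret (a, z)

/-- Determinantal rejection sampling with input `Σ̂`, `K` and pool size `t = d + r`. The
distribution `D` is used only through `draw D`. -/
def detRejectionSampling {d : ℕ} (D : Measure (Vec d)) (Shat : Mat d) (K : ℝ) (r : ℕ) :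
    RandProg (Fin d → Vec d) :=
  compute (Timed.invDet Shat) fun N =>
    andThen (repeatUntil (poolTrial D N.1 N.2 K (d + r))) fun z => volSamp r z

end VolumeSampling

end

noncomputable section

open MeasureTheory ProbabilityTheory

namespace VolumeSampling

/-! ### A calculus for randomized programs -/

section Calculus

variable {α β γ : Type} [MeasurableSpace α] [MeasurableSpace β] [MeasurableSpace γ]

/-! Everything is read off one functional of a program: the integral of `b ^ cost * f result`, where
cost is the number of operations plus `e` times the number of samples. At `b = 1` it determines the
law of the result; at `f = 1` it is an exponential moment of the cost. Since costs add, it composes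
along `andThen`, and a rejection loop sums to a geometric series (`transform_repeatUntil`).

For the whole algorithm this functional factors as `costMoment` times the integral of `f` against
volume-rescaled sampling (`transform_detRejectionSampling`), so output and cost are independent.
Three facts produce the factorization. (i) A leverage-sampled point has density proportional to `xᵀ
S x`, and rescaling divides it by the square root of the same quantity. For `d` points the squared
volume of the rescaled vectors times the leverage density is therefore a constant multiple of the
squared volume of the original points (`det_gramMat_rescale`). (ii) By the arithmetic-geometric mean
inequality the acceptance probability of a pool is a genuine probability, so accepting multiplies
the pool law by a constant times the determinant of its Gram matrix (`acceptProb_le_one`). (iii)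
Under this weight, reverse iterative sampling is a uniform choice of the deleted index followed by
the same weight on the smaller pool (`poolTransform_succ`). Leverage scores sum to `d`, so the
rejection rate of a removal trial does not depend on the pool. Integrating out deleted points leaves
a binomial coefficient and the case of `d` points (`lintegral_poolTransform`).

At `b = 1` the cost factor is `1`: the algorithm halts almost surely with the exact law.

For the cost, a pool is accepted with probability at least `1 / 4`. One factor `1 / 2` is the
birthday-type ratio of a falling factorial to a power at pool size `2 d ^ 2`
(`half_le_descFactorial_div`). The other comes from a Kantorovich-type trace inequality with `ε ^ 2
= 1 / (2 d)` (`det_ratio_ge`). A leverage trial succeeds with probability at least `d / (2 K)`, and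
a removal trial with probability `(k + 1) / (d + k + 1)`. With one sample charged an extra `d ^ 2`
operations, the exponential moment at rate of order `1 / (K d ^ 3)` is at most `e`
(`costMoment_le`). Markov's inequality (`cost_tail`) then bounds samples and time at once. -/

/-- A measurable family of programs, each of total mass at most `1`. -/
structure IsProg (f : γ → RandProg α) : Prop where
  measurable : Measurable f
  mass_le : ∀ c, f c Set.univ ≤ 1

/-- A measurable family of measures can be composed with a measurable family depending on the
same parameter. -/
theorem measurable_bind_param {m : γ → Measure α} (hm : Measurable m)
    (hm1 : ∀ c, m c Set.univ ≤ 1) {f : γ → α → Measure β}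
    (hf : Measurable (fun p : γ × α => f p.1 p.2)) :
    Measurable fun c => Measure.bind (m c) (f c) := by
  let κ : Kernel γ α := ⟨m, hm⟩
  have : IsFiniteKernel κ := ⟨⟨1, by simp, hm1⟩⟩
  refine Measure.measurable_of_measurable_coe _ fun s hs => ?_
  have hb : ∀ c, Measure.bind (m c) (f c) s = ∫⁻ a, f c a s ∂(κ c) := fun c =>
    Measure.bind_apply hs (hf.comp (measurable_const.prodMk measurable_id)).aemeasurable
  simp_rw [hb]
  exact Measurable.lintegral_kernel_prod_right' (κ := κ)
    (f := fun p : γ × α => f p.1 p.2 s) ((Measure.measurable_coe hs).comp hf)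

theorem bind_mass_le {m : Measure α} (hm : m Set.univ ≤ 1) {f : α → Measure β}
    (hf : Measurable f) (hf1 : ∀ a, f a Set.univ ≤ 1) : Measure.bind m f Set.univ ≤ 1 := by
  rw [Measure.bind_apply MeasurableSet.univ hf.aemeasurable]
  calc ∫⁻ a, f a Set.univ ∂m ≤ ∫⁻ _, 1 ∂m := lintegral_mono hf1
    _ = m Set.univ := by simp
    _ ≤ 1 := hm

theorem map_mass_le {m : Measure α} (hm : m Set.univ ≤ 1) {f : α → β} (hf : Measurable f) :
    Measure.map f m Set.univ ≤ 1 := by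
  rw [Measure.map_apply hf MeasurableSet.univ]; simpa using hm

theorem measurable_addLeft (c : ℕ × ℕ) :
    Measurable fun z : α × (ℕ × ℕ) => (z.1, c + z.2) := by fun_prop

/-- In bind form, `measurable_bind_param` also covers a charge that varies with the parameter. -/
theorem charge_eq_bind (c : ℕ × ℕ) (m : RandProg α) :
    charge c m = Measure.bind m fun z => Measure.dirac (z.1, c + z.2) :=
  (Measure.bind_dirac_eq_map m (measurable_addLeft c)).symm

theorem IsProg.ret {f : γ → α} (hf : Measurable f) :
    IsProg fun c => VolumeSampling.ret (f c) where
  measurable := Measure.measurable_dirac.comp (hf.prodMk measurable_const)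
  mass_le c := by simp [VolumeSampling.ret]

theorem IsProg.charge {m : γ → RandProg α} (hm : IsProg m) {k : γ → ℕ × ℕ} (hk : Measurable k) :
    IsProg fun c => VolumeSampling.charge (k c) (m c) where
  measurable := by
    simp_rw [charge_eq_bind]
    refine measurable_bind_param hm.measurable hm.mass_le ?_
    refine Measure.measurable_dirac.comp ?_
    refine Measurable.prodMk (by fun_prop) (Measurable.add (by fun_prop) (by fun_prop))
  mass_le c := map_mass_le (hm.mass_le c) (measurable_addLeft _)

theorem IsProg.comp {m : γ → RandProg α} (hm : IsProg m) {f : β → γ} (hf : Measurable f) :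
    IsProg fun c => m (f c) :=
  ⟨hm.measurable.comp hf, fun c => hm.mass_le (f c)⟩

theorem IsProg.bindCharge {m : γ → RandProg α} (hm : IsProg m) {f : γ → α → RandProg β}
    (hf : IsProg fun p : γ × α => f p.1 p.2) :
    IsProg fun c => (Measure.bind (m c) fun z => VolumeSampling.charge z.2 (f c z.1) :
      RandProg β) := by
  have h : IsProg fun p : γ × (α × (ℕ × ℕ)) => VolumeSampling.charge p.2.2 (f p.1 p.2.1) :=
    (hf.comp (β := γ × (α × (ℕ × ℕ))) (f := fun p => (p.1, p.2.1)) (by fun_prop)).charge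
      (by fun_prop)
  exact ⟨measurable_bind_param hm.measurable hm.mass_le h.measurable,
    fun c => bind_mass_le (hm.mass_le c)
      (h.measurable.comp (measurable_const.prodMk measurable_id)) fun z => h.mass_le (c, z)⟩

theorem IsProg.andThen {m : γ → RandProg α} (hm : IsProg m) {f : γ → α → RandProg β}
    (hf : IsProg fun p : γ × α => f p.1 p.2) :
    IsProg fun c => VolumeSampling.andThen (m c) (f c) :=
  hm.bindCharge hf

theorem IsProg.compute {δ : Type} {m : γ → Timed δ} {f : γ → δ → RandProg β}
    (hops : Measurable fun c => (m c).ops) (hf : IsProg fun c => f c (m c).val) :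
    IsProg fun c => VolumeSampling.compute (m c) (f c) :=
  hf.charge (measurable_const.prodMk hops)

theorem measurable_restrict_param {m : γ → Measure α} (hm : Measurable m) {s : Set α}
    (hs : MeasurableSet s) : Measurable fun c => (m c).restrict s := by
  refine Measure.measurable_of_measurable_coe _ fun t ht => ?_
  simp_rw [Measure.restrict_apply ht]
  exact (Measure.measurable_coe (ht.inter hs)).comp hm

theorem measurableSet_flag (b : Bool) :
    MeasurableSet {z : (Bool × α) × (ℕ × ℕ) | z.1.1 = b} :=
  (measurable_fst.comp measurable_fst) (measurableSet_singleton b)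

theorem IsProg.repeatExactly {m : γ → RandProg (Bool × α)} (hm : IsProg m) (n : ℕ) :
    IsProg fun c => VolumeSampling.repeatExactly (m c) n := by
  have hr : ∀ b : Bool, IsProg fun c => ((m c).restrict {z | z.1.1 = b} :
      RandProg (Bool × α)) := fun b =>
    ⟨measurable_restrict_param hm.measurable (measurableSet_flag b), fun c =>
      (Measure.restrict_apply_le _ _).trans (hm.mass_le c)⟩
  induction n with
  | zero =>
    have hg : Measurable fun z : (Bool × α) × (ℕ × ℕ) => (z.1.2, z.2) := by fun_prop
    exact ⟨(Measure.measurable_map _ hg).comp (hr true).measurable,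
      fun c => map_mass_le ((hr true).mass_le c) hg⟩
  | succ n ih =>
    exact (hr false).bindCharge (f := fun c _ => VolumeSampling.repeatExactly (m c) n)
      (ih.comp measurable_fst)

/-- The joint transform of the result (through `f`) and of the weighted cost of a program. The
law of the result is obtained for `b = 1`, the exponential moments of the cost for `f = 1`. -/
def transform (e : ℕ) (b : ENNReal) (m : RandProg α) (f : α → ENNReal) : ENNReal :=
  ∫⁻ z, b ^ (z.2.2 + e * z.2.1) * f z.1 ∂m

variable (e : ℕ) (b : ENNReal)

theorem measurable_weight : Measurable fun c : ℕ × ℕ => b ^ (c.2 + e * c.1) :=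
  Measurable.of_discrete

theorem measurable_transformIntegrand {f : α → ENNReal} (hf : Measurable f) :
    Measurable fun z : α × (ℕ × ℕ) => b ^ (z.2.2 + e * z.2.1) * f z.1 :=
  ((measurable_weight e b).comp measurable_snd).mul (hf.comp measurable_fst)

theorem IsProg.measurable_transform {m : γ → RandProg α} (hm : IsProg m) {f : α → ENNReal}
    (hf : Measurable f) : Measurable fun c => transform e b (m c) f :=
  (Measure.measurable_lintegral (measurable_transformIntegrand e b hf)).comp hm.measurable

theorem transform_one_one (m : RandProg α) : transform e 1 m (fun _ => 1) = m Set.univ := by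
  simp [transform]

theorem transform_const_mul (m : RandProg α) (k : ENNReal) {f : α → ENNReal} (hf : Measurable f) :
    transform e b m (fun a => k * f a) = k * transform e b m f := by
  unfold transform
  rw [← lintegral_const_mul _ (measurable_transformIntegrand e b hf)]
  congr 1; ext z; ring

theorem transform_ret (a : α) {f : α → ENNReal} (hf : Measurable f) :
    transform e b (ret a) f = f a := by
  unfold transform ret
  rw [lintegral_dirac' _ (measurable_transformIntegrand e b hf)]
  simp

theorem transform_charge (c : ℕ × ℕ) (m : RandProg α) {f : α → ENNReal} (hf : Measurable f) :
    transform e b (charge c m) f = b ^ (c.2 + e * c.1) * transform e b m f := by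
  unfold transform charge
  rw [lintegral_map (measurable_transformIntegrand e b hf) (measurable_addLeft c),
    ← lintegral_const_mul _ (measurable_transformIntegrand e b hf)]
  congr 1; ext z
  simp only [Prod.fst_add, Prod.snd_add]
  ring

/-- Counters add along a composition and `b ^ ·` turns sums into products, so transforms nest like
iterated expectations. -/
theorem transform_bindCharge (m : RandProg α) {g : α → RandProg β} (hg : IsProg g)
    {f : β → ENNReal} (hf : Measurable f) :
    transform e b (Measure.bind m fun z => charge z.2 (g z.1)) f =
      transform e b m fun a => transform e b (g a) f := by
  have h : IsProg fun p : α × (ℕ × ℕ) => VolumeSampling.charge p.2 (g p.1) :=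
    (hg.comp measurable_fst).charge measurable_snd
  conv_lhs => unfold transform
  rw [Measure.lintegral_bind h.measurable.aemeasurable
    (measurable_transformIntegrand e b hf).aemeasurable]
  conv_rhs => unfold transform
  congr 1; ext z
  exact transform_charge e b z.2 (g z.1) hf

theorem transform_andThen (m : RandProg α) {g : α → RandProg β} (hg : IsProg g)
    {f : β → ENNReal} (hf : Measurable f) :
    transform e b (andThen m g) f = transform e b m fun a => transform e b (g a) f :=
  transform_bindCharge e b m hg hf

theorem transform_compute {δ : Type} (m : Timed δ) (g : δ → RandProg β)
    {f : β → ENNReal} (hf : Measurable f) :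
    transform e b (compute m g) f = b ^ m.ops * transform e b (g m.val) f := by
  simp [compute, transform_charge e b _ _ hf]

theorem transform_restrict_flag (m : RandProg (Bool × α)) (v : Bool) (f : Bool × α → ENNReal) :
    transform e b (m.restrict {z | z.1.1 = v} : RandProg (Bool × α)) f =
      transform e b m fun z => if z.1 = v then f z else 0 := by
  unfold transform
  rw [← lintegral_indicator (measurableSet_flag v)]
  congr 1; ext z
  by_cases h : z.1.1 = v <;> simp [Set.indicator, h]

/-- Rounds are independent, and a failed round passes on only its cost: each contributes the same
scalar factor. -/
theorem transform_repeatExactly {m : RandProg (Bool × α)} (hm : m Set.univ ≤ 1)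
    {f : α → ENNReal} (hf : Measurable f) (n : ℕ) :
    transform e b (repeatExactly m n) f =
      (transform e b m fun z => if z.1 = false then 1 else 0) ^ n *
        transform e b m fun z => if z.1 = true then f z.2 else 0 := by
  induction n with
  | zero =>
    have hg : Measurable fun z : (Bool × α) × (ℕ × ℕ) => (z.1.2, z.2) := by fun_prop
    rw [pow_zero, one_mul, ← transform_restrict_flag e b m true fun z => f z.2]
    unfold transform repeatExactly
    rw [lintegral_map (measurable_transformIntegrand e b hf) hg]
  | succ n ih =>
    have hP : IsProg fun _ : Bool × α => repeatExactly m n :=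
      IsProg.repeatExactly (m := fun _ : Bool × α => m) ⟨measurable_const, fun _ => hm⟩ n
    have h := transform_bindCharge e b (m.restrict {z | z.1.1 = false} : RandProg (Bool × α)) hP hf
    rw [repeatExactly, h, transform_restrict_flag, ih, pow_succ, mul_right_comm]
    set F := transform e b m fun z => if z.1 = false then 1 else 0 with hF
    set T := transform e b m fun z => if z.1 = true then f z.2 else 0
    have hmeas : Measurable fun z : Bool × α => if z.1 = false then (1 : ENNReal) else 0 :=
      Measurable.ite ((measurableSet_singleton false).preimage measurable_fst)
        measurable_const measurable_const
    have hc := transform_const_mul e b m (F ^ n * T) hmeas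
    rw [← hF] at hc
    rw [← hc]
    simp only [mul_ite, mul_one, mul_zero]

/-- A geometric series over the number of failed rounds. In `ENNReal` no convergence hypothesis is
needed: if the failure factor is at least `1`, the truncated difference is `0` and its inverse `∞`.
-/
theorem transform_repeatUntil {m : RandProg (Bool × α)} (hm : m Set.univ ≤ 1)
    {f : α → ENNReal} (hf : Measurable f) :
    transform e b (repeatUntil m) f =
      (1 - transform e b m fun z => if z.1 = false then 1 else 0)⁻¹ *
        transform e b m fun z => if z.1 = true then f z.2 else 0 := by
  have : transform e b (repeatUntil m) f = ∑' n, transform e b (repeatExactly m n) f := by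
    unfold transform repeatUntil
    rw [lintegral_sum_measure]
  rw [this]
  simp_rw [transform_repeatExactly e b hm hf]
  rw [ENNReal.tsum_mul_right, ENNReal.tsum_geometric]

theorem repeatUntil_mass_le {m : RandProg (Bool × α)} (hm : m Set.univ ≤ 1) :
    repeatUntil m Set.univ ≤ 1 := by
  rw [← transform_one_one 0, transform_repeatUntil 0 1 hm measurable_const]
  have hF : transform 0 1 m (fun z => if z.1 = false then 1 else 0) +
      transform 0 1 m (fun z => if z.1 = true then 1 else 0) ≤ 1 := by
    unfold transform
    rw [← lintegral_add_left]
    · refine (lintegral_mono (g := fun _ => 1) fun z => ?_).trans (by simpa using hm)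
      cases h : z.1.1 <;> simp [h]
    · exact measurable_transformIntegrand 0 1 (f := fun z : Bool × α => if z.1 = false then 1 else 0)
        (Measurable.ite ((measurableSet_singleton false).preimage measurable_fst)
        measurable_const measurable_const)
  rw [mul_comm, ← div_eq_mul_inv]
  exact ENNReal.div_le_of_le_mul (by
    rw [one_mul]; exact ENNReal.le_sub_of_add_le_left (ne_top_of_le_ne_top (by simp)
      (le_self_add.trans hF)) hF)

theorem IsProg.repeatUntil {m : γ → RandProg (Bool × α)} (hm : IsProg m) :
    IsProg fun c => VolumeSampling.repeatUntil (m c) where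
  measurable := by
    refine Measure.measurable_of_measurable_coe _ fun s hs => ?_
    simp_rw [VolumeSampling.repeatUntil, Measure.sum_apply _ hs]
    exact Measurable.tsum fun n =>
      (Measure.measurable_coe hs).comp (hm.repeatExactly n).measurable
  mass_le c := repeatUntil_mass_le (hm.mass_le c)

end Calculus

/-! ### The random primitives -/

section Primitives

variable (e : ℕ) (b : ENNReal)

theorem transform_map {α β : Type} [MeasurableSpace α] [MeasurableSpace β] (m : Measure α)
    {g : α → β} (hg : Measurable g) (c : ℕ × ℕ) {f : β → ENNReal} (hf : Measurable f) :
    transform e b (m.map fun a => (g a, c)) f = b ^ (c.2 + e * c.1) * ∫⁻ a, f (g a) ∂m := by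
  unfold transform
  rw [lintegral_map (measurable_transformIntegrand e b hf) (hg.prodMk measurable_const),
    ← lintegral_const_mul (b ^ (c.2 + e * c.1)) (f := fun a => f (g a)) (hf.comp hg)]

/-- The range hypotheses make the clamping in `coin` inactive. Exactness of the output depends on
verifying them at every coin toss. -/
theorem transform_coin {p : ℝ} (hp : 0 ≤ p) (hp1 : p ≤ 1) (f : Bool → ENNReal) :
    transform e b (coin p) f =
      b * (ENNReal.ofReal p * f true + ENNReal.ofReal (1 - p) * f false) := by
  have hf : Measurable f := Measurable.of_discrete
  rw [coin, transform_map e b _ (g := fun b => b) measurable_id (0, 1) hf]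
  simp only [mul_zero, add_zero, pow_one, bernoulliMeasure_def]
  rw [lintegral_add_measure, lintegral_smul_measure, lintegral_smul_measure,
    lintegral_dirac' _ hf, lintegral_dirac' _ hf]
  congr 3
  · rw [Set.projIcc_of_mem _ ⟨hp, hp1⟩]
    ext
    simp [hp]
  · rw [Set.projIcc_of_mem _ ⟨hp, hp1⟩]
    ext
    simp [hp1]

theorem isProg_coin : IsProg fun p : ℝ => coin p where
  measurable := by
    refine (Measure.measurable_map _ (by fun_prop)).comp ?_
    refine Measure.measurable_of_measurable_coe _ fun s hs => ?_
    simp only [bernoulliMeasure_def, Measure.coe_add, Measure.coe_smul, Pi.add_apply,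
      Pi.smul_apply, ENNReal.smul_def, smul_eq_mul]
    have h : Measurable fun p : ℝ => (Set.projIcc (0 : ℝ) 1 zero_le_one p) :=
      continuous_projIcc.measurable
    refine Measurable.add (Measurable.mul_const (Measurable.coe_nnreal_ennreal ?_) _)
      (Measurable.mul_const (Measurable.coe_nnreal_ennreal ?_) _)
    · exact (by fun_prop : Continuous unitInterval.toNNReal).measurable.comp h
    · exact (by fun_prop :
        Continuous fun p => unitInterval.toNNReal (unitInterval.symm p)).measurable.comp h
  mass_le p := map_mass_le (by simp) (by fun_prop)

theorem lintegral_uniformOn_univ (n : ℕ) (f : Fin n → ENNReal) :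
    ∫⁻ i, f i ∂(uniformOn (Set.univ : Set (Fin n))) = (n : ENNReal)⁻¹ * ∑ i, f i := by
  rw [lintegral_fintype, Finset.mul_sum]
  refine Finset.sum_congr rfl fun i _ => ?_
  rw [uniformOn_univ]
  simp [mul_comm]

theorem transform_randIndex (n : ℕ) (f : Fin n → ENNReal) :
    transform e b (randIndex n) f = b * ((n : ENNReal)⁻¹ * ∑ i, f i) := by
  rw [randIndex, transform_map e b _ (g := fun i => i) measurable_id (0, 1) Measurable.of_discrete]
  simp [lintegral_uniformOn_univ]

theorem randIndex_mass_le (n : ℕ) : randIndex n Set.univ ≤ 1 :=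
  map_mass_le prob_le_one (by fun_prop)

theorem transform_draw {d : ℕ} (D : Measure (Vec d)) {f : Vec d → ENNReal} (hf : Measurable f) :
    transform e b (draw D) f = b ^ (d + e) * ∫⁻ x, f x ∂D := by
  rw [draw, transform_map e b _ (g := fun x => x) measurable_id (1, d) hf]
  simp

theorem draw_mass_le {d : ℕ} (D : Measure (Vec d)) [IsProbabilityMeasure D] :
    draw D Set.univ ≤ 1 :=
  map_mass_le prob_le_one (by fun_prop)

end Primitives

/-! ### Values and running times of the deterministic computations -/

namespace Timed

@[simp] theorem bind_val {α β : Type} (m : Timed α) (f : α → Timed β) :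
    (m >>= f).val = (f m.val).val := rfl
@[simp] theorem bind_ops {α β : Type} (m : Timed α) (f : α → Timed β) :
    (m >>= f).ops = m.ops + (f m.val).ops := rfl
@[simp] theorem pure_val {α : Type} (a : α) : (pure a : Timed α).val = a := rfl
@[simp] theorem pure_ops {α : Type} (a : α) : (pure a : Timed α).ops = 0 := rfl

variable {d n : ℕ}

@[simp] theorem dot_val (u v : Vec d) : (dot u v).val = u ⬝ᵥ v := rfl
@[simp] theorem dot_ops (u v : Vec d) : (dot u v).ops = 2 * d := by
  simp [dot, sum, mul, mul_comm]

@[simp] theorem tabulate_val {α : Type} (f : Fin n → Timed α) :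
    (tabulate f).val = fun i => (f i).val := rfl
theorem tabulate_ops {α : Type} (f : Fin n → Timed α) {k : ℕ} (h : ∀ i, (f i).ops = k) :
    (tabulate f).ops = n * (k + 1) := by
  simp [tabulate, h]

@[simp] theorem mulVec_val (M : Mat d) (v : Vec d) : (mulVec M v).val = M.mulVec v := rfl
@[simp] theorem mulVec_ops (M : Mat d) (v : Vec d) : (mulVec M v).ops = d * (2 * d + 1) :=
  tabulate_ops _ fun _ => dot_ops _ _

@[simp] theorem vecMul_val (M : Mat d) (v : Vec d) : (vecMul v M).val = Matrix.vecMul v M := rfl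
@[simp] theorem vecMul_ops (M : Mat d) (v : Vec d) : (vecMul v M).ops = d * (2 * d + 1) :=
  tabulate_ops _ fun i => by simp [sum, mul, mul_comm]

@[simp] theorem quad_val (M : Mat d) (x : Vec d) : (quad M x).val = x ⬝ᵥ M.mulVec x := rfl
@[simp] theorem quad_ops (M : Mat d) (x : Vec d) : (quad M x).ops = d * (2 * d + 1) + 2 * d := by
  simp [quad]

theorem rankOne_val (M : Mat d) (u v : Vec d) :
    (rankOne M u v).val =
      (Matrix.of fun i j => M i j - M.mulVec u i * Matrix.vecMul v M j / (1 + v ⬝ᵥ M.mulVec u),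
        1 + v ⬝ᵥ M.mulVec u) := rfl

@[simp] theorem rankOne_ops (M : Mat d) (u v : Vec d) :
    (rankOne M u v).ops = 2 * (d * (2 * d + 1)) + 2 * d + 1 + d * (4 * d + 1) := by
  simp only [rankOne, bind_ops, mulVec_ops, vecMul_ops, dot_ops, pure_ops]
  rw [tabulate_ops _ (k := d * 4) fun i => tabulate_ops _ (k := 3) fun j => rfl]
  simp only [add]
  ring

theorem gram_val (y : Fin n → Vec d) :
    (gram y).val = ∑ k, Matrix.vecMulVec (y k) (y k) := by
  ext i j
  simp only [Matrix.sum_apply, Matrix.vecMulVec_apply]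
  rfl

@[simp] theorem gram_ops (y : Fin n → Vec d) : (gram y).ops = d * (d * (2 * n + 1) + 1) :=
  tabulate_ops _ fun i => tabulate_ops _ fun j => by simp [sum, mul, mul_comm]

theorem invDetStep_val (A : Mat d) (st : Mat d × ℝ) (k : Fin d) :
    (invDetStep A st k).val =
      ((rankOne st.1 (Pi.single k 1) (A k - Pi.single k 1)).val.1,
        st.2 * (rankOne st.1 (Pi.single k 1) (A k - Pi.single k 1)).val.2) := by
  have h1 : (fun i => if i = k then (1 : ℝ) else 0) = Pi.single k 1 := by
    ext i; simp [Pi.single_apply]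
  rw [← h1]; rfl

theorem invDetStep_ops (A : Mat d) (st : Mat d × ℝ) (k : Fin d) :
    (invDetStep A st k).ops =
      3 * d + (2 * (d * (2 * d + 1)) + 2 * d + 1 + d * (4 * d + 1)) + 1 := by
  simp only [invDetStep, bind_ops, rankOne_ops, pure_ops]
  rw [tabulate_ops _ (k := 0) fun i => rfl, tabulate_ops _ (k := 1) fun i => rfl]
  simp only [mul]
  ring

theorem foldlM_ops {σ ι : Type} (g : σ → ι → Timed σ) {k : ℕ} (h : ∀ s i, (g s i).ops = k)
    (l : List ι) (s : σ) : (l.foldlM g s).ops = l.length * k := by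
  induction l generalizing s with
  | nil => simp
  | cons i l ih => simp [List.foldlM_cons, h, ih]; ring

theorem invDet_ops (A : Mat d) :
    (invDet A).ops = d * (d + 1) +
      d * (3 * d + (2 * (d * (2 * d + 1)) + 2 * d + 1 + d * (4 * d + 1)) + 1) := by
  simp only [invDet, bind_ops]
  rw [foldlM_ops _ (invDetStep_ops A), tabulate_ops _ (k := d) fun i => ?_]
  · simp
  · rw [tabulate_ops _ (k := 0) fun j => rfl]; simp

end Timed

open Matrix

/-! ### Linear algebra -/

section LinearAlgebra

variable {d n : ℕ}

/-- The matrix determinant lemma for a rank-one update. -/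
theorem det_add_vecMulVec {B : Mat d} (hB : B.det ≠ 0) (u v : Vec d) :
    (B + vecMulVec u v).det = B.det * (1 + v ⬝ᵥ B⁻¹ *ᵥ u) := by
  rw [vecMulVec_eq Unit, det_add_replicateCol_mul_replicateRow (isUnit_iff_ne_zero.mpr hB),
    Matrix.mul_assoc, det_unique (n := Unit), Matrix.add_apply, Matrix.one_apply_eq]
  rfl

/-- The **Sherman–Morrison formula**. -/
theorem inv_add_vecMulVec {B : Mat d} (hB : B.det ≠ 0) {u v : Vec d}
    (hc : 1 + v ⬝ᵥ B⁻¹ *ᵥ u ≠ 0) :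
    (B + vecMulVec u v)⁻¹ =
      B⁻¹ - (1 + v ⬝ᵥ B⁻¹ *ᵥ u)⁻¹ • vecMulVec (B⁻¹ *ᵥ u) (v ᵥ* B⁻¹) := by
  have hB' : IsUnit B.det := isUnit_iff_ne_zero.mpr hB
  refine inv_eq_right_inv ?_
  set c := 1 + v ⬝ᵥ B⁻¹ *ᵥ u with hcdef
  have h1 : B * vecMulVec (B⁻¹ *ᵥ u) (v ᵥ* B⁻¹) = vecMulVec u (v ᵥ* B⁻¹) := by
    rw [mul_vecMulVec, mulVec_mulVec, mul_nonsing_inv _ hB', one_mulVec]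
  have h2 : vecMulVec u v * vecMulVec (B⁻¹ *ᵥ u) (v ᵥ* B⁻¹) =
      (c - 1) • vecMulVec u (v ᵥ* B⁻¹) := by
    rw [vecMulVec_mul_vecMulVec, hcdef, add_sub_cancel_left, vecMulVec_smul]
  rw [Matrix.add_mul, Matrix.mul_sub, Matrix.mul_sub, mul_nonsing_inv _ hB', Matrix.mul_smul,
    Matrix.mul_smul, h1, h2, vecMulVec_mul, smul_smul, mul_sub, inv_mul_cancel₀ hc, sub_smul]
  simp

theorem Timed.rankOne_val_of_inv {B : Mat d} (hB : B.det ≠ 0) {u v : Vec d}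
    (hc : (B + vecMulVec u v).det ≠ 0) :
    (Timed.rankOne B⁻¹ u v).val.1 = (B + vecMulVec u v)⁻¹ := by
  rw [det_add_vecMulVec hB] at hc
  rw [inv_add_vecMulVec hB (right_ne_zero_of_mul hc), Timed.rankOne_val]
  ext i j
  simp [vecMulVec_apply, div_eq_inv_mul]

theorem Timed.foldlM_val {σ ι : Type} (g : σ → ι → Timed σ) (l : List ι) (s : σ) :
    (l.foldlM g s).val = l.foldl (fun s i => (g s i).val) s := by
  induction l generalizing s with
  | nil => simp
  | cons i l ih => simp [List.foldlM_cons, ih]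

/-- The identity matrix with the rows in `s` replaced by those of `A`. -/
def replaceRows (A : Mat d) (s : Finset (Fin d)) : Mat d :=
  Matrix.of fun i => if i ∈ s then A i else Pi.single i 1

theorem replaceRows_empty (A : Mat d) : replaceRows A ∅ = 1 := by
  ext i j
  simp [replaceRows, Pi.single_apply, Matrix.one_apply, eq_comm]

theorem replaceRows_univ (A : Mat d) : replaceRows A Finset.univ = A := by
  ext i j
  simp [replaceRows]

theorem replaceRows_insert (A : Mat d) {s : Finset (Fin d)} {k : Fin d} (hk : k ∉ s) :
    replaceRows A (insert k s) =
      replaceRows A s + vecMulVec (Pi.single k 1) (A k - Pi.single k 1) := by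
  ext i j
  by_cases h : i = k
  · subst h
    simp [replaceRows, hk, vecMulVec_apply]
  · simp [replaceRows, h, vecMulVec_apply]

/-- A kernel vector `v` of the partially replaced matrix vanishes outside `s`, while `A v` vanishes
on `s`. Hence `vᵀ A v = 0`, and semidefiniteness gives `A v = 0`. So a zero pivot can occur only for
singular `A`, and no pivoting is needed. -/
theorem det_eq_zero_of_det_replaceRows {A : Mat d} (hA : A.PosSemidef) {s : Finset (Fin d)}
    (h : (replaceRows A s).det = 0) : A.det = 0 := by
  obtain ⟨v, hv, hv0⟩ := exists_mulVec_eq_zero_iff.mpr h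
  refine exists_mulVec_eq_zero_iff.mp ⟨v, hv, ?_⟩
  rw [← hA.dotProduct_mulVec_zero_iff, dotProduct]
  refine Finset.sum_eq_zero fun i _ => ?_
  have hi := congrFun hv0 i
  simp only [mulVec, replaceRows, of_apply, Pi.zero_apply] at hi
  split_ifs at hi with his
  · simp [mulVec, hi]
  · simp only [single_one_dotProduct] at hi
    simp [hi]

/-- The loop invariant has two branches: either inverse and determinant are correct for the rows
treated so far, or a zero pivot was met, so that the determinant stays `0` forever and `A` is
singular. -/
theorem foldl_invDetStep {A : Mat d} (hA : A.PosSemidef) (l : List (Fin d)) (hl : l.Nodup)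
    (s : Finset (Fin d)) (hs : ∀ i ∈ l, i ∉ s) (st : Mat d × ℝ)
    (hst : ((replaceRows A s).det ≠ 0 ∧ st.1 = (replaceRows A s)⁻¹ ∧
      st.2 = (replaceRows A s).det) ∨ (st.2 = 0 ∧ A.det = 0)) :
    ((replaceRows A (s ∪ l.toFinset)).det ≠ 0 ∧
        (l.foldl (fun st k => (Timed.invDetStep A st k).val) st).1 =
          (replaceRows A (s ∪ l.toFinset))⁻¹ ∧
        (l.foldl (fun st k => (Timed.invDetStep A st k).val) st).2 =
          (replaceRows A (s ∪ l.toFinset)).det) ∨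
      ((l.foldl (fun st k => (Timed.invDetStep A st k).val) st).2 = 0 ∧ A.det = 0) := by
  induction l generalizing s st with
  | nil => simpa using hst
  | cons k l ih =>
    have hk : k ∉ s := hs k (by simp)
    have hu : s ∪ (k :: l).toFinset = insert k s ∪ l.toFinset := by
      ext i; simp
    rw [List.foldl_cons, hu]
    refine ih hl.of_cons (insert k s) (fun i hi => ?_) _ ?_
    · rw [Finset.mem_insert, not_or]
      exact ⟨fun h => (List.nodup_cons.mp hl).1 (h ▸ hi), hs i (List.mem_cons_of_mem _ hi)⟩
    · rw [Timed.invDetStep_val]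
      rcases hst with ⟨h0, h1, h2⟩ | ⟨h1, h2⟩
      · rw [h1, h2]
        have hd : (replaceRows A s).det *
            (Timed.rankOne (replaceRows A s)⁻¹ (Pi.single k 1) (A k - Pi.single k 1)).val.2 =
              (replaceRows A (insert k s)).det := by
          rw [replaceRows_insert A hk, det_add_vecMulVec h0]
          rfl
        by_cases hz : (replaceRows A (insert k s)).det = 0
        · exact Or.inr ⟨hd.trans hz, det_eq_zero_of_det_replaceRows hA hz⟩
        · refine Or.inl ⟨hz, ?_, hd⟩
          rw [replaceRows_insert A hk] at hz ⊢
          exact Timed.rankOne_val_of_inv h0 hz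
      · exact Or.inr ⟨by simp [h1], h2⟩

theorem invDet_spec {A : Mat d} (hA : A.PosSemidef) :
    (A.det ≠ 0 ∧ (Timed.invDet A).val.1 = A⁻¹ ∧ (Timed.invDet A).val.2 = A.det) ∨
      ((Timed.invDet A).val.2 = 0 ∧ A.det = 0) := by
  have hI : (fun i j => if i = j then (1 : ℝ) else 0) = (1 : Mat d) := by
    ext i j; simp [Matrix.one_apply]
  have h := foldl_invDetStep hA (List.finRange d) (List.nodup_finRange d) ∅ (by simp) (1, 1)
    (Or.inl (by simp [replaceRows_empty]))
  have hv : (Timed.invDet A).val =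
      (List.finRange d).foldl (fun st k => (Timed.invDetStep A st k).val) (1, 1) := by
    rw [← Timed.foldlM_val, ← hI]; rfl
  have hu : ∅ ∪ (List.finRange d).toFinset = Finset.univ := by
    ext i; simp
  rwa [← hv, hu, replaceRows_univ] at h

theorem invDet_val_snd {A : Mat d} (hA : A.PosSemidef) : (Timed.invDet A).val.2 = A.det := by
  rcases invDet_spec hA with h | h
  · exact h.2.2
  · exact h.1.trans h.2.symm

theorem invDet_val_fst {A : Mat d} (hA : A.PosSemidef) (h0 : A.det ≠ 0) :
    (Timed.invDet A).val.1 = A⁻¹ := by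
  rcases invDet_spec hA with h | h
  · exact h.2.1
  · exact absurd h.2 h0

/-! ### Positive semidefinite matrices -/

open scoped MatrixOrder in
theorem exists_eq_conjTranspose_mul_self {A : Mat d} (hA : A.PosSemidef) :
    ∃ C : Mat d, A = Cᴴ * C :=
  CStarAlgebra.nonneg_iff_eq_star_mul_self.mp hA.nonneg

/-- With `A = Cᴴ C`, cyclicity turns the trace into that of the semidefinite matrix `C B Cᴴ`. -/
theorem trace_mul_nonneg {A B : Mat d} (hA : A.PosSemidef) (hB : B.PosSemidef) :
    0 ≤ (A * B).trace := by
  obtain ⟨C, rfl⟩ := exists_eq_conjTranspose_mul_self hA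
  rw [Matrix.mul_assoc, Matrix.trace_mul_comm]
  exact (hB.mul_mul_conjTranspose_same C).trace_nonneg

/-- The inequality of arithmetic and geometric means for the eigenvalues of a positive
semidefinite matrix. -/
theorem det_le_trace_div_pow (hd : 1 ≤ d) {A : Mat d} (hA : A.PosSemidef) :
    A.det ≤ (A.trace / d) ^ d := by
  have hd0 : (d : ℝ) ≠ 0 := by positivity
  rw [hA.isHermitian.det_eq_prod_eigenvalues, hA.isHermitian.trace_eq_sum_eigenvalues]
  simp only [RCLike.ofReal_real_eq_id, id]
  have hnn := hA.eigenvalues_nonneg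
  have h := Real.geom_mean_le_arith_mean_weighted Finset.univ (fun _ : Fin d => (d : ℝ)⁻¹)
    hA.isHermitian.eigenvalues (fun _ _ => by positivity) (by simp [hd0]) (fun i _ => hnn i)
  rw [← Finset.mul_sum, inv_mul_eq_div] at h
  calc ∏ i, hA.isHermitian.eigenvalues i
      = (∏ i, hA.isHermitian.eigenvalues i ^ (d : ℝ)⁻¹) ^ d := by
        rw [← Finset.prod_pow]
        refine Finset.prod_congr rfl fun i _ => ?_
        rw [← Real.rpow_natCast, ← Real.rpow_mul (hnn i), inv_mul_cancel₀ hd0, Real.rpow_one]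
    _ ≤ _ := pow_le_pow_left₀ (Finset.prod_nonneg fun i _ => Real.rpow_nonneg (hnn i) _) h d

/-- `S A` need not be symmetric, but with `S = Cᴴ C` it has the trace and determinant of the
semidefinite matrix `C A Cᴴ`. -/
theorem det_mul_le_trace_div_pow (hd : 1 ≤ d) {S A : Mat d} (hS : S.PosSemidef)
    (hA : A.PosSemidef) : (S * A).det ≤ ((S * A).trace / d) ^ d := by
  obtain ⟨C, rfl⟩ := exists_eq_conjTranspose_mul_self hS
  have h := det_le_trace_div_pow hd (hA.mul_mul_conjTranspose_same C)
  have hdet : (C * A * Cᴴ).det = (Cᴴ * C * A).det := by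
    simp only [det_mul]; ring
  rwa [hdet, Matrix.trace_mul_comm, ← Matrix.mul_assoc] at h

/-- The inverse is antitone on positive definite matrices. -/
theorem posSemidef_inv_sub_inv {A B : Mat d} (hA : A.PosDef) (hB : B.PosDef)
    (h : (B - A).PosSemidef) : (A⁻¹ - B⁻¹).PosSemidef := by
  refine PosSemidef.of_dotProduct_mulVec_nonneg
    (hA.inv.isHermitian.sub hB.inv.isHermitian) fun x => ?_
  have hAu : IsUnit A.det := (Matrix.isUnit_iff_isUnit_det _).mp hA.isUnit
  have hBu : IsUnit B.det := (Matrix.isUnit_iff_isUnit_det _).mp hB.isUnit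
  -- The proof is the identity `xᵀ (A⁻¹ - B⁻¹) x = (u - v)ᵀ A (u - v) + uᵀ (B - A) u`, a sum of two
  -- nonnegative terms.
  set u := B⁻¹ *ᵥ x with hu
  set v := A⁻¹ *ᵥ x with hv
  have hBu' : B *ᵥ u = x := by rw [hu, mulVec_mulVec, mul_nonsing_inv _ hBu, one_mulVec]
  have hAv : A *ᵥ v = x := by rw [hv, mulVec_mulVec, mul_nonsing_inv _ hAu, one_mulVec]
  have hsym : v ⬝ᵥ A *ᵥ u = u ⬝ᵥ x := by
    have hT : Aᵀ = A := hA.isHermitian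
    rw [dotProduct_mulVec, ← mulVec_transpose, hT, hAv, dotProduct_comm]
  have h1 := hA.posSemidef.dotProduct_mulVec_nonneg (u - v)
  have h2 := h.dotProduct_mulVec_nonneg u
  simp only [star_trivial, mulVec_sub, sub_mulVec, dotProduct_sub, sub_dotProduct, hAv, hBu',
    hsym] at h1 h2 ⊢
  rw [← hu, ← hv, dotProduct_comm x u, dotProduct_comm x v]
  linarith

/-! ### Gram matrices -/

/-- `∑ₖ yₖ yₖᵀ`. -/
def gramMat (y : Fin n → Vec d) : Mat d := ∑ k, vecMulVec (y k) (y k)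

theorem posSemidef_vecMulVec_self (x : Vec d) : (vecMulVec x x).PosSemidef :=
  posSemidef_vecMulVec_self_star x

theorem posSemidef_gramMat (y : Fin n → Vec d) : (gramMat y).PosSemidef :=
  posSemidef_sum _ fun k _ => posSemidef_vecMulVec_self (y k)

theorem gramMat_det_nonneg (y : Fin n → Vec d) : 0 ≤ (gramMat y).det :=
  (posSemidef_gramMat y).det_nonneg

theorem gramMat_removeNth (y : Fin (n + 1) → Vec d) (p : Fin (n + 1)) :
    gramMat (fun i => y (p.succAbove i)) = gramMat y + vecMulVec (-y p) (y p) := by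
  simp [gramMat, Fin.sum_univ_succAbove _ p, neg_vecMulVec]

theorem det_gramMat_removeNth {y : Fin (n + 1) → Vec d} (h : (gramMat y).det ≠ 0)
    (p : Fin (n + 1)) :
    (gramMat fun i => y (p.succAbove i)).det =
      (gramMat y).det * (1 - y p ⬝ᵥ (gramMat y)⁻¹ *ᵥ y p) := by
  rw [gramMat_removeNth, det_add_vecMulVec h, mulVec_neg, dotProduct_neg, sub_eq_add_neg]

/-- The quadratic form of a Gram matrix only decreases when a point is deleted, so a kernel vector
stays in the kernel. -/
theorem det_gramMat_removeNth_of_eq_zero {y : Fin (n + 1) → Vec d} (h : (gramMat y).det = 0)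
    (p : Fin (n + 1)) : (gramMat fun i => y (p.succAbove i)).det = 0 := by
  obtain ⟨v, hv, hv0⟩ := exists_mulVec_eq_zero_iff.mpr h
  refine exists_mulVec_eq_zero_iff.mp ⟨v, hv, ?_⟩
  have hsum : gramMat y =
      gramMat (fun i => y (p.succAbove i)) + vecMulVec (y p) (y p) := by
    rw [gramMat_removeNth, neg_vecMulVec]; simp
  have h0 : v ⬝ᵥ gramMat y *ᵥ v = 0 := by simp [hv0]
  rw [hsum, add_mulVec, dotProduct_add] at h0
  have h1 := (posSemidef_gramMat fun i => y (p.succAbove i)).dotProduct_mulVec_nonneg v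
  have h2 := (posSemidef_vecMulVec_self (y p)).dotProduct_mulVec_nonneg v
  rw [← (posSemidef_gramMat _).dotProduct_mulVec_zero_iff]
  simp only [star_trivial] at h1 h2 ⊢
  linarith

theorem trace_mul_vecMulVec (S : Mat d) (x : Vec d) :
    (S * vecMulVec x x).trace = x ⬝ᵥ S *ᵥ x := by
  rw [mul_vecMulVec, trace_vecMulVec, dotProduct_comm]

theorem sum_quad_eq_trace (S : Mat d) (y : Fin n → Vec d) :
    ∑ k, y k ⬝ᵥ S *ᵥ y k = (S * gramMat y).trace := by
  simp_rw [gramMat, Matrix.mul_sum, trace_sum, trace_mul_vecMulVec]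

/-- The scores add up to the trace of the identity. The success probability of a removal trial is
therefore the same for all nonsingular pools of a given size, which makes the cost independent of
the output. -/
theorem sum_leverage {y : Fin n → Vec d} (h : (gramMat y).det ≠ 0) :
    ∑ k, y k ⬝ᵥ (gramMat y)⁻¹ *ᵥ y k = d := by
  rw [sum_quad_eq_trace, nonsing_inv_mul _ (isUnit_iff_ne_zero.mpr h)]
  simp

theorem leverage_nonneg (y : Fin n → Vec d) (x : Vec d) : 0 ≤ x ⬝ᵥ (gramMat y)⁻¹ *ᵥ x :=
  (posSemidef_gramMat y).inv.dotProduct_mulVec_nonneg x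

theorem leverage_le_one {y : Fin (n + 1) → Vec d} (h : (gramMat y).det ≠ 0) (p : Fin (n + 1)) :
    y p ⬝ᵥ (gramMat y)⁻¹ *ᵥ y p ≤ 1 := by
  have h1 := gramMat_det_nonneg fun i => y (p.succAbove i)
  rw [det_gramMat_removeNth h] at h1
  have h2 : 0 < (gramMat y).det := lt_of_le_of_ne (gramMat_det_nonneg y) h.symm
  linarith [nonneg_of_mul_nonneg_right h1 h2]

end LinearAlgebra

/-! ### Volume sampling from a pool -/

section ReverseSampling

variable {d n : ℕ} {γ : Type} [MeasurableSpace γ]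

theorem measurable_quad {M : γ → Mat d} (hM : ∀ i j, Measurable fun c => M c i j)
    {x : γ → Vec d} (hx : Measurable x) : Measurable fun c => x c ⬝ᵥ M c *ᵥ x c := by
  simp only [mulVec, dotProduct]
  have hx' : ∀ i, Measurable fun c => x c i := fun i => (measurable_pi_apply i).comp hx
  fun_prop

theorem measurable_rankOne {M : γ → Mat d} (hM : ∀ i j, Measurable fun c => M c i j)
    {u v : γ → Vec d} (hu : Measurable u) (hv : Measurable v) :
    (∀ i j, Measurable fun c => (Timed.rankOne (M c) (u c) (v c)).val.1 i j) ∧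
      Measurable fun c => (Timed.rankOne (M c) (u c) (v c)).val.2 := by
  have hu' : ∀ i, Measurable fun c => u c i := fun i => (measurable_pi_apply i).comp hu
  have hv' : ∀ i, Measurable fun c => v c i := fun i => (measurable_pi_apply i).comp hv
  simp only [Timed.rankOne_val, of_apply, mulVec, vecMul, dotProduct]
  constructor <;> fun_prop

/-- Argued along the loop and not through `invDet_spec`: measurability is also needed at singular
matrices, where the first component is not the inverse. -/
theorem measurable_invDet {A : γ → Mat d} (hA : ∀ i j, Measurable fun c => A c i j) :
    (∀ i j, Measurable fun c => (Timed.invDet (A c)).val.1 i j) ∧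
      Measurable fun c => (Timed.invDet (A c)).val.2 := by
  have key : ∀ (l : List (Fin d)) (st : γ → Mat d × ℝ),
      (∀ i j, Measurable fun c => (st c).1 i j) → (Measurable fun c => (st c).2) →
      (∀ i j, Measurable fun c =>
        (l.foldl (fun s k => (Timed.invDetStep (A c) s k).val) (st c)).1 i j) ∧
      Measurable fun c => (l.foldl (fun s k => (Timed.invDetStep (A c) s k).val) (st c)).2 := by
    intro l
    induction l with
    | nil => exact fun st h1 h2 => ⟨h1, h2⟩
    | cons k l ih =>
      intro st h1 h2
      have h := measurable_rankOne (M := fun c => (st c).1) (u := fun _ => Pi.single k 1)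
        (v := fun c => A c k - Pi.single k 1) h1 measurable_const
        ((measurable_pi_iff.mpr fun j => hA k j).sub_const _)
      simp only [List.foldl_cons]
      refine ih (fun c => (Timed.invDetStep (A c) (st c) k).val) ?_ ?_
      · simp only [Timed.invDetStep_val]
        exact h.1
      · simp only [Timed.invDetStep_val]
        exact h2.mul h.2
  have h := key (List.finRange d) (fun _ => (fun i j => if i = j then (1 : ℝ) else 0, 1))
    (fun i j => measurable_const) measurable_const
  simp only [← Timed.foldlM_val] at h
  exact h

theorem measurable_gramMat {y : γ → Fin n → Vec d} (hy : Measurable y) (i j : Fin d) :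
    Measurable fun c => gramMat (y c) i j := by
  have hy' : ∀ k i, Measurable fun c => y c k i := fun k i =>
    (measurable_pi_apply i).comp ((measurable_pi_apply k).comp hy)
  simp only [gramMat, Matrix.sum_apply, vecMulVec_apply]
  fun_prop

theorem measurable_det {A : γ → Mat d} (hA : ∀ i j, Measurable fun c => A c i j) :
    Measurable fun c => (A c).det := by
  simp only [Matrix.det_apply, Units.smul_def, zsmul_eq_mul]
  fun_prop

/-- The number of operations of a trial of the removal step. -/
def removalOps (d : ℕ) : ℕ := d * (2 * d + 1) + 2 * d + 3

theorem isProg_removalTrial {M : γ → Mat d} (hM : ∀ i j, Measurable fun c => M c i j)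
    {y : γ → Fin n → Vec d} (hy : Measurable y) :
    IsProg fun c => removalTrial (M c) (y c) := by
  refine IsProg.andThen ⟨measurable_const, fun _ => randIndex_mass_le n⟩ ?_
  refine IsProg.compute ?_ ?_
  · simp only [Timed.bind_ops, Timed.quad_ops, Timed.sub]
    exact measurable_const
  · have hq : Measurable fun p : γ × Fin n =>
        (Timed.sub 1 (Timed.quad (M p.1) (y p.1 p.2)).val).val := by
      refine Measurable.const_sub (measurable_from_prod_countable_left fun i => ?_) 1
      exact measurable_quad hM ((measurable_pi_apply i).comp hy)
    exact (isProg_coin.comp hq).andThen (IsProg.ret (by fun_prop))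

variable (e : ℕ) (b : ENNReal)

theorem transform_removalTrial (M : Mat d) (y : Fin n → Vec d)
    (h0 : ∀ p, 0 ≤ y p ⬝ᵥ M *ᵥ y p) (h1 : ∀ p, y p ⬝ᵥ M *ᵥ y p ≤ 1)
    (f : Bool × Fin n → ENNReal) :
    transform e b (removalTrial M y) f =
      b ^ removalOps d * ((n : ENNReal)⁻¹ * ∑ p,
        (ENNReal.ofReal (1 - y p ⬝ᵥ M *ᵥ y p) * f (true, p) +
          ENNReal.ofReal (y p ⬝ᵥ M *ᵥ y p) * f (false, p))) := by
  have hf : Measurable f := Measurable.of_discrete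
  have hprog : IsProg fun p : Fin n => (compute (do
      let l ← Timed.quad M (y p)
      Timed.sub 1 l) fun q => andThen (coin q) fun a => ret (a, p) : RandProg (Bool × Fin n)) :=
    IsProg.compute Measurable.of_discrete (IsProg.andThen (isProg_coin.comp Measurable.of_discrete)
      (IsProg.ret (by fun_prop)))
  rw [removalTrial, transform_andThen e b _ hprog hf, transform_randIndex]
  have hp : ∀ p, transform e b (compute (do
      let l ← Timed.quad M (y p)
      Timed.sub 1 l) fun q => andThen (coin q) fun a => ret (a, p)) f =
      b ^ (d * (2 * d + 1) + 2 * d + 1) * (b * (ENNReal.ofReal (1 - y p ⬝ᵥ M *ᵥ y p) * f (true, p) +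
          ENNReal.ofReal (y p ⬝ᵥ M *ᵥ y p) * f (false, p))) := by
    intro p
    rw [transform_compute e b _ _ hf, transform_andThen e b _ (IsProg.ret (by fun_prop)) hf]
    simp only [Timed.bind_ops, Timed.quad_ops, Timed.bind_val, Timed.quad_val, Timed.sub]
    rw [transform_coin e b (by linarith [h1 p]) (by linarith [h0 p])]
    simp only [transform_ret e b _ hf, sub_sub_cancel]
  simp_rw [hp, ← mul_assoc, ← Finset.mul_sum, removalOps]
  ring

/-- The factor that a removal step contributes to the transform. -/
def removalFactor (d : ℕ) (b : ENNReal) (r : ℕ) : ENNReal :=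
  b ^ (2 * d + (2 * (d * (2 * d + 1)) + 2 * d + 1 + d * (4 * d + 1)) + (d + r + 1)) *
    ((1 - b ^ removalOps d * (d / (d + r + 1)))⁻¹ *
      (b ^ removalOps d * ((r + 1) / (d + r + 1))))

theorem transform_removal {y : Fin (n + 1) → Vec d} (h : (gramMat y).det ≠ 0)
    (f : Fin (n + 1) → ENNReal) :
    transform e b (repeatUntil (removalTrial (gramMat y)⁻¹ y)) f =
      (1 - b ^ removalOps d * (d / (n + 1)))⁻¹ *
        (b ^ removalOps d * ((n + 1 : ENNReal)⁻¹ *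
          ∑ p, ENNReal.ofReal (1 - y p ⬝ᵥ (gramMat y)⁻¹ *ᵥ y p) * f p)) := by
  have h0 := fun p => leverage_nonneg y (y p)
  have h1 := leverage_le_one h
  have hm : IsProg fun _ : Unit => removalTrial (gramMat y)⁻¹ y :=
    isProg_removalTrial (M := fun _ => (gramMat y)⁻¹) (y := fun _ => y)
      (fun _ _ => measurable_const) measurable_const
  have hF := transform_removalTrial e b _ y h0 h1 fun z => if z.1 = false then 1 else 0
  have hT := transform_removalTrial e b _ y h0 h1 fun z => if z.1 = true then f z.2 else 0
  simp only [Bool.true_eq_false, Bool.false_eq_true, if_true, if_false, mul_zero, mul_one, zero_add,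
    add_zero] at hF hT
  have hs : (((n + 1 : ℕ) : ENNReal)⁻¹ * ∑ p, ENNReal.ofReal (y p ⬝ᵥ (gramMat y)⁻¹ *ᵥ y p)) =
      d / (n + 1) := by
    rw [← ENNReal.ofReal_sum_of_nonneg fun p _ => h0 p, sum_leverage h, ENNReal.ofReal_natCast,
      mul_comm, div_eq_mul_inv, Nat.cast_add, Nat.cast_one]
  rw [transform_repeatUntil e b (hm.mass_le ()) (f := f) Measurable.of_discrete, hF, hT, hs,
    Nat.cast_add, Nat.cast_one]

theorem isProg_reverseSampling (r : ℕ) {γ : Type} [MeasurableSpace γ] {M : γ → Mat d}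
    (hM : ∀ i j, Measurable fun c => M c i j)
    {z : γ → Fin (d + r) → Vec d × Vec d} (hz : Measurable z) :
    IsProg fun c => reverseSampling r (M c) (z c) := by
  induction r generalizing γ with
  | zero =>
    refine IsProg.ret (f := fun c i => (z c i).1) ?_
    exact measurable_pi_iff.mpr fun i => measurable_fst.comp ((measurable_pi_apply i).comp hz)
  | succ r ih =>
    have hz' : ∀ i, Measurable fun c => z c i := fun i => (measurable_pi_apply i).comp hz
    refine IsProg.andThen (IsProg.repeatUntil (isProg_removalTrial hM
      (measurable_pi_iff.mpr fun i => measurable_snd.comp (hz' i)))) ?_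
    have hy : Measurable fun p : γ × Fin (d + r + 1) => (z p.1 p.2).2 :=
      measurable_from_prod_countable_left fun i => measurable_snd.comp (hz' i)
    refine IsProg.compute ?_ (IsProg.charge (ih ?_ ?_) measurable_const)
    · simp only [Timed.bind_ops, Timed.rankOne_ops]
      have ht : ∀ v : Vec d, (Timed.tabulate fun i => Timed.sub 0 (v i)).ops = d * 2 := fun v =>
        Timed.tabulate_ops _ fun _ => rfl
      simp_rw [ht]
      exact measurable_const
    · refine (measurable_rankOne (M := fun p : γ × Fin (d + r + 1) => M p.1)
        (fun i j => (hM i j).comp measurable_fst) ?_ hy).1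
      exact measurable_pi_iff.mpr fun i => Measurable.const_sub ((measurable_pi_apply i).comp hy) 0
    · exact measurable_pi_iff.mpr fun i => measurable_from_prod_countable_left fun p =>
        hz' (p.succAbove i)

/-- The transform of reverse iterative sampling from `z`, weighted with the determinant of the
Gram matrix of the pool. -/
def poolTransform (r : ℕ) (f : (Fin d → Vec d) → ENNReal) (z : Fin (d + r) → Vec d × Vec d) :
    ENNReal :=
  ENNReal.ofReal (gramMat fun i => (z i).2).det *
    transform e b (reverseSampling r (gramMat fun i => (z i).2)⁻¹ z) f

theorem poolTransform_zero {f : (Fin d → Vec d) → ENNReal} (hf : Measurable f)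
    (z : Fin d → Vec d × Vec d) :
    poolTransform e b 0 f z =
      ENNReal.ofReal (gramMat fun i => (z i).2).det * f fun i => (z i).1 := by
  rw [poolTransform, reverseSampling, transform_ret e b _ hf]; rfl

/-- The weight `det G` times the acceptance probability `1 - yₚᵀ G⁻¹ yₚ` is the determinant of the
Gram matrix without `p`, that is, the weight of the smaller pool. After the normalization by the
success probability `(r + 1) / (d + r + 1)`, every index `p` enters with the same coefficient. -/
theorem poolTransform_succ (r : ℕ) {f : (Fin d → Vec d) → ENNReal} (hf : Measurable f)
    (z : Fin (d + (r + 1)) → Vec d × Vec d) :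
    poolTransform e b (r + 1) f z =
      removalFactor d b r * (r + 1 : ENNReal)⁻¹ *
        ∑ p : Fin (d + r + 1), poolTransform e b r f fun i => z (p.succAbove i) := by
  set y : Fin (d + r + 1) → Vec d := fun i => (z i).2 with hy
  -- On singular pools the program may do anything: the weight vanishes on both sides.
  by_cases h : (gramMat y).det = 0
  · have hs : ∀ p : Fin (d + r + 1), poolTransform e b r f (fun i => z (p.succAbove i)) = 0 := by
      intro p
      rw [poolTransform, det_gramMat_removeNth_of_eq_zero h p]; simp
    rw [poolTransform, Finset.sum_eq_zero fun p _ => hs p, mul_zero]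
    erw [h]; simp
  have hdet : 0 < (gramMat y).det := lt_of_le_of_ne (gramMat_det_nonneg y) (Ne.symm h)
  have hprog : IsProg fun p : Fin (d + r + 1) => (compute (do
        let u ← Timed.tabulate fun i => Timed.sub 0 ((z p).2 i)
        Timed.rankOne (gramMat y)⁻¹ u (z p).2) fun N =>
      charge (0, d + r + 1) (reverseSampling r N.1 fun i : Fin (d + r) => z (p.succAbove i)) :
        RandProg (Fin d → Vec d)) := by
    refine IsProg.compute Measurable.of_discrete (IsProg.charge (isProg_reverseSampling r
      (fun _ _ => Measurable.of_discrete) Measurable.of_discrete) measurable_const)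
  have hstep : ∀ p : Fin (d + r + 1), transform e b (compute (do
        let u ← Timed.tabulate fun i => Timed.sub 0 ((z p).2 i)
        Timed.rankOne (gramMat y)⁻¹ u (z p).2) fun N =>
      charge (0, d + r + 1) (reverseSampling r N.1 fun i : Fin (d + r) => z (p.succAbove i))) f =
      b ^ (2 * d + (2 * (d * (2 * d + 1)) + 2 * d + 1 + d * (4 * d + 1)) + (d + r + 1)) *
        transform e b (reverseSampling r (Timed.rankOne (gramMat y)⁻¹ (-y p) (y p)).val.1
          fun i : Fin (d + r) => z (p.succAbove i)) f := by
    intro p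
    rw [transform_compute e b _ _ hf, transform_charge e b _ _ hf, ← mul_assoc, ← pow_add,
      Timed.bind_ops, Timed.rankOne_ops, Timed.tabulate_ops _ (k := 1) fun i => rfl]
    congr 2
    · ring
    · have : (fun i => 0 - (z p).2 i) = -y p := by ext i; simp [hy]
      rw [← this]; rfl
  have hterm : ∀ p : Fin (d + r + 1), ENNReal.ofReal (gramMat y).det *
      (ENNReal.ofReal (1 - y p ⬝ᵥ (gramMat y)⁻¹ *ᵥ y p) *
        transform e b (reverseSampling r (Timed.rankOne (gramMat y)⁻¹ (-y p) (y p)).val.1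
          fun i : Fin (d + r) => z (p.succAbove i)) f) =
      poolTransform e b r f fun i => z (p.succAbove i) := by
    intro p
    rw [poolTransform, ← mul_assoc, ← ENNReal.ofReal_mul hdet.le, ← det_gramMat_removeNth h]
    -- Sherman–Morrison fails exactly when the remaining pool is singular, and then `p` is accepted
    -- with probability zero.
    by_cases hp : (gramMat fun i => y (p.succAbove i)).det = 0
    · rw [hp]; simp
    · have h2 := hp
      rw [gramMat_removeNth] at h2
      rw [Timed.rankOne_val_of_inv h h2, ← gramMat_removeNth]
  have hpow : transform e b (reverseSampling (r + 1) (gramMat y)⁻¹ z) f =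
      transform e b (repeatUntil (removalTrial (gramMat y)⁻¹ y)) fun p =>
      b ^ (2 * d + (2 * (d * (2 * d + 1)) + 2 * d + 1 + d * (4 * d + 1)) + (d + r + 1)) *
        transform e b (reverseSampling r (Timed.rankOne (gramMat y)⁻¹ (-y p) (y p)).val.1
          fun i : Fin (d + r) => z (p.succAbove i)) f := by
    rw [reverseSampling, transform_andThen e b _ hprog hf]
    simp_rw [hstep]
    rfl
  have hr : (r + 1 : ENNReal)⁻¹ * (r + 1) = 1 :=
    ENNReal.inv_mul_cancel (by simp) (by simp)
  rw [poolTransform]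
  change ENNReal.ofReal (gramMat y).det *
    transform e b (reverseSampling (r + 1) (gramMat y)⁻¹ z) f = _
  rw [hpow, transform_removal e b h]
  simp_rw [← hterm]
  rw [← Finset.mul_sum, removalFactor]
  have hcomm : ∀ p : Fin (d + r + 1), ENNReal.ofReal (1 - y p ⬝ᵥ (gramMat y)⁻¹ *ᵥ y p) *
      (b ^ (2 * d + (2 * (d * (2 * d + 1)) + 2 * d + 1 + d * (4 * d + 1)) + (d + r + 1)) *
        transform e b (reverseSampling r (Timed.rankOne (gramMat y)⁻¹ (-y p) (y p)).val.1
          fun i : Fin (d + r) => z (p.succAbove i)) f) =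
      b ^ (2 * d + (2 * (d * (2 * d + 1)) + 2 * d + 1 + d * (4 * d + 1)) + (d + r + 1)) *
        (ENNReal.ofReal (1 - y p ⬝ᵥ (gramMat y)⁻¹ *ᵥ y p) *
        transform e b (reverseSampling r (Timed.rankOne (gramMat y)⁻¹ (-y p) (y p)).val.1
          fun i : Fin (d + r) => z (p.succAbove i)) f) := fun p => by ring
  simp_rw [hcomm]
  rw [← Finset.mul_sum]
  simp only [Nat.cast_add]
  rw [div_eq_mul_inv (r + 1 : ENNReal)]
  generalize (∑ p : Fin (d + r + 1), _ : ENNReal) = s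
  generalize (1 - b ^ removalOps d * (d / (d + r + 1)))⁻¹ = t
  calc _ = (b ^ (2 * d + (2 * (d * (2 * d + 1)) + 2 * d + 1 + d * (4 * d + 1)) + (d + r + 1)) *
      (t * (b ^ removalOps d * ((d + r + 1 : ENNReal)⁻¹)))) *
        (ENNReal.ofReal (gramMat y).det * s) := by ring
    _ = (b ^ (2 * d + (2 * (d * (2 * d + 1)) + 2 * d + 1 + d * (4 * d + 1)) + (d + r + 1)) *
      (t * (b ^ removalOps d * ((d + r + 1 : ENNReal)⁻¹)))) *
        (ENNReal.ofReal (gramMat y).det * s) * ((r + 1 : ENNReal)⁻¹ * (r + 1)) := by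
        rw [hr, mul_one]
    _ = _ := by ring

theorem sum_det_gramMat_removeNth (y : Fin (n + 1) → Vec d) :
    ∑ p : Fin (n + 1), (gramMat fun i => y (p.succAbove i)).det =
      (n + 1 - d) * (gramMat y).det := by
  by_cases h : (gramMat y).det = 0
  · rw [h, Finset.sum_eq_zero fun p _ => det_gramMat_removeNth_of_eq_zero h p, mul_zero]
  · simp_rw [det_gramMat_removeNth h, ← Finset.mul_sum, Finset.sum_sub_distrib, sum_leverage h]
    simp [mul_comm]

end ReverseSampling

/-! ### Averages over pools of independent points -/

section PoolAverages

variable {d : ℕ}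

/-- The law of an i.i.d. pool with one point deleted does not depend on which index was deleted. -/
theorem lintegral_removeNth {X : Type} [MeasurableSpace X] (ν : Measure X) [IsProbabilityMeasure ν]
    {n : ℕ} (p : Fin (n + 1)) {g : (Fin n → X) → ENNReal} (hg : Measurable g) :
    ∫⁻ z, g (fun i => z (p.succAbove i)) ∂(Measure.pi fun _ : Fin (n + 1) => ν) =
      ∫⁻ z, g z ∂(Measure.pi fun _ : Fin n => ν) :=
  (measurePreserving_snd.comp (measurePreserving_piFinSuccAbove (fun _ => ν) p)).lintegral_comp hg

theorem measurable_inv_apply {γ : Type} [MeasurableSpace γ] {A : γ → Mat d}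
    (hA : ∀ i j, Measurable fun c => A c i j) (i j : Fin d) :
    Measurable fun c => (A c)⁻¹ i j := by
  simp only [Matrix.inv_def, Ring.inverse_eq_inv', Matrix.smul_apply, smul_eq_mul, adjugate_apply]
  refine (measurable_det hA).inv.mul (measurable_det fun k l => ?_)
  by_cases h : k = j
  · subst h; simp
  · simpa [updateRow_ne h] using hA k l

theorem measurable_det_gramMat_snd (n : ℕ) :
    Measurable fun z : Fin n → Vec d × Vec d => ENNReal.ofReal (gramMat fun i => (z i).2).det :=
  (measurable_det (measurable_gramMat (y := fun z : Fin n → Vec d × Vec d => fun i => (z i).2)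
    (by fun_prop))).ennreal_ofReal

variable (e : ℕ) (b : ENNReal)

theorem measurable_poolTransform (r : ℕ) {f : (Fin d → Vec d) → ENNReal} (hf : Measurable f) :
    Measurable (poolTransform e b r f) := by
  have hy : Measurable fun z : Fin (d + r) → Vec d × Vec d => fun i => (z i).2 := by fun_prop
  exact (measurable_det_gramMat_snd (d + r)).mul
    ((isProg_reverseSampling r (measurable_inv_apply (measurable_gramMat hy))
      measurable_id).measurable_transform e b hf)

theorem choose_add_succ (r : ℕ) :
    (((d + (r + 1)).choose d : ℕ) : ENNReal) =
      (r + 1 : ENNReal)⁻¹ * (d + r + 1) * ((d + r).choose d : ℕ) := by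
  have h := Nat.choose_mul_succ_eq (d + r) d
  rw [show d + r + 1 - d = r + 1 by omega] at h
  have h' : (((d + r).choose d : ℕ) : ENNReal) * (d + r + 1) =
      ((d + (r + 1)).choose d : ℕ) * (r + 1) := by exact_mod_cast h
  rw [mul_assoc, mul_comm (d + r + 1 : ENNReal), h', mul_comm _ (r + 1 : ENNReal), ← mul_assoc,
    ENNReal.inv_mul_cancel (by simp) (by simp), one_mul]

/-- By exchangeability the `d + r + 1` terms of `poolTransform_succ` have the same integral. Each
step thus contributes `(d + r + 1) / (r + 1)` besides the cost factor, and these ratios multiply up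
to the binomial coefficient. -/
theorem lintegral_poolTransform (ν : Measure (Vec d × Vec d)) [IsProbabilityMeasure ν] (r : ℕ)
    {f : (Fin d → Vec d) → ENNReal} (hf : Measurable f) :
    ∫⁻ z, poolTransform e b r f z ∂(Measure.pi fun _ : Fin (d + r) => ν) =
      (∏ k ∈ Finset.range r, removalFactor d b k) * ((d + r).choose d : ℕ) *
        ∫⁻ z, ENNReal.ofReal (gramMat fun i => (z i).2).det * f (fun i => (z i).1)
          ∂(Measure.pi fun _ : Fin d => ν) := by
  induction r with
  | zero =>
    simp only [Finset.range_zero, Finset.prod_empty, add_zero, Nat.choose_self, Nat.cast_one,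
      one_mul]
    exact lintegral_congr fun z => poolTransform_zero e b hf z
  | succ r ih =>
    have hm : ∀ p : Fin (d + r + 1), Measurable fun z : Fin (d + r + 1) → Vec d × Vec d =>
        poolTransform e b r f fun i => z (p.succAbove i) := fun p =>
      (measurable_poolTransform e b r hf).comp (by fun_prop)
    have h1 : ∀ p : Fin (d + r + 1),
        ∫⁻ z, poolTransform e b r f (fun i => z (p.succAbove i))
          ∂(Measure.pi fun _ : Fin (d + r + 1) => ν) =
        ∫⁻ z, poolTransform e b r f z ∂(Measure.pi fun _ : Fin (d + r) => ν) := fun p =>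
      lintegral_removeNth ν p (measurable_poolTransform e b r hf)
    have h2 : ∫⁻ z, poolTransform e b (r + 1) f z ∂(Measure.pi fun _ : Fin (d + r + 1) => ν) =
        removalFactor d b r * (r + 1 : ENNReal)⁻¹ * ((d + r + 1 : ℕ) *
          ∫⁻ z, poolTransform e b r f z ∂(Measure.pi fun _ : Fin (d + r) => ν)) :=
      calc _ = ∫⁻ z : Fin (d + r + 1) → Vec d × Vec d,
            removalFactor d b r * (r + 1 : ENNReal)⁻¹ * ∑ p : Fin (d + r + 1),
              poolTransform e b r f (fun i => z (p.succAbove i)) ∂(Measure.pi fun _ => ν) :=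
            lintegral_congr fun z => poolTransform_succ e b r hf z
        _ = _ := by
            rw [lintegral_const_mul _ (Finset.measurable_sum _ fun p _ => hm p),
              lintegral_finsetSum _ fun p _ => hm p, Finset.sum_congr rfl fun p _ => h1 p]
            simp only [Finset.sum_const, Finset.card_univ, Fintype.card_fin, nsmul_eq_mul]
    refine h2.trans ?_
    rw [ih, Finset.prod_range_succ, choose_add_succ]
    push_cast
    ring

/-- A Cauchy–Binet formula in expectation, by the same deletion recursion: the determinants of the
one-point deletions sum to `r + 1` times the full determinant. -/
theorem lintegral_det_gramMat (ν : Measure (Vec d × Vec d)) [IsProbabilityMeasure ν] (r : ℕ) :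
    ∫⁻ z, ENNReal.ofReal (gramMat fun i => (z i).2).det
        ∂(Measure.pi fun _ : Fin (d + r) => ν) =
      ((d + r).choose d : ℕ) * ∫⁻ z, ENNReal.ofReal (gramMat fun i => (z i).2).det
          ∂(Measure.pi fun _ : Fin d => ν) := by
  induction r with
  | zero => simp
  | succ r ih =>
    have hstep : ∀ z : Fin (d + r + 1) → Vec d × Vec d,
        ENNReal.ofReal (gramMat fun i => (z i).2).det = (r + 1 : ENNReal)⁻¹ *
          ∑ p : Fin (d + r + 1), ENNReal.ofReal (gramMat fun i => (z (p.succAbove i)).2).det := by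
      intro z
      rw [← ENNReal.ofReal_sum_of_nonneg fun p _ => gramMat_det_nonneg _]
      have h := sum_det_gramMat_removeNth fun i => (z i).2
      push_cast at h
      rw [h, show (d + r + 1 - d : ℝ) = r + 1 by ring, ENNReal.ofReal_mul (by positivity),
        ← mul_assoc]
      have h2 : ENNReal.ofReal (r + 1) = r + 1 := by
        rw [ENNReal.ofReal_add (by positivity) zero_le_one]; simp
      rw [h2, ENNReal.inv_mul_cancel (by simp) (by simp), one_mul]
    have hm : ∀ p : Fin (d + r + 1), Measurable fun z : Fin (d + r + 1) → Vec d × Vec d =>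
        ENNReal.ofReal (gramMat fun i => (z (p.succAbove i)).2).det := fun p =>
      (measurable_det_gramMat_snd (d + r)).comp
        (g := fun z : Fin (d + r) → Vec d × Vec d => ENNReal.ofReal (gramMat fun i => (z i).2).det)
        (f := fun z : Fin (d + r + 1) → Vec d × Vec d => fun i => z (p.succAbove i)) (by fun_prop)
    have h1 : ∀ p : Fin (d + r + 1),
        ∫⁻ z, ENNReal.ofReal (gramMat fun i => (z (p.succAbove i)).2).det
          ∂(Measure.pi fun _ : Fin (d + r + 1) => ν) =
        ∫⁻ z, ENNReal.ofReal (gramMat fun i => (z i).2).det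
          ∂(Measure.pi fun _ : Fin (d + r) => ν) := fun p =>
      lintegral_removeNth ν p (measurable_det_gramMat_snd (d + r))
    have h2 : ∫⁻ z, ENNReal.ofReal (gramMat fun i => (z i).2).det
          ∂(Measure.pi fun _ : Fin (d + r + 1) => ν) =
        (r + 1 : ENNReal)⁻¹ * ((d + r + 1 : ℕ) *
          ∫⁻ z, ENNReal.ofReal (gramMat fun i => (z i).2).det
            ∂(Measure.pi fun _ : Fin (d + r) => ν)) := by
      rw [lintegral_congr hstep,
        lintegral_const_mul _ (Finset.measurable_sum _ fun p _ => hm p),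
        lintegral_finsetSum _ fun p _ => hm p, Finset.sum_congr rfl fun p _ => h1 p]
      simp only [Finset.sum_const, Finset.card_univ, Fintype.card_fin, nsmul_eq_mul]
    refine h2.trans ?_
    rw [ih, choose_add_succ]
    push_cast
    ring

/-- Products of measures with densities, pushed forward in every coordinate. -/
theorem lintegral_pi_map_withDensity {X Y : Type} [MeasurableSpace X] [MeasurableSpace Y]
    (θ : Measure X) [IsProbabilityMeasure θ] {ρ : X → ENNReal} (hρ : Measurable ρ) {g : X → Y}
    (hg : Measurable g) [SigmaFinite ((θ.withDensity ρ).map g)] (n : ℕ)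
    {F : (Fin n → Y) → ENNReal} (hF : Measurable F) :
    ∫⁻ z, F z ∂(Measure.pi fun _ : Fin n => (θ.withDensity ρ).map g) =
      ∫⁻ x, (∏ i, ρ (x i)) * F (fun i => g (x i)) ∂(Measure.pi fun _ : Fin n => θ) := by
  have hprod : Measurable fun x : Fin n → X => ∏ i, ρ (x i) := by fun_prop
  have hgn : Measurable fun x : Fin n → X => fun i => g (x i) := by fun_prop
  have hpi : (Measure.pi fun _ : Fin n => (θ.withDensity ρ).map g) =
      ((Measure.pi fun _ : Fin n => θ).withDensity fun x => ∏ i, ρ (x i)).map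
        fun x i => g (x i) := by
    refine Measure.pi_eq fun s hs => ?_
    have hS : MeasurableSet ((fun (x : Fin n → X) i => g (x i)) ⁻¹' Set.univ.pi s) :=
      hgn (MeasurableSet.univ_pi hs)
    rw [Measure.map_apply hgn (MeasurableSet.univ_pi hs), withDensity_apply _ hS,
      ← lintegral_indicator hS]
    -- On a box the indicator times the product density splits into coordinate factors, so
    -- independence factors the integral.
    have hind : ∀ x : Fin n → X, ((fun (x : Fin n → X) i => g (x i)) ⁻¹' Set.univ.pi s).indicator
        (fun x => ∏ i, ρ (x i)) x = ∏ i, (g ⁻¹' s i).indicator ρ (x i) := by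
      intro x
      by_cases hx : ∀ i, g (x i) ∈ s i
      · rw [Set.indicator_of_mem (by simpa using hx)]
        exact Finset.prod_congr rfl fun i _ => (Set.indicator_of_mem (s := g ⁻¹' s i) (hx i) ρ).symm
      · rw [Set.indicator_of_notMem (by simpa using hx)]
        push Not at hx
        obtain ⟨i, hi⟩ := hx
        exact (Finset.prod_eq_zero (Finset.mem_univ i) (Set.indicator_of_notMem (s := g ⁻¹' s i) hi ρ)).symm
    simp_rw [hind]
    have hm : ∀ i, Measurable ((g ⁻¹' s i).indicator ρ) := fun i => hρ.indicator (hg (hs i))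
    rw [lintegral_prod_eq_prod_lintegral_of_indepFun Finset.univ
      (fun i (x : Fin n → X) => (g ⁻¹' s i).indicator ρ (x i))
      (iIndepFun_pi (μ := fun _ : Fin n => θ) (X := fun i => (g ⁻¹' s i).indicator ρ)
        fun i => (hm i).aemeasurable) fun i => (hm i).comp (measurable_pi_apply i)]
    refine Finset.prod_congr rfl fun i _ => ?_
    rw [Measure.map_apply hg (hs i), withDensity_apply _ (hg (hs i)),
      (measurePreserving_eval (fun _ : Fin n => θ) i).lintegral_comp (hm i),
      lintegral_indicator (hg (hs i))]
  rw [hpi, lintegral_map hF hgn, lintegral_withDensity_eq_lintegral_mul _ hprod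
    (g := fun x => F fun i => g (x i)) (hF.comp hgn)]
  rfl

end PoolAverages

/-! ### Volume-rescaled samples of size `d` -/

section VolumeRescaled

variable {d : ℕ}

theorem det_gramMat_square (x : Fin d → Vec d) :
    (gramMat x).det = (Matrix.of x).det ^ 2 := by
  have : gramMat x = (Matrix.of x)ᵀ * Matrix.of x := by
    ext i j
    simp [gramMat, Matrix.sum_apply, vecMulVec_apply, Matrix.mul_apply]
  rw [this, det_mul, det_transpose, sq]

theorem integrable_coord_mul {D : Measure (Vec d)} (hD : MemLp (fun x : Vec d => x) 2 D)
    (i j : Fin d) : Integrable (fun x : Vec d => x i * x j) D :=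
  (hD.eval i).integrable_mul (hD.eval j)

theorem integral_quad {D : Measure (Vec d)} (hD : MemLp (fun x : Vec d => x) 2 D) (S : Mat d) :
    Integrable (fun x => x ⬝ᵥ S *ᵥ x) D ∧
      ∫ x, x ⬝ᵥ S *ᵥ x ∂D = (S * secondMoment D).trace := by
  have hq : ∀ x : Vec d, x ⬝ᵥ S *ᵥ x = ∑ i, ∑ j, S i j * (x j * x i) := by
    intro x
    simp only [dotProduct, mulVec, Finset.mul_sum]
    exact Finset.sum_congr rfl fun i _ => Finset.sum_congr rfl fun j _ => by ring
  have hi : ∀ i j, Integrable (fun x : Vec d => S i j * (x j * x i)) D := fun i j =>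
    (integrable_coord_mul hD j i).const_mul _
  simp_rw [hq]
  refine ⟨integrable_finsetSum _ fun i _ => integrable_finsetSum _ fun j _ => hi i j, ?_⟩
  rw [integral_finsetSum _ fun i _ => integrable_finsetSum _ fun j _ => hi i j]
  simp_rw [trace, diag_apply, Matrix.mul_apply]
  refine Finset.sum_congr rfl fun i _ => ?_
  rw [integral_finsetSum _ fun j _ => hi i j]
  refine Finset.sum_congr rfl fun j _ => ?_
  rw [integral_const_mul]; rfl

/-- The expected squared volume of `d` independent points. -/
theorem integral_det_gramMat {D : Measure (Vec d)} [IsProbabilityMeasure D]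
    (hD : MemLp (fun x : Vec d => x) 2 D) :
    Integrable (fun x : Fin d → Vec d => (gramMat x).det) (Measure.pi fun _ => D) ∧
      ∫ x, (gramMat x).det ∂(Measure.pi fun _ : Fin d => D) =
        d.factorial * (secondMoment D).det := by
  -- The squared Leibniz expansion. Each product has one factor per point, quadratic in that point,
  -- so second moments suffice for integrability and independence factors the expectation.
  have hexp : ∀ x : Fin d → Vec d, (gramMat x).det =
      ∑ σ : Equiv.Perm (Fin d), ∑ τ : Equiv.Perm (Fin d),
        ((Equiv.Perm.sign σ : ℤ) : ℝ) * ((Equiv.Perm.sign τ : ℤ) : ℝ) *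
          ∏ i, x i (σ i) * x i (τ i) := by
    intro x
    rw [det_gramMat_square, ← det_transpose, det_apply', sq, Finset.sum_mul_sum]
    refine Finset.sum_congr rfl fun σ _ => Finset.sum_congr rfl fun τ _ => ?_
    simp only [transpose_apply, of_apply, Finset.prod_mul_distrib]
    ring
  have hi : ∀ σ τ : Equiv.Perm (Fin d), Integrable (fun x : Fin d → Vec d =>
      ((Equiv.Perm.sign σ : ℤ) : ℝ) * ((Equiv.Perm.sign τ : ℤ) : ℝ) *
          ∏ i, x i (σ i) * x i (τ i)) (Measure.pi fun _ => D) := fun σ τ =>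
    (Integrable.fintype_prod (f := fun i (x : Vec d) => x (σ i) * x (τ i)) fun i =>
      integrable_coord_mul hD _ _).const_mul _
  simp_rw [hexp]
  refine ⟨integrable_finsetSum _ fun σ _ => integrable_finsetSum _ fun τ _ => hi σ τ, ?_⟩
  rw [integral_finsetSum _ fun σ _ => integrable_finsetSum _ fun τ _ => hi σ τ]
  have hσ : ∀ σ : Equiv.Perm (Fin d), ∫ x : Fin d → Vec d, ∑ τ : Equiv.Perm (Fin d),
      ((Equiv.Perm.sign σ : ℤ) : ℝ) * ((Equiv.Perm.sign τ : ℤ) : ℝ) *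
          ∏ i, x i (σ i) * x i (τ i) ∂(Measure.pi fun _ => D) = (secondMoment D).det := by
    intro σ
    rw [integral_finsetSum _ fun τ _ => hi σ τ]
    simp_rw [integral_const_mul]
    have hF : ∀ τ : Equiv.Perm (Fin d), ∫ x : Fin d → Vec d, ∏ i, x i (σ i) * x i (τ i)
        ∂(Measure.pi fun _ => D) = ∏ i, secondMoment D (σ i) (τ i) := fun τ =>
      integral_fintype_prod_eq_prod (μ := fun _ : Fin d => D)
        fun i (x : Vec d) => x (σ i) * x (τ i)
    simp_rw [hF, mul_assoc, ← Finset.mul_sum]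
    -- For fixed `σ` the sum over `τ` is the determinant of the second-moment matrix with rows
    -- permuted by `σ`. Its sign cancels that of `σ`, so all `d!` permutations contribute equally.
    have hdet : ∑ τ : Equiv.Perm (Fin d), ((Equiv.Perm.sign τ : ℤ) : ℝ) *
        ∏ i, secondMoment D (σ i) (τ i) = ((secondMoment D).submatrix σ id).det := by
      rw [← det_transpose, det_apply']
      rfl
    rw [hdet, det_permute, ← mul_assoc, ← Int.cast_mul, ← Units.val_mul]
    simp
  simp_rw [hσ]
  simp [Fintype.card_perm]

theorem measurable_gramMat_det (n : ℕ) :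
    Measurable fun x : Fin n → Vec d => (gramMat x).det :=
  measurable_det (measurable_gramMat (y := fun x : Fin n → Vec d => x) measurable_id)

theorem lintegral_det_gramMat_mul {D : Measure (Vec d)} [IsProbabilityMeasure D]
    (hS : 0 < (secondMoment D).det) {f : (Fin d → Vec d) → ENNReal} (hf : Measurable f) :
    ∫⁻ x, ENNReal.ofReal (gramMat x).det * f x ∂(Measure.pi fun _ : Fin d => D) =
      ENNReal.ofReal (d.factorial * (secondMoment D).det) * ∫⁻ x, f x ∂(volumeRescaled D d) := by
  have hc : 0 < (d.factorial : ℝ) * (secondMoment D).det := by positivity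
  have hm := ((measurable_gramMat_det (d := d) d).div_const
    ((d.factorial : ℝ) * (d.choose d : ℝ) * (secondMoment D).det)).ennreal_ofReal
  rw [volumeRescaled]
  change _ = _ * ∫⁻ x, f x ∂((Measure.pi fun _ : Fin d => D).withDensity fun x =>
    ENNReal.ofReal ((gramMat x).det /
      ((d.factorial : ℝ) * (d.choose d : ℝ) * (secondMoment D).det)))
  rw [lintegral_withDensity_eq_lintegral_mul _ hm hf, ← lintegral_const_mul _ (hm.mul hf)]
  refine lintegral_congr fun x => ?_
  rw [Pi.mul_apply, ← mul_assoc, ← ENNReal.ofReal_mul hc.le, Nat.choose_self, Nat.cast_one,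
    mul_one, mul_div_cancel₀ _ hc.ne']

theorem volumeRescaled_univ {D : Measure (Vec d)} [IsProbabilityMeasure D]
    (hD : MemLp (fun x : Vec d => x) 2 D) (hS : 0 < (secondMoment D).det) :
    volumeRescaled D d Set.univ = 1 := by
  have hc : 0 < (d.factorial : ℝ) * (secondMoment D).det := by positivity
  have h := lintegral_det_gramMat_mul hS (f := fun _ => 1) measurable_const
  simp only [mul_one, lintegral_one] at h
  rw [← ofReal_integral_eq_lintegral_ofReal (integral_det_gramMat hD).1
    (Filter.Eventually.of_forall fun x => gramMat_det_nonneg x), (integral_det_gramMat hD).2] at h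
  have h0 : ENNReal.ofReal (d.factorial * (secondMoment D).det) ≠ 0 := (ENNReal.ofReal_pos.mpr hc).ne'
  exact ((ENNReal.mul_eq_left h0 ENNReal.ofReal_ne_top).mp h.symm)

end VolumeRescaled

/-! ### Leverage score sampling -/

section Leverage

variable {d : ℕ}

/-- The rescaled point `(√d / √(xᵀ S x)) x`. -/
def rescale (S : Mat d) (x : Vec d) : Vec d := fun i => √(d : ℝ) / √(x ⬝ᵥ S *ᵥ x) * x i

/-- The law of a leverage score sample together with its rescaled version. -/
def leverageLaw (D : Measure (Vec d)) (S : Mat d) : Measure (Vec d × Vec d) :=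
  (D.withDensity fun x =>
    ENNReal.ofReal (x ⬝ᵥ S *ᵥ x / (S * secondMoment D).trace)).map fun x => (x, rescale S x)

/-- The number of operations of a trial of leverage score sampling, where a draw is charged with
`e` additional operations. -/
def leverageOps (d e : ℕ) : ℕ := d + e + (d * (2 * d + 1) + 2 * d + 2)

/-- The number of operations of the acceptance test for a pool of size `t`. -/
def poolOps (d t : ℕ) : ℕ :=
  d * (d * (2 * t + 1) + 1) + d * (2 * d + 1) + (d * (d + 1) +
      d * (3 * d + (2 * (d * (2 * d + 1)) + 2 * d + 1 + d * (4 * d + 1)) + 1)) + 2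

/-- The factor that an accepted point contributes to the transform, where `p` is the acceptance
probability. -/
def leverageFactor (d e : ℕ) (b : ENNReal) (p : ℝ) : ENNReal :=
  b ^ (2 * d + 3) * ((1 - b ^ leverageOps d e * ENNReal.ofReal (1 - p))⁻¹ *
    (b ^ leverageOps d e * ENNReal.ofReal p))

theorem measurable_lev (S : Mat d) : Measurable fun x : Vec d => x ⬝ᵥ S *ᵥ x :=
  measurable_quad (M := fun _ => S) (fun _ _ => measurable_const) measurable_id

theorem measurable_rescale (S : Mat d) : Measurable (rescale S) := by
  have h := measurable_lev S
  refine measurable_pi_iff.mpr fun i => ?_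
  unfold rescale
  fun_prop

/-- An equality unless `xᵀ S x = 0`, where division by zero makes the rescaled point `0`. -/
theorem rescale_quad_le {S : Mat d} (hS : S.PosSemidef) (x : Vec d) :
    rescale S x ⬝ᵥ S *ᵥ rescale S x ≤ d := by
  have h0 : 0 ≤ x ⬝ᵥ S *ᵥ x := hS.dotProduct_mulVec_nonneg x
  have : rescale S x = (√(d : ℝ) / √(x ⬝ᵥ S *ᵥ x)) • x := rfl
  rw [this, mulVec_smul, dotProduct_smul, smul_dotProduct, smul_smul, smul_eq_mul, ← sq, div_pow,
    Real.sq_sqrt (by positivity), Real.sq_sqrt h0]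
  rcases h0.eq_or_lt with h | h
  · simp [← h]
  · rw [div_mul_cancel₀ _ h.ne']

variable {D : Measure (Vec d)} {S : Mat d} {K : ℝ} (e : ℕ) (b : ENNReal)

theorem isProg_leverageTrial [IsProbabilityMeasure D] {γ : Type} [MeasurableSpace γ] :
    IsProg fun _ : γ => leverageTrial D S K := by
  refine IsProg.andThen ⟨measurable_const, fun _ => draw_mass_le D⟩ ?_
  refine IsProg.compute ?_ ?_
  · simp only [Timed.bind_ops, Timed.quad_ops, Timed.div, Timed.pure_ops]
    exact measurable_const
  · have hq : Measurable fun p : γ × Vec d => (Timed.quad S p.2).val :=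
      (measurable_lev S).comp measurable_snd
    refine IsProg.andThen (isProg_coin.comp (hq.div_const K)) (IsProg.ret ?_)
    exact measurable_snd.prodMk (Measurable.prodMk (by fun_prop) (hq.comp measurable_fst))

theorem transform_leverageTrial [IsProbabilityMeasure D] (hS : S.PosSemidef) (hK : 0 < K)
    (hle : ∀ᵐ x ∂D, x ⬝ᵥ S *ᵥ x ≤ K) {f : Bool × (Vec d × ℝ) → ENNReal} (hf : Measurable f) :
    transform e b (leverageTrial D S K) f =
      b ^ leverageOps d e * ∫⁻ x, (ENNReal.ofReal (x ⬝ᵥ S *ᵥ x / K) *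
        f (true, (x, x ⬝ᵥ S *ᵥ x)) +
          ENNReal.ofReal (1 - x ⬝ᵥ S *ᵥ x / K) * f (false, (x, x ⬝ᵥ S *ᵥ x))) ∂D := by
  have hprog : IsProg fun x : Vec d => (compute (do
        let l ← Timed.quad S x
        let p ← Timed.div l K
        pure (l, p)) fun lp =>
      andThen (coin lp.2) fun a => ret (a, (x, lp.1)) : RandProg (Bool × (Vec d × ℝ))) := by
    refine IsProg.compute ?_ ?_
    · simp only [Timed.bind_ops, Timed.quad_ops, Timed.div, Timed.pure_ops]
      exact measurable_const
    · have hq : Measurable fun x : Vec d => (Timed.quad S x).val := measurable_lev S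
      refine IsProg.andThen (isProg_coin.comp (hq.div_const K)) (IsProg.ret ?_)
      exact measurable_snd.prodMk (measurable_fst.prodMk (hq.comp measurable_fst))
  rw [leverageTrial, transform_andThen e b _ hprog hf,
    transform_draw e b D (hprog.measurable_transform e b hf)]
  have hl := measurable_lev S
  have hmeas : Measurable fun x : Vec d => (ENNReal.ofReal (x ⬝ᵥ S *ᵥ x / K) *
        f (true, (x, x ⬝ᵥ S *ᵥ x)) +
          ENNReal.ofReal (1 - x ⬝ᵥ S *ᵥ x / K) * f (false, (x, x ⬝ᵥ S *ᵥ x))) := by fun_prop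
  rw [leverageOps, pow_add b (d + e), mul_assoc, ← lintegral_const_mul _ hmeas]
  congr 1
  refine lintegral_congr_ae (hle.mono fun x hx => ?_)
  have h0 : 0 ≤ x ⬝ᵥ S *ᵥ x := hS.dotProduct_mulVec_nonneg x
  have hprog2 : IsProg fun a : Bool => ret (a, (x, x ⬝ᵥ S *ᵥ x)) := IsProg.ret (by fun_prop)
  simp only []
  rw [transform_compute e b _ _ hf]
  simp only [Timed.bind_ops, Timed.quad_ops, Timed.bind_val, Timed.quad_val, Timed.div,
    Timed.pure_ops, Timed.pure_val]
  rw [transform_andThen e b _ hprog2 hf, transform_coin e b (by positivity)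
    ((div_le_one hK).mpr hx)]
  simp only [transform_ret e b _ hf]
  ring

/-- The bound `K` affects only the acceptance rate `tr (S Σ) / K`, not the law of an accepted point.
-/
theorem ofReal_mul_lintegral_leverageLaw (hm : 0 < (S * secondMoment D).trace) (hK : 0 < K)
    {f : Vec d × Vec d → ENNReal} (hf : Measurable f) :
    ∫⁻ x, ENNReal.ofReal (x ⬝ᵥ S *ᵥ x / K) * f (x, rescale S x) ∂D =
      ENNReal.ofReal ((S * secondMoment D).trace / K) * ∫⁻ z, f z ∂(leverageLaw D S) := by
  have hl := measurable_lev S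
  have hr := measurable_rescale S
  have hfr : Measurable fun x => f (x, rescale S x) := by fun_prop
  rw [leverageLaw, lintegral_map hf (by fun_prop), lintegral_withDensity_eq_lintegral_mul _
    (by fun_prop) hfr, ← lintegral_const_mul _ (by fun_prop)]
  refine lintegral_congr fun x => ?_
  rw [Pi.mul_apply, ← mul_assoc, ← ENNReal.ofReal_mul (by positivity)]
  congr 2
  field_simp

theorem lintegral_lev [IsProbabilityMeasure D] (hD : MemLp (fun x : Vec d => x) 2 D)
    (hS : S.PosSemidef) (hK : 0 < K) :
    ∫⁻ x, ENNReal.ofReal (x ⬝ᵥ S *ᵥ x / K) ∂D =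
      ENNReal.ofReal ((S * secondMoment D).trace / K) := by
  have hi := integral_quad hD S
  rw [← ofReal_integral_eq_lintegral_ofReal (hi.1.div_const K) (Filter.Eventually.of_forall fun x =>
    div_nonneg (hS.dotProduct_mulVec_nonneg x) hK.le), integral_div, hi.2]

theorem isProbabilityMeasure_leverageLaw [IsProbabilityMeasure D]
    (hD : MemLp (fun x : Vec d => x) 2 D) (hS : S.PosSemidef)
    (hm : 0 < (S * secondMoment D).trace) : IsProbabilityMeasure (leverageLaw D S) := by
  constructor
  have h := ofReal_mul_lintegral_leverageLaw (D := D) (S := S) hm hm (f := fun _ => 1)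
    measurable_const
  simp only [mul_one, lintegral_one] at h
  rw [lintegral_lev hD hS hm, div_self hm.ne'] at h
  simpa using h.symm

theorem transform_leveragePoint [IsProbabilityMeasure D] (hD : MemLp (fun x : Vec d => x) 2 D)
    (hS : S.PosSemidef) (hm : 0 < (S * secondMoment D).trace) (hK : 0 < K)
    (hle : ∀ᵐ x ∂D, x ⬝ᵥ S *ᵥ x ≤ K) {f : Vec d × Vec d → ENNReal} (hf : Measurable f) :
    transform e b (leveragePoint D S K) f =
      leverageFactor d e b ((S * secondMoment D).trace / K) * ∫⁻ z, f z ∂(leverageLaw D S) := by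
  have hl := measurable_lev S
  have hr := measurable_rescale S
  have hops : ∀ xl : Vec d × ℝ, (do
        let a ← Timed.sqrt d
        let b ← Timed.sqrt xl.2
        let s ← Timed.div a b
        Timed.tabulate fun i => Timed.mul s (xl.1 i) : Timed (Vec d)).ops = 2 * d + 3 := by
    intro xl
    simp only [Timed.bind_ops]
    rw [Timed.tabulate_ops _ (k := 1) fun _ => rfl]
    simp only [Timed.sqrt, Timed.div]
    ring
  have hprog : IsProg fun xl : Vec d × ℝ => (compute (do
        let a ← Timed.sqrt d
        let b ← Timed.sqrt xl.2
        let s ← Timed.div a b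
        Timed.tabulate fun i => Timed.mul s (xl.1 i)) fun y =>
      ret (xl.1, y) : RandProg (Vec d × Vec d)) := by
    refine IsProg.compute ?_ (IsProg.ret (measurable_fst.prodMk ?_))
    · simp_rw [hops]
      exact measurable_const
    · simp only [Timed.bind_val, Timed.tabulate_val, Timed.mul, Timed.div, Timed.sqrt]
      fun_prop
  have hbody : ∀ xl : Vec d × ℝ, transform e b (compute (do
        let a ← Timed.sqrt d
        let b ← Timed.sqrt xl.2
        let s ← Timed.div a b
        Timed.tabulate fun i => Timed.mul s (xl.1 i)) fun y =>
      ret (xl.1, y) : RandProg (Vec d × Vec d)) f =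
        b ^ (2 * d + 3) * f (xl.1, fun i => √(d : ℝ) / √xl.2 * xl.1 i) := by
    intro xl
    rw [transform_compute e b _ _ hf, hops, transform_ret e b _ hf]
    rfl
  have hmeas2 : Measurable fun xl : Vec d × ℝ =>
      b ^ (2 * d + 3) * f (xl.1, fun i => √(d : ℝ) / √xl.2 * xl.1 i) := by fun_prop
  have hflag : ∀ v : Bool, MeasurableSet {z : Bool × (Vec d × ℝ) | z.1 = v} := fun v =>
    measurable_fst (measurableSet_singleton v)
  have hT := transform_leverageTrial e b hS hK hle
    (f := fun z => if z.1 = true then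
      b ^ (2 * d + 3) * f (z.2.1, fun i => √(d : ℝ) / √z.2.2 * z.2.1 i) else 0)
    (Measurable.ite (hflag true) (hmeas2.comp measurable_snd) measurable_const)
  have hF := transform_leverageTrial e b hS hK hle
    (f := fun z => if z.1 = false then 1 else 0)
    (Measurable.ite (hflag false) measurable_const measurable_const)
  simp only [Bool.true_eq_false, Bool.false_eq_true, if_true, if_false, mul_zero, mul_one, zero_add,
    add_zero] at hT hF
  have hi := integral_quad hD S
  have hF' : ∫⁻ x, ENNReal.ofReal (1 - x ⬝ᵥ S *ᵥ x / K) ∂D =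
      ENNReal.ofReal (1 - (S * secondMoment D).trace / K) := by
    have hi1 : Integrable (fun x : Vec d => 1 - x ⬝ᵥ S *ᵥ x / K) D :=
      (integrable_const _).sub (hi.1.div_const K)
    rw [← ofReal_integral_eq_lintegral_ofReal hi1
      (hle.mono fun x hx => by simpa using (div_le_one hK).mpr hx),
      integral_sub (integrable_const _) (hi.1.div_const K), integral_div, hi.2]
    simp
  have hT' : ∫⁻ x, ENNReal.ofReal (x ⬝ᵥ S *ᵥ x / K) * (b ^ (2 * d + 3) *
      f (x, fun i => √(d : ℝ) / √(x ⬝ᵥ S *ᵥ x) * x i)) ∂D = b ^ (2 * d + 3) *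
      (ENNReal.ofReal ((S * secondMoment D).trace / K) * ∫⁻ z, f z ∂(leverageLaw D S)) := by
    rw [← ofReal_mul_lintegral_leverageLaw hm hK hf, ← lintegral_const_mul _ (by fun_prop)]
    refine lintegral_congr fun x => ?_
    rw [mul_left_comm]; rfl
  have hmass : leverageTrial D S K Set.univ ≤ 1 := (isProg_leverageTrial (γ := Unit)).mass_le ()
  rw [leveragePoint, transform_andThen e b _ hprog hf]
  simp_rw [hbody]
  rw [transform_repeatUntil e b hmass hmeas2, hT, hF, hF', hT', leverageFactor]
  ring

theorem isProg_leveragePoint [IsProbabilityMeasure D] {γ : Type} [MeasurableSpace γ] :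
    IsProg fun _ : γ => leveragePoint D S K := by
  refine IsProg.andThen isProg_leverageTrial.repeatUntil (IsProg.compute ?_ (IsProg.ret ?_))
  · simp only [Timed.bind_ops]
    simp_rw [fun (v : Vec d) (s : ℝ) => (Timed.tabulate_ops (n := d)
      (fun i => Timed.mul s (v i)) (k := 1) fun _ => rfl)]
    simp only [Timed.sqrt, Timed.div]
    exact measurable_const
  · simp only [Timed.bind_val, Timed.tabulate_val, Timed.mul, Timed.div, Timed.sqrt]
    fun_prop

theorem measurable_snoc {X : Type} [MeasurableSpace X] {n : ℕ} :
    Measurable fun p : (Fin n → X) × X => (Fin.snoc (α := fun _ => X) p.1 p.2 : Fin (n + 1) → X) := by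
  refine measurable_pi_iff.mpr fun i => ?_
  refine Fin.lastCases ?_ (fun j => ?_) i
  · simp only [Fin.snoc_last]; fun_prop
  · simp only [Fin.snoc_castSucc]; fun_prop

theorem lintegral_snoc {X : Type} [MeasurableSpace X] (ν : Measure X) [IsProbabilityMeasure ν]
    {n : ℕ} {f : (Fin (n + 1) → X) → ENNReal} (hf : Measurable f) :
    ∫⁻ z, ∫⁻ w, f (Fin.snoc (α := fun _ => X) z w) ∂ν ∂(Measure.pi fun _ : Fin n => ν) =
      ∫⁻ z, f z ∂(Measure.pi fun _ : Fin (n + 1) => ν) := by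
  have h := (measurePreserving_piFinSuccAbove (fun _ : Fin (n + 1) => ν) (Fin.last n)).symm
  rw [← h.lintegral_comp hf, 
    lintegral_prod_symm (fun a => f ((MeasurableEquiv.piFinSuccAbove (fun _ => X)
      (Fin.last n)).symm a)) (hf.comp h.measurable).aemeasurable]
  refine lintegral_congr fun z => lintegral_congr fun w => ?_
  congr 1
  exact (Fin.insertNth_last' w z).symm

theorem isProg_leveragePool [IsProbabilityMeasure D] (k : ℕ) {γ : Type} [MeasurableSpace γ] :
    IsProg fun _ : γ => leveragePool D S K k := by
  induction k generalizing γ with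
  | zero => exact IsProg.ret measurable_const
  | succ k ih =>
    refine IsProg.andThen ih (IsProg.andThen isProg_leveragePoint (IsProg.charge (IsProg.ret ?_)
      measurable_const))
    exact measurable_snoc.comp (f := fun p : (γ × (Fin k → Vec d × Vec d)) × (Vec d × Vec d) =>
      (p.1.2, p.2)) (by fun_prop)

theorem transform_leveragePool [IsProbabilityMeasure D] (hD : MemLp (fun x : Vec d => x) 2 D)
    (hS : S.PosSemidef) (hm : 0 < (S * secondMoment D).trace) (hK : 0 < K)
    (hle : ∀ᵐ x ∂D, x ⬝ᵥ S *ᵥ x ≤ K) (k : ℕ) {f : (Fin k → Vec d × Vec d) → ENNReal}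
    (hf : Measurable f) :
    transform e b (leveragePool D S K k) f =
      (b * leverageFactor d e b ((S * secondMoment D).trace / K)) ^ k *
        ∫⁻ z, f z ∂(Measure.pi fun _ : Fin k => leverageLaw D S) := by
  have := isProbabilityMeasure_leverageLaw hD hS hm
  induction k with
  | zero =>
    rw [leveragePool, transform_ret e b _ hf, pow_zero, one_mul, Measure.pi_of_empty,
      lintegral_dirac' _ hf]
    congr 1
  | succ k ih =>
    have hprog2 : ∀ z : Fin k → Vec d × Vec d, IsProg fun w : Vec d × Vec d =>
        (charge (0, 1) (ret (Fin.snoc (α := fun _ => Vec d × Vec d) z w)) :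
          RandProg (Fin (k + 1) → Vec d × Vec d)) := fun z =>
      IsProg.charge (IsProg.ret (measurable_snoc.comp (measurable_const.prodMk measurable_id)))
        measurable_const
    have hprog : IsProg fun z : Fin k → Vec d × Vec d =>
        (andThen (leveragePoint D S K) fun w =>
          charge (0, 1) (ret (Fin.snoc (α := fun _ => Vec d × Vec d) z w)) :
          RandProg (Fin (k + 1) → Vec d × Vec d)) :=
      IsProg.andThen isProg_leveragePoint (IsProg.charge (IsProg.ret measurable_snoc)
        measurable_const)
    have hin : Measurable fun z : Fin k → Vec d × Vec d =>
        ∫⁻ w, f (Fin.snoc (α := fun _ => Vec d × Vec d) z w) ∂(leverageLaw D S) :=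
      Measurable.lintegral_prod_right' (hf.comp measurable_snoc)
    have hinner : ∀ z : Fin k → Vec d × Vec d, transform e b (andThen (leveragePoint D S K) fun w =>
          charge (0, 1) (ret (Fin.snoc (α := fun _ => Vec d × Vec d) z w)) :
          RandProg (Fin (k + 1) → Vec d × Vec d)) f =
        (b * leverageFactor d e b ((S * secondMoment D).trace / K)) *
          ∫⁻ w, f (Fin.snoc (α := fun _ => Vec d × Vec d) z w) ∂(leverageLaw D S) := by
      intro z
      have hfz : Measurable fun w => f (Fin.snoc (α := fun _ => Vec d × Vec d) z w) :=
        hf.comp (measurable_snoc.comp (measurable_const.prodMk measurable_id))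
      rw [transform_andThen e b _ (hprog2 z) hf]
      simp_rw [transform_charge e b _ _ hf, transform_ret e b _ hf]
      rw [transform_const_mul e b _ _ hfz, transform_leveragePoint e b hD hS hm hK hle hfz]
      simp only [mul_zero, add_zero, pow_one]
      rw [mul_assoc]
    rw [leveragePool, transform_andThen e b _ hprog hf]
    simp_rw [hinner]
    rw [transform_const_mul e b _ _ hin, ih hin, lintegral_snoc _ hf]
    ring

end Leverage

/-! ### The joint transform of output and cost of the algorithm -/

section Algorithm

variable {d : ℕ} {D : Measure (Vec d)} {S : Mat d} {K : ℝ} (e : ℕ) (b : ENNReal)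

/-- The acceptance probability `det (S G / t) = det (G / t) / det Σ̂` of a pool. -/
def acceptProb (δ : ℝ) (t : ℕ) (z : Fin t → Vec d × Vec d) : ℝ :=
  (gramMat fun i => (z i).2).det * ((t : ℝ) ^ d * δ)⁻¹

theorem acceptProb_nonneg {δ : ℝ} (hδ : 0 ≤ δ) {t : ℕ} (z : Fin t → Vec d × Vec d) :
    0 ≤ acceptProb δ t z :=
  mul_nonneg (gramMat_det_nonneg _) (by positivity)

theorem measurable_acceptProb (δ : ℝ) (t : ℕ) :
    Measurable (acceptProb δ t : (Fin t → Vec d × Vec d) → ℝ) :=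
  (measurable_det (measurable_gramMat (y := fun z : Fin t → Vec d × Vec d => fun i => (z i).2)
    (by fun_prop))).mul_const _

/-- For rescaled points `tr (S G) ≤ t d`, so the arithmetic-geometric mean inequality gives `det (S
G) ≤ t ^ d`. -/
theorem acceptProb_le_one (hd : 1 ≤ d) (hS : S.PosDef) {t : ℕ} (ht : 0 < t)
    {z : Fin t → Vec d × Vec d} (hz : ∀ i, (z i).2 ⬝ᵥ S *ᵥ (z i).2 ≤ d) :
    acceptProb (S.det)⁻¹ t z ≤ 1 := by
  have h := det_mul_le_trace_div_pow hd hS.posSemidef (posSemidef_gramMat fun i => (z i).2)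
  rw [← sum_quad_eq_trace, det_mul] at h
  have hsum : ∑ k, (z k).2 ⬝ᵥ S *ᵥ (z k).2 ≤ t * d := by
    simpa using Finset.sum_le_sum fun i (_ : i ∈ Finset.univ) => hz i
  have h0 : 0 ≤ ∑ k, (z k).2 ⬝ᵥ S *ᵥ (z k).2 := Finset.sum_nonneg fun k _ =>
    hS.posSemidef.dotProduct_mulVec_nonneg _
  have hd0 : (0 : ℝ) < d := by exact_mod_cast hd
  have ht0 : (0 : ℝ) < t := by exact_mod_cast ht
  have h2 : ((∑ k, (z k).2 ⬝ᵥ S *ᵥ (z k).2) / d) ^ d ≤ (t : ℝ) ^ d :=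
    pow_le_pow_left₀ (by positivity) ((div_le_iff₀ hd0).mpr hsum) d
  rw [acceptProb, mul_inv, inv_inv, ← mul_assoc, mul_right_comm, mul_comm _ S.det,
    mul_inv_le_iff₀ (by positivity), one_mul]
  exact h.trans h2

theorem leverageLaw_pool_ae [IsProbabilityMeasure D] (hD : MemLp (fun x : Vec d => x) 2 D)
    (hS : S.PosSemidef) (hm : 0 < (S * secondMoment D).trace) (t : ℕ) :
    ∀ᵐ z ∂(Measure.pi fun _ : Fin t => leverageLaw D S),
      ∀ i, (z i).2 ⬝ᵥ S *ᵥ (z i).2 ≤ d := by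
  have := isProbabilityMeasure_leverageLaw hD hS hm
  have hr := measurable_rescale S
  have hset : MeasurableSet {w : Vec d × Vec d | w.2 ⬝ᵥ S *ᵥ w.2 ≤ d} :=
    measurableSet_le ((measurable_lev S).comp measurable_snd) measurable_const
  have h1 : ∀ᵐ w ∂(leverageLaw D S), w.2 ⬝ᵥ S *ᵥ w.2 ≤ d :=
    (ae_map_iff (by fun_prop) hset).mpr
      (Filter.Eventually.of_forall fun x => rescale_quad_le hS x)
  exact ae_all_iff.mpr fun i =>
    (measurePreserving_eval (fun _ : Fin t => leverageLaw D S) i).quasiMeasurePreserving.ae h1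

theorem poolTest_val (δ : ℝ) {t : ℕ} (z : Fin t → Vec d × Vec d) :
    (do
        let G ← Timed.gram fun k => (z k).2
        let T ← Timed.tabulate fun i => Timed.tabulate fun j => Timed.div (G i j) t
        let N ← Timed.invDet T
        Timed.div N.2 δ : Timed ℝ).val = acceptProb δ t z := by
  have hT : (fun i j => gramMat (fun k => (z k).2) i j / (t : ℝ) : Mat d) =
      (t : ℝ)⁻¹ • gramMat fun k => (z k).2 := by
    ext i j
    rw [Matrix.smul_apply, smul_eq_mul, div_eq_inv_mul]
  have hpsd : ((t : ℝ)⁻¹ • gramMat fun k => (z k).2).PosSemidef :=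
    (posSemidef_gramMat _).smul (by positivity)
  simp only [Timed.bind_val, Timed.tabulate_val, Timed.gram_val]
  change (Timed.invDet (fun i j => gramMat (fun k => (z k).2) i j / (t : ℝ) : Mat d)).val.2 / δ = _
  rw [hT, invDet_val_snd hpsd, det_smul, acceptProb, Fintype.card_fin, mul_inv, inv_pow]
  ring

theorem poolTest_ops (δ : ℝ) {t : ℕ} (z : Fin t → Vec d × Vec d) :
    (do
        let G ← Timed.gram fun k => (z k).2
        let T ← Timed.tabulate fun i => Timed.tabulate fun j => Timed.div (G i j) t
        let N ← Timed.invDet T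
        Timed.div N.2 δ : Timed ℝ).ops + 1 = poolOps d t := by
  simp only [Timed.bind_ops, Timed.gram_ops]
  rw [Timed.tabulate_ops _ (k := d * 2) fun _ => Timed.tabulate_ops _ (k := 1) fun _ => rfl]
  erw [Timed.invDet_ops]
  simp only [Timed.div, poolOps]
  ring

theorem isProg_poolTrial [IsProbabilityMeasure D] (δ : ℝ) (t : ℕ) {γ : Type} [MeasurableSpace γ] :
    IsProg fun _ : γ => poolTrial D S δ K t := by
  refine IsProg.andThen (isProg_leveragePool t) (IsProg.compute ?_ ?_)
  · have h : ∀ z : Fin t → Vec d × Vec d, (do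
        let G ← Timed.gram fun k => (z k).2
        let T ← Timed.tabulate fun i => Timed.tabulate fun j => Timed.div (G i j) t
        let N ← Timed.invDet T
        Timed.div N.2 δ : Timed ℝ).ops = poolOps d t - 1 := fun z => by
      rw [← poolTest_ops δ z]; rfl
    simp_rw [h]
    exact measurable_const
  · simp_rw [poolTest_val]
    refine IsProg.andThen (isProg_coin.comp ((measurable_acceptProb δ t).comp measurable_snd))
      (IsProg.ret (by fun_prop))

theorem transform_poolTrial [IsProbabilityMeasure D] (hd : 1 ≤ d)
    (hD : MemLp (fun x : Vec d => x) 2 D)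
    (hS : S.PosDef) (hm : 0 < (S * secondMoment D).trace) (hK : 0 < K)
    (hle : ∀ᵐ x ∂D, x ⬝ᵥ S *ᵥ x ≤ K) {t : ℕ} (ht : 0 < t)
    {f : Bool × (Fin t → Vec d × Vec d) → ENNReal} (hf : Measurable f) :
    transform e b (poolTrial D S (S.det)⁻¹ K t) f =
      (b * leverageFactor d e b ((S * secondMoment D).trace / K)) ^ t * b ^ poolOps d t *
        ∫⁻ z, (ENNReal.ofReal (acceptProb (S.det)⁻¹ t z) * f (true, z) +
          ENNReal.ofReal (1 - acceptProb (S.det)⁻¹ t z) * f (false, z))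
            ∂(Measure.pi fun _ : Fin t => leverageLaw D S) := by
  have hacc := measurable_acceptProb (d := d) (S.det)⁻¹ t
  have hprog : IsProg fun z : Fin t → Vec d × Vec d => (compute (do
        let G ← Timed.gram fun k => (z k).2
        let T ← Timed.tabulate fun i => Timed.tabulate fun j => Timed.div (G i j) t
        let N ← Timed.invDet T
        Timed.div N.2 (S.det)⁻¹) fun q =>
      andThen (coin q) fun a => ret (a, z) : RandProg (Bool × (Fin t → Vec d × Vec d))) := by
    refine IsProg.compute ?_ ?_
    · have h : ∀ z : Fin t → Vec d × Vec d, (do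
          let G ← Timed.gram fun k => (z k).2
          let T ← Timed.tabulate fun i => Timed.tabulate fun j => Timed.div (G i j) t
          let N ← Timed.invDet T
          Timed.div N.2 (S.det)⁻¹ : Timed ℝ).ops = poolOps d t - 1 := fun z => by
        rw [← poolTest_ops (S.det)⁻¹ z]; rfl
      simp_rw [h]
      exact measurable_const
    · simp_rw [poolTest_val]
      exact IsProg.andThen (isProg_coin.comp hacc) (IsProg.ret (by fun_prop))
  have hmeas : Measurable fun z => (ENNReal.ofReal (acceptProb (S.det)⁻¹ t z) * f (true, z) +
          ENNReal.ofReal (1 - acceptProb (S.det)⁻¹ t z) * f (false, z)) := by fun_prop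
  rw [poolTrial, transform_andThen e b _ hprog hf,
    transform_leveragePool e b hD hS.posSemidef hm hK hle t
      (hprog.measurable_transform e b hf), mul_assoc, ← lintegral_const_mul _ hmeas]
  congr 1
  refine lintegral_congr_ae ((leverageLaw_pool_ae hD hS.posSemidef hm t).mono fun z hz => ?_)
  have hprog2 : IsProg fun a : Bool => ret (a, z) := IsProg.ret (by fun_prop)
  have h1 := acceptProb_le_one hd hS ht hz
  simp only []
  rw [transform_compute e b _ _ hf, poolTest_val, transform_andThen e b _ hprog2 hf,
    transform_coin e b (acceptProb_nonneg (inv_nonneg.mpr hS.det_pos.le) z) h1,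
    ← poolTest_ops (S.det)⁻¹ z, pow_succ]
  simp only [transform_ret e b _ hf]
  ring

/-- The number of operations that prepare the removal steps for a pool of size `t`. -/
def prepareOps (d t : ℕ) : ℕ :=
  d * (d * (2 * t + 1) + 1) + (d * (d + 1) +
      d * (3 * d + (2 * (d * (2 * d + 1)) + 2 * d + 1 + d * (4 * d + 1)) + 1))

theorem prepare_ops {t : ℕ} (y : Fin t → Vec d) :
    (do let G ← Timed.gram y; Timed.invDet G : Timed (Mat d × ℝ)).ops = prepareOps d t := by
  simp only [Timed.bind_ops, Timed.gram_ops, Timed.invDet_ops, prepareOps]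

theorem isProg_volSamp (r : ℕ) : IsProg fun z : Fin (d + r) → Vec d × Vec d => volSamp r z := by
  refine IsProg.compute ?_ ?_
  · simp_rw [prepare_ops]
    exact measurable_const
  · refine isProg_reverseSampling r (measurable_invDet fun i j => ?_).1 measurable_id
    simp only [Timed.gram_val]
    exact measurable_gramMat (y := fun z : Fin (d + r) → Vec d × Vec d => fun i => (z i).2)
      (by fun_prop) i j

/-- The determinant weight hides singular pools, for which `invDet` returns no inverse. -/
theorem det_mul_transform_volSamp (r : ℕ) {f : (Fin d → Vec d) → ENNReal} (hf : Measurable f)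
    (z : Fin (d + r) → Vec d × Vec d) :
    ENNReal.ofReal (gramMat fun i => (z i).2).det * transform e b (volSamp r z) f =
      b ^ prepareOps d (d + r) * poolTransform e b r f z := by
  by_cases h : (gramMat fun i => (z i).2).det = 0
  · simp [poolTransform, h]
  · have hv : (do let G ← Timed.gram fun i => (z i).2; Timed.invDet G : Timed (Mat d × ℝ)).val.1 =
        (gramMat fun i => (z i).2)⁻¹ := by
      rw [Timed.bind_val, Timed.gram_val]
      exact invDet_val_fst (posSemidef_gramMat _) h
    rw [volSamp, transform_compute e b _ _ hf, prepare_ops, hv, poolTransform]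
    ring

/-- Rescaling multiplies row `i` by `√d / √(xᵢᵀ S xᵢ)`. The square of this factor times the density
`xᵢᵀ S xᵢ / m` is `d / m`, free of `xᵢ`. If some `xᵢ` is zero, both determinants vanish. -/
theorem det_gramMat_rescale (hS : S.PosDef) {m : ℝ} (hm : 0 < m) (x : Fin d → Vec d) :
    (∏ i, ENNReal.ofReal (x i ⬝ᵥ S *ᵥ x i / m)) *
        ENNReal.ofReal (gramMat fun i => rescale S (x i)).det =
      ENNReal.ofReal ((d / m) ^ d) * ENNReal.ofReal (gramMat x).det := by
  have h0 : ∀ i, 0 ≤ x i ⬝ᵥ S *ᵥ x i := fun i => hS.posSemidef.dotProduct_mulVec_nonneg (x i)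
  rw [← ENNReal.ofReal_prod_of_nonneg fun i _ => div_nonneg (h0 i) hm.le,
    ← ENNReal.ofReal_mul (Finset.prod_nonneg fun i _ => div_nonneg (h0 i) hm.le),
    ← ENNReal.ofReal_mul (by positivity)]
  congr 1
  rw [det_gramMat_square, det_gramMat_square]
  have hd : (Matrix.of fun i => rescale S (x i)) =
      Matrix.diagonal (fun i => √(d : ℝ) / √(x i ⬝ᵥ S *ᵥ x i)) * Matrix.of x := by
    ext i j
    simp [rescale, Matrix.diagonal_mul]
  rw [hd, det_mul, det_diagonal, mul_pow, ← mul_assoc, ← Finset.prod_pow, ← Finset.prod_mul_distrib]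
  by_cases hx : ∃ i, x i = 0
  · obtain ⟨i, hi⟩ := hx
    have : (Matrix.of x).det = 0 := det_eq_zero_of_row_eq_zero i fun j => by simp [hi]
    simp [this]
  · push Not at hx
    congr 1
    have hi : ∀ i, x i ⬝ᵥ S *ᵥ x i / m * (√(d : ℝ) / √(x i ⬝ᵥ S *ᵥ x i)) ^ 2 = d / m := by
      intro i
      have hp : 0 < x i ⬝ᵥ S *ᵥ x i := hS.dotProduct_mulVec_pos (hx i)
      rw [div_pow, Real.sq_sqrt (by positivity), Real.sq_sqrt hp.le]
      field_simp
    simp_rw [hi]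
    rw [Finset.prod_const, Finset.card_univ, Fintype.card_fin]

theorem lintegral_det_gramMat_leverageLaw [IsProbabilityMeasure D]
    (hD : MemLp (fun x : Vec d => x) 2 D) (hS : S.PosDef)
    (hm : 0 < (S * secondMoment D).trace) (hdet : 0 < (secondMoment D).det)
    {f : (Fin d → Vec d) → ENNReal} (hf : Measurable f) :
    ∫⁻ z, ENNReal.ofReal (gramMat fun i => (z i).2).det * f (fun i => (z i).1)
        ∂(Measure.pi fun _ : Fin d => leverageLaw D S) =
      ENNReal.ofReal ((d / (S * secondMoment D).trace) ^ d *
        (d.factorial * (secondMoment D).det)) * ∫⁻ x, f x ∂(volumeRescaled D d) := by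
  have := isProbabilityMeasure_leverageLaw hD hS.posSemidef hm
  have hr := measurable_rescale S
  have hl := measurable_lev S
  have hg : Measurable fun x : Vec d => (x, rescale S x) := by fun_prop
  have hρ : Measurable fun x : Vec d =>
    ENNReal.ofReal (x ⬝ᵥ S *ᵥ x / (S * secondMoment D).trace) := by fun_prop
  have hF : Measurable fun z : Fin d → Vec d × Vec d =>
      ENNReal.ofReal (gramMat fun i => (z i).2).det * f (fun i => (z i).1) :=
    (measurable_det_gramMat_snd d).mul (hf.comp (by fun_prop))
  have hs : SigmaFinite ((D.withDensity fun x : Vec d =>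
      ENNReal.ofReal (x ⬝ᵥ S *ᵥ x / (S * secondMoment D).trace)).map fun x => (x, rescale S x)) := by
    change SigmaFinite (leverageLaw D S)
    infer_instance
  have h := lintegral_pi_map_withDensity D hρ hg d hF
  rw [leverageLaw, h, ENNReal.ofReal_mul (by positivity), mul_assoc,
    ← lintegral_det_gramMat_mul hdet hf, ← lintegral_const_mul _
    (f := fun x => ENNReal.ofReal (gramMat x).det * f x)
    ((measurable_gramMat_det d).ennreal_ofReal.mul hf)]
  refine lintegral_congr fun x => ?_
  simp only []
  rw [← mul_assoc, det_gramMat_rescale hS hm, mul_assoc]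

/-- The probability that a pool of size `t` is accepted. -/
def poolAcceptance (D : Measure (Vec d)) (S : Mat d) (t : ℕ) : ℝ :=
  t.choose d * d.factorial / (t : ℝ) ^ d *
    ((d / (S * secondMoment D).trace) ^ d * (S * secondMoment D).det)

/-- The acceptance probability is a constant times the Gram determinant, precisely the weight in
`poolTransform`. -/
theorem lintegral_acceptProb_mul [IsProbabilityMeasure D]
    (hD : MemLp (fun x : Vec d => x) 2 D) (hS : S.PosDef)
    (hm : 0 < (S * secondMoment D).trace) (hdet : 0 < (secondMoment D).det)
    (r : ℕ) {f : (Fin d → Vec d) → ENNReal} (hf : Measurable f) :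
    ∫⁻ z, ENNReal.ofReal (acceptProb (S.det)⁻¹ (d + r) z) * transform e b (volSamp r z) f
        ∂(Measure.pi fun _ : Fin (d + r) => leverageLaw D S) =
      ENNReal.ofReal (poolAcceptance D S (d + r)) * (b ^ prepareOps d (d + r) *
        ∏ k ∈ Finset.range r, removalFactor d b k) * ∫⁻ x, f x ∂(volumeRescaled D d) := by
  have := isProbabilityMeasure_leverageLaw hD hS.posSemidef hm
  have hSd := hS.det_pos
  have hz : ∀ z : Fin (d + r) → Vec d × Vec d,
      ENNReal.ofReal (acceptProb (S.det)⁻¹ (d + r) z) * transform e b (volSamp r z) f =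
      ENNReal.ofReal (((d + r : ℕ) : ℝ) ^ d * (S.det)⁻¹)⁻¹ * b ^ prepareOps d (d + r) *
        poolTransform e b r f z := by
    intro z
    rw [mul_assoc, ← det_mul_transform_volSamp e b r hf, acceptProb,
      ENNReal.ofReal_mul (gramMat_det_nonneg _)]
    ring
  simp_rw [hz]
  rw [lintegral_const_mul _ (measurable_poolTransform e b r hf), lintegral_poolTransform e b _ r hf,
    lintegral_det_gramMat_leverageLaw hD hS hm hdet hf]
  have hp : ENNReal.ofReal (poolAcceptance D S (d + r)) =
      ENNReal.ofReal (((d + r : ℕ) : ℝ) ^ d * (S.det)⁻¹)⁻¹ * ((d + r).choose d : ℕ) *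
        ENNReal.ofReal ((d / (S * secondMoment D).trace) ^ d *
          (d.factorial * (secondMoment D).det)) := by
    rw [← ENNReal.ofReal_natCast, ← ENNReal.ofReal_mul (by positivity),
      ← ENNReal.ofReal_mul (by positivity), poolAcceptance, det_mul, mul_inv, inv_inv]
    congr 1
    ring
  rw [hp]
  ring

theorem lintegral_acceptProb [IsProbabilityMeasure D]
    (hD : MemLp (fun x : Vec d => x) 2 D) (hS : S.PosDef)
    (hm : 0 < (S * secondMoment D).trace) (hdet : 0 < (secondMoment D).det) (r : ℕ) :
    ∫⁻ z, ENNReal.ofReal (acceptProb (S.det)⁻¹ (d + r) z)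
        ∂(Measure.pi fun _ : Fin (d + r) => leverageLaw D S) =
      ENNReal.ofReal (poolAcceptance D S (d + r)) := by
  have := isProbabilityMeasure_leverageLaw hD hS.posSemidef hm
  have hSd := hS.det_pos
  have h1 := lintegral_det_gramMat_leverageLaw hD hS hm hdet (f := fun _ => 1) measurable_const
  simp only [mul_one, lintegral_one, volumeRescaled_univ hD hdet] at h1
  simp_rw [acceptProb, ENNReal.ofReal_mul (gramMat_det_nonneg _)]
  rw [lintegral_mul_const _ (measurable_det_gramMat_snd _), lintegral_det_gramMat, h1,
    ← ENNReal.ofReal_natCast, ← ENNReal.ofReal_mul (by positivity),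
    ← ENNReal.ofReal_mul (by positivity), poolAcceptance, det_mul, mul_inv, inv_inv]
  congr 1
  ring

/-- The factor that the accepted pool contributes to the transform, where `g` is the factor of a
single round and `q` its acceptance probability. -/
def roundsFactor (g q : ENNReal) : ENNReal := (1 - g * (1 - q))⁻¹ * (g * q)

/-- The exponential moment of the cost of the algorithm. -/
def costMoment (D : Measure (Vec d)) (S : Mat d) (K : ℝ) (r e : ℕ) (b : ENNReal) : ENNReal :=
  b ^ (d * (d + 1) +
      d * (3 * d + (2 * (d * (2 * d + 1)) + 2 * d + 1 + d * (4 * d + 1)) + 1)) *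
    (roundsFactor ((b * leverageFactor d e b ((S * secondMoment D).trace / K)) ^ (d + r) *
        b ^ poolOps d (d + r)) (ENNReal.ofReal (poolAcceptance D S (d + r))) *
      (b ^ prepareOps d (d + r) * ∏ k ∈ Finset.range r, removalFactor d b k))

/-- The output of the algorithm is a volume-rescaled sample, and it is independent of the cost. -/
theorem transform_detRejectionSampling [IsProbabilityMeasure D] (hd : 1 ≤ d)
    (hD : MemLp (fun x : Vec d => x) 2 D) {Q : Mat d} (hQ : Q.PosDef)
    (hm : 0 < (Q⁻¹ * secondMoment D).trace) (hdet : 0 < (secondMoment D).det) (hK : 0 < K)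
    (hle : ∀ᵐ x ∂D, x ⬝ᵥ Q⁻¹ *ᵥ x ≤ K) (r : ℕ)
    {f : (Fin d → Vec d) → ENNReal} (hf : Measurable f) :
    transform e b (detRejectionSampling D Q K r) f =
      costMoment D Q⁻¹ K r e b * ∫⁻ x, f x ∂(volumeRescaled D d) := by
  have hS := hQ.inv
  have := isProbabilityMeasure_leverageLaw hD hS.posSemidef hm
  have hQd : Q.det ≠ 0 := hQ.det_pos.ne'
  -- The program divides by `det Σ̂`, while the acceptance lemmas are phrased through `S = Σ̂⁻¹`.
  have hδ : Q.det = (Q⁻¹.det)⁻¹ := by rw [det_nonsing_inv, Ring.inverse_eq_inv', inv_inv]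
  have hflag : ∀ v : Bool, MeasurableSet {z : Bool × (Fin (d + r) → Vec d × Vec d) | z.1 = v} :=
    fun v => measurable_fst (measurableSet_singleton v)
  have hv := isProg_volSamp (d := d) r
  have hvf := hv.measurable_transform e b hf
  have hacc := measurable_acceptProb (d := d) (Q⁻¹.det)⁻¹ (d + r)
  have ht : 0 < d + r := by omega
  have hT := transform_poolTrial e b hd hD hS hm hK hle ht
    (f := fun z => if z.1 = true then transform e b (volSamp r z.2) f else 0)
    (Measurable.ite (hflag true) (hvf.comp measurable_snd) measurable_const)
  have hF := transform_poolTrial e b hd hD hS hm hK hle ht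
    (f := fun z => if z.1 = false then 1 else 0)
    (Measurable.ite (hflag false) measurable_const measurable_const)
  simp only [Bool.true_eq_false, Bool.false_eq_true, if_true, if_false, mul_zero, mul_one, zero_add,
    add_zero] at hT hF
  have hF' : ∫⁻ z, ENNReal.ofReal (1 - acceptProb (Q⁻¹.det)⁻¹ (d + r) z)
      ∂(Measure.pi fun _ : Fin (d + r) => leverageLaw D Q⁻¹) =
      1 - ENNReal.ofReal (poolAcceptance D Q⁻¹ (d + r)) := by
    have hle1 : ∀ᵐ z ∂(Measure.pi fun _ : Fin (d + r) => leverageLaw D Q⁻¹),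
        acceptProb (Q⁻¹.det)⁻¹ (d + r) z ≤ 1 :=
      (leverageLaw_pool_ae hD hS.posSemidef hm (d + r)).mono fun z hz =>
        acceptProb_le_one hd hS ht hz
    have hnn : ∀ z : Fin (d + r) → Vec d × Vec d, 0 ≤ acceptProb (Q⁻¹.det)⁻¹ (d + r) z :=
      acceptProb_nonneg (inv_nonneg.mpr hS.det_pos.le)
    simp_rw [ENNReal.ofReal_sub _ (hnn _), ENNReal.ofReal_one]
    rw [lintegral_sub hacc.ennreal_ofReal, lintegral_acceptProb hD hS hm hdet]
    · simp
    · rw [lintegral_acceptProb hD hS hm hdet]; exact ENNReal.ofReal_ne_top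
    · exact hle1.mono fun z hz => by simpa using hz
  have hmass : poolTrial D Q⁻¹ (Q⁻¹.det)⁻¹ K (d + r) Set.univ ≤ 1 :=
    (isProg_poolTrial (γ := Unit) _ _).mass_le ()
  rw [detRejectionSampling, transform_compute e b _ _ hf, Timed.invDet_ops,
    invDet_val_fst hQ.posSemidef hQd, invDet_val_snd hQ.posSemidef, hδ,
    transform_andThen e b _ hv hf, transform_repeatUntil e b hmass hvf, hT, hF, hF',
    lintegral_acceptProb_mul e b hD hS hm hdet r hf, costMoment, roundsFactor]
  ring

end Algorithm

/-! ### Consequences of the approximation `Σ̂ ≈ Σ` -/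

section Approximation

variable {d : ℕ} {P Q : Mat d} {ε : ℝ}

/-- The two semidefinite differences add up to `2 ε P`, so `P` is semidefinite; invertibility does
the rest. -/
theorem posDef_of_approx (hP : IsUnit P) (hε : 0 < ε) (h1 : (Q - (1 - ε) • P).PosSemidef)
    (h2 : ((1 + ε) • P - Q).PosSemidef) : P.PosDef := by
  have h : ((2 * ε)⁻¹ • ((Q - (1 - ε) • P) + ((1 + ε) • P - Q))).PosSemidef :=
    (h1.add h2).smul (by positivity)
  have h3 : (2 * ε)⁻¹ • ((Q - (1 - ε) • P) + ((1 + ε) • P - Q)) = P := by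
    have : (Q - (1 - ε) • P) + ((1 + ε) • P - Q) = (2 * ε) • P := by module
    rw [this, smul_smul, inv_mul_cancel₀ (by positivity), one_smul]
  rw [h3] at h
  exact h.posDef_iff_isUnit.mpr hP

theorem posDef_approx (hP : P.PosDef) (hε : ε < 1) (h1 : (Q - (1 - ε) • P).PosSemidef) :
    Q.PosDef := by
  have : ((1 - ε) • P + (Q - (1 - ε) • P)).PosDef := (hP.smul (sub_pos.mpr hε)).add_posSemidef h1
  simpa using this

theorem inv_smul_of_pos (hP : P.PosDef) {c : ℝ} (hc : 0 < c) : (c • P)⁻¹ = c⁻¹ • P⁻¹ := by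
  have hu : IsUnit P.det := (Matrix.isUnit_iff_isUnit_det _).mp hP.isUnit
  refine inv_eq_right_inv ?_
  rw [Matrix.smul_mul, Matrix.mul_smul, smul_smul, mul_inv_cancel₀ hc.ne', one_smul,
    mul_nonsing_inv _ hu]

theorem inv_approx_lower (hP : P.PosDef) (hε : 0 < ε) (hQ : Q.PosDef)
    (h2 : ((1 + ε) • P - Q).PosSemidef) : (Q⁻¹ - (1 + ε)⁻¹ • P⁻¹).PosSemidef := by
  have hc : 0 < 1 + ε := by positivity
  have := posSemidef_inv_sub_inv hQ (hP.smul hc) h2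
  rwa [inv_smul_of_pos hP hc] at this

theorem quad_inv_approx_le (hP : P.PosDef) (hε : ε < 1) (hQ : Q.PosDef)
    (h1 : (Q - (1 - ε) • P).PosSemidef) (x : Vec d) :
    x ⬝ᵥ Q⁻¹ *ᵥ x ≤ (1 - ε)⁻¹ * (x ⬝ᵥ P⁻¹ *ᵥ x) := by
  have hc : 0 < 1 - ε := sub_pos.mpr hε
  have h := posSemidef_inv_sub_inv (hP.smul hc) hQ h1
  rw [inv_smul_of_pos hP hc] at h
  have h' := h.dotProduct_mulVec_nonneg x
  simp only [star_trivial, sub_mulVec, dotProduct_sub, smul_mulVec, dotProduct_smul,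
    smul_eq_mul] at h'
  linarith

theorem trace_inv_mul_self (hP : P.PosDef) : (P⁻¹ * P).trace = d := by
  rw [nonsing_inv_mul _ ((Matrix.isUnit_iff_isUnit_det _).mp hP.isUnit)]
  simp

theorem trace_approx_ge (hP : P.PosDef) (hε : 0 < ε) (hQ : Q.PosDef)
    (h2 : ((1 + ε) • P - Q).PosSemidef) : d / (1 + ε) ≤ (Q⁻¹ * P).trace := by
  have h := trace_mul_nonneg (inv_approx_lower hP hε hQ h2) hP.posSemidef
  rw [Matrix.sub_mul, trace_sub, Matrix.smul_mul, trace_smul, trace_inv_mul_self hP,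
    smul_eq_mul] at h
  rw [div_eq_inv_mul]
  linarith

/-- A form of the Kantorovich inequality. -/
theorem trace_approx_add_le (hP : P.PosDef) (hε : 0 < ε) (hQ : Q.PosDef)
    (h1 : (Q - (1 - ε) • P).PosSemidef) (h2 : ((1 + ε) • P - Q).PosSemidef) :
    (1 - ε ^ 2) * (Q⁻¹ * P).trace + (P⁻¹ * Q).trace ≤ 2 * d := by
  have hc : 0 < 1 + ε := by positivity
  -- The trace of the product of `Q⁻¹ - (1 + ε)⁻¹ P⁻¹` and `Q - (1 - ε) P`, both semidefinite, is
  -- nonnegative; expanding it gives the claim.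
  have h := trace_mul_nonneg (inv_approx_lower hP hε hQ h2) h1
  simp only [Matrix.sub_mul, Matrix.mul_sub, Matrix.smul_mul, Matrix.mul_smul, trace_sub,
    trace_smul, smul_eq_mul, trace_inv_mul_self hP, trace_inv_mul_self hQ] at h
  have h' := mul_nonneg hc.le h
  have h3 : (1 + ε) * (d - (1 + ε)⁻¹ * (P⁻¹ * Q).trace -
      (1 - ε) * ((Q⁻¹ * P).trace - (1 + ε)⁻¹ * d)) =
      2 * d - (1 - ε ^ 2) * (Q⁻¹ * P).trace - (P⁻¹ * Q).trace := by
    field_simp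
    ring
  rw [h3] at h'
  linarith

/-- Let `m = tr (Q⁻¹ P)` and `n = tr (P⁻¹ Q)`. The mean inequality for the eigenvalues bounds `det
(P⁻¹ Q)` by `(n / d) ^ d`, and the trace inequality bounds `m n`. The errors thus enter through `ε ^
2`, so that `ε` of order `1 / √d` is enough. -/
theorem det_ratio_ge (hd : 1 ≤ d) (hP : P.PosDef) (hε : 0 < ε) (hε1 : ε < 1) (hQ : Q.PosDef)
    (h1 : (Q - (1 - ε) • P).PosSemidef) (h2 : ((1 + ε) • P - Q).PosSemidef) :
    (1 - ε ^ 2) ^ d ≤ (d / (Q⁻¹ * P).trace) ^ d * (Q⁻¹ * P).det := by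
  have hd0 : (0 : ℝ) < d := by exact_mod_cast hd
  have hm : 0 < (Q⁻¹ * P).trace :=
    lt_of_lt_of_le (by positivity) (trace_approx_ge hP hε hQ h2)
  set m := (Q⁻¹ * P).trace with hmdef
  set n := (P⁻¹ * Q).trace with hndef
  have hk : (1 - ε ^ 2) * m + n ≤ 2 * d := trace_approx_add_le hP hε hQ h1 h2
  have hc : 0 < 1 - ε ^ 2 := by nlinarith
  have hdet := det_mul_le_trace_div_pow hd hP.inv.posSemidef hQ.posSemidef
  rw [← hndef, det_mul, det_nonsing_inv, Ring.inverse_eq_inv'] at hdet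
  have hPd := hP.det_pos
  have hQd := hQ.det_pos
  have hn0 : 0 ≤ n := trace_mul_nonneg hP.inv.posSemidef hQ.posSemidef
  rw [det_mul, det_nonsing_inv, Ring.inverse_eq_inv']
  -- With `a = (1 - ε ^ 2) m`, this is `4 a n ≤ (a + n) ^ 2 ≤ (2 d) ^ 2`.
  have hmn : (1 - ε ^ 2) * (m * n) ≤ d ^ 2 := by
    nlinarith [sq_nonneg ((1 - ε ^ 2) * m - n), mul_pos hc hm,
      mul_self_le_mul_self (by positivity : 0 ≤ (1 - ε ^ 2) * m + n) hk]
  have hx : (1 - ε ^ 2) * (n / d) ≤ d / m := by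
    rw [mul_div_assoc', div_le_div_iff₀ hd0 hm]
    nlinarith
  have hinv : (P.det⁻¹ * Q.det) * (Q.det⁻¹ * P.det) = 1 := by field_simp
  calc (1 - ε ^ 2) ^ d = (1 - ε ^ 2) ^ d * ((P.det⁻¹ * Q.det) * (Q.det⁻¹ * P.det)) := by
        rw [hinv, mul_one]
    _ ≤ (1 - ε ^ 2) ^ d * ((n / d) ^ d * (Q.det⁻¹ * P.det)) := by gcongr
    _ = ((1 - ε ^ 2) * (n / d)) ^ d * (Q.det⁻¹ * P.det) := by rw [mul_pow]; ring
    _ ≤ (d / m) ^ d * (Q.det⁻¹ * P.det) := by gcongr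

/-- The falling factorial is at least `(2 d ^ 2 - d) ^ d`, so the ratio is at least `(1 - 1 / (2 d))
^ d`, which is at least `1 / 2` by Bernoulli's inequality. -/
theorem half_le_descFactorial_div (hd : 1 ≤ d) :
    (1 / 2 : ℝ) ≤ ((2 * d ^ 2).choose d * d.factorial : ℝ) / ((2 * d ^ 2 : ℕ) : ℝ) ^ d := by
  have hd0 : (0 : ℝ) < d := by exact_mod_cast hd
  have h1 := Nat.pow_sub_le_descFactorial (2 * d ^ 2) d
  rw [Nat.descFactorial_eq_factorial_mul_choose] at h1
  have hle : d ≤ 2 * d ^ 2 + 1 := by nlinarith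
  have h2 : ((2 * d ^ 2 + 1 - d : ℕ) : ℝ) ^ d ≤ ((2 * d ^ 2).choose d * d.factorial : ℝ) := by
    rw [mul_comm d.factorial] at h1; exact_mod_cast h1
  rw [Nat.cast_sub hle] at h2
  push_cast at h2 ⊢
  have ht : (0 : ℝ) < (2 * (d : ℝ) ^ 2) ^ d := by positivity
  rw [le_div_iff₀ ht]
  refine le_trans ?_ h2
  have hb := one_add_mul_le_pow (a := -(1 / (2 * d) : ℝ)) (by
    have : (1 / (2 * d) : ℝ) ≤ 1 := by
      rw [div_le_one (by positivity)]
      have : (1 : ℝ) ≤ d := by exact_mod_cast hd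
      linarith
    linarith) d
  have hb' : (1 / 2 : ℝ) ≤ (1 + -(1 / (2 * d) : ℝ)) ^ d := by
    refine le_trans (le_of_eq ?_) hb
    field_simp
    norm_num
  calc (1 / 2 : ℝ) * (2 * (d : ℝ) ^ 2) ^ d ≤ (1 + -(1 / (2 * d) : ℝ)) ^ d * (2 * (d : ℝ) ^ 2) ^ d := by
        gcongr
    _ = (2 * (d : ℝ) ^ 2 - d) ^ d := by
        rw [← mul_pow]
        congr 1
        field_simp
        ring
    _ ≤ _ := by
        have : (1 : ℝ) ≤ d := by exact_mod_cast hd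
        refine pow_le_pow_left₀ ?_ ?_ d
        · nlinarith
        · linarith

end Approximation

theorem poolAcceptance_ge {d : ℕ} (hd : 1 ≤ d) {D : Measure (Vec d)} {Q : Mat d} {ε : ℝ}
    (hP : (secondMoment D).PosDef) (hε : 0 < ε) (hε1 : ε < 1) (hε2 : ε ^ 2 = 1 / (2 * d))
    (hQ : Q.PosDef) (h1 : (Q - (1 - ε) • secondMoment D).PosSemidef)
    (h2 : ((1 + ε) • secondMoment D - Q).PosSemidef) :
    1 / 4 ≤ poolAcceptance D Q⁻¹ (2 * d ^ 2) := by
  have hd0 : (0 : ℝ) < d := by exact_mod_cast hd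
  have h3 := det_ratio_ge hd hP hε hε1 hQ h1 h2
  have h4 := half_le_descFactorial_div hd
  have hb := one_add_mul_le_pow (a := -ε ^ 2) (by nlinarith) d
  have hb' : (1 / 2 : ℝ) ≤ (1 - ε ^ 2) ^ d := by
    rw [sub_eq_add_neg]
    refine le_trans (le_of_eq ?_) hb
    rw [hε2]
    field_simp
    norm_num
  rw [poolAcceptance]
  calc (1 / 4 : ℝ) = 1 / 2 * (1 / 2) := by norm_num
    _ ≤ _ := mul_le_mul h4 (hb'.trans h3) (by norm_num) (le_trans (by norm_num) h4)

section Support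

variable {d : ℕ} {D : Measure (Vec d)} {Q : Mat d} {ε K : ℝ}

/-- The hypothesis on `K` sees only its positive part, hence `max K 0`; positivity of `K` is deduced
from this bound later. -/
theorem quad_inv_le_ae (hP : (secondMoment D).PosDef) (hε1 : ε < 1)
    (hQ : Q.PosDef) (h1 : (Q - (1 - ε) • secondMoment D).PosSemidef)
    (hK : condNumber D / ENNReal.ofReal (1 - ε) ≤ ENNReal.ofReal K) :
    ∀ᵐ x ∂D, x ⬝ᵥ Q⁻¹ *ᵥ x ≤ max K 0 := by
  have hc : 0 < 1 - ε := sub_pos.mpr hε1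
  filter_upwards [Measure.support_mem_ae (μ := D)] with x hx
  have hx1 : ENNReal.ofReal (x ⬝ᵥ (secondMoment D)⁻¹ *ᵥ x) ≤ condNumber D :=
    le_iSup₂ (f := fun x (_ : x ∈ D.support) =>
      ENNReal.ofReal (x ⬝ᵥ (secondMoment D)⁻¹ *ᵥ x)) x hx
  have hx2 : condNumber D ≤ ENNReal.ofReal K * ENNReal.ofReal (1 - ε) :=
    (ENNReal.div_le_iff (ENNReal.ofReal_pos.mpr hc).ne' ENNReal.ofReal_ne_top).mp hK
  have hx3 : x ⬝ᵥ (secondMoment D)⁻¹ *ᵥ x ≤ max K 0 * (1 - ε) := by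
    have h := hx1.trans hx2
    have hmax : ENNReal.ofReal K = ENNReal.ofReal (max K 0) := by
      rw [ENNReal.ofReal_max]; simp
    rw [hmax, ← ENNReal.ofReal_mul (by positivity)] at h
    exact (ENNReal.ofReal_le_ofReal_iff (by positivity)).mp h
  refine (quad_inv_approx_le hP hε1 hQ h1 x).trans ?_
  rw [inv_mul_le_iff₀ hc]
  linarith

theorem trace_le_of_ae [IsProbabilityMeasure D] (hD : MemLp (fun x : Vec d => x) 2 D) {S : Mat d} {B : ℝ}
    (h : ∀ᵐ x ∂D, x ⬝ᵥ S *ᵥ x ≤ B) : (S * secondMoment D).trace ≤ B := by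
  have hi := integral_quad hD S
  rw [← hi.2]
  simpa using integral_mono_ae hi.1 (integrable_const B) h

end Support

/-! ### Bounds on the moments of the cost -/

section Cost

/-- The moment of a geometric number of rounds, where `g` is the moment of the cost of a round and
`p` its success probability. -/
def geomFactor (g : ENNReal) (p : ℝ) : ENNReal :=
  (1 - g * ENNReal.ofReal (1 - p))⁻¹ * (g * ENNReal.ofReal p)

theorem geomFactor_one {p : ℝ} (hp : 0 < p) (hp1 : p ≤ 1) : geomFactor 1 p = 1 := by
  have h : 1 - ENNReal.ofReal (1 - p) = ENNReal.ofReal p := by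
    rw [← ENNReal.ofReal_one, ← ENNReal.ofReal_sub _ (by linarith), sub_sub_cancel]
  rw [geomFactor, one_mul, one_mul, h]
  exact ENNReal.inv_mul_cancel (ENNReal.ofReal_pos.mpr hp).ne' ENNReal.ofReal_ne_top

/-- A round of cost moment at most `e ^ a`, repeated until a success of probability `p`, behaves up
to a factor `2` in the exponent as if it ran the expected `1 / p` times. -/
theorem geomFactor_le {g : ENNReal} {a p : ℝ} (ha : 0 ≤ a) (hp : 0 < p) (hp1 : p ≤ 1)
    (hap : a ≤ p / 2) (hg : g ≤ ENNReal.ofReal (Real.exp a)) :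
    geomFactor g p ≤ ENNReal.ofReal (Real.exp (2 * (a / p))) := by
  have hpa : 0 < p - a := by linarith
  have he := Real.add_one_le_exp (-a)
  have hE := Real.exp_pos a
  have hmul : Real.exp a * Real.exp (-a) = 1 := by rw [← Real.exp_add]; simp
  -- Equivalent to `(1 - a) e ^ a ≤ 1`.
  have h1 : Real.exp a * (p - a) ≤ 1 - Real.exp a * (1 - p) := by nlinarith
  have hpos : 0 < Real.exp a * (p - a) := by positivity
  have hF : ENNReal.ofReal (Real.exp a * (p - a)) ≤ 1 - g * ENNReal.ofReal (1 - p) := by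
    calc ENNReal.ofReal (Real.exp a * (p - a))
        ≤ ENNReal.ofReal (1 - Real.exp a * (1 - p)) := ENNReal.ofReal_le_ofReal h1
      _ = 1 - ENNReal.ofReal (Real.exp a) * ENNReal.ofReal (1 - p) := by
          rw [ENNReal.ofReal_sub _ (mul_nonneg hE.le (by linarith)), ENNReal.ofReal_one,
            ENNReal.ofReal_mul hE.le]
      _ ≤ 1 - g * ENNReal.ofReal (1 - p) := tsub_le_tsub_left (by gcongr) 1
  have hu : a / p ≤ 1 / 2 := by
    rw [div_le_iff₀ hp]; linarith
  have hu0 : 0 ≤ a / p := by positivity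
  calc geomFactor g p
      ≤ (ENNReal.ofReal (Real.exp a * (p - a)))⁻¹ *
          (ENNReal.ofReal (Real.exp a) * ENNReal.ofReal p) := by
        unfold geomFactor
        gcongr
    _ = ENNReal.ofReal ((Real.exp a * (p - a))⁻¹ * (Real.exp a * p)) := by
        rw [← ENNReal.ofReal_mul hE.le, ← ENNReal.ofReal_inv_of_pos hpos,
          ← ENNReal.ofReal_mul (by positivity)]
    _ ≤ ENNReal.ofReal (Real.exp (2 * (a / p))) := by
        refine ENNReal.ofReal_le_ofReal ?_
        -- With `w = a / p ≤ 1 / 2`, the bound `(1 - w)⁻¹ ≤ 1 + 2 w ≤ e ^ (2 w)` finishes.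
        have h2 : (Real.exp a * (p - a))⁻¹ * (Real.exp a * p) = (1 - a / p)⁻¹ := by
          field_simp
        rw [h2]
        have h3 := Real.add_one_le_exp (2 * (a / p))
        refine le_trans ?_ h3
        rw [inv_le_iff_one_le_mul₀ (by linarith)]
        nlinarith

theorem ofReal_exp_pow (x : ℝ) (n : ℕ) :
    ENNReal.ofReal (Real.exp x) ^ n = ENNReal.ofReal (Real.exp (n * x)) := by
  rw [← ENNReal.ofReal_pow (Real.exp_pos x).le, ← Real.exp_nat_mul]

theorem ofReal_exp_pow_le {x y : ℝ} {n : ℕ} (h : n * x ≤ y) :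
    ENNReal.ofReal (Real.exp x) ^ n ≤ ENNReal.ofReal (Real.exp y) := by
  rw [ofReal_exp_pow]
  exact ENNReal.ofReal_le_ofReal (Real.exp_le_exp.mpr h)

theorem mul_le_ofReal_exp {u v : ENNReal} {x y z : ℝ} (hu : u ≤ ENNReal.ofReal (Real.exp x))
    (hv : v ≤ ENNReal.ofReal (Real.exp y)) (h : x + y ≤ z) :
    u * v ≤ ENNReal.ofReal (Real.exp z) := by
  refine (mul_le_mul' hu hv).trans ?_
  rw [← ENNReal.ofReal_mul (Real.exp_pos x).le, ← Real.exp_add]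
  exact ENNReal.ofReal_le_ofReal (Real.exp_le_exp.mpr h)

theorem pow_le_ofReal_exp {u : ENNReal} {x y : ℝ} {n : ℕ} (hu : u ≤ ENNReal.ofReal (Real.exp x))
    (h : n * x ≤ y) : u ^ n ≤ ENNReal.ofReal (Real.exp y) :=
  (pow_le_pow_left' hu n).trans (ofReal_exp_pow_le h)

theorem prod_le_ofReal_exp {u : ℕ → ENNReal} {x : ℕ → ℝ} {n : ℕ}
    (hu : ∀ k ∈ Finset.range n, u k ≤ ENNReal.ofReal (Real.exp (x k))) :
    ∏ k ∈ Finset.range n, u k ≤ ENNReal.ofReal (Real.exp (∑ k ∈ Finset.range n, x k)) := by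
  rw [Real.exp_sum, ENNReal.ofReal_prod_of_nonneg fun _ _ => (Real.exp_pos _).le]
  exact Finset.prod_le_prod' hu

/-- A crude stand-in for the logarithmic bound. For at most `2 d ^ 2` terms it gives `O(d)`, which
suffices for a removal cost of order `d ^ 4`. -/
theorem sum_inv_le_sqrt (n : ℕ) : ∑ k ∈ Finset.range n, (1 / (k + 1) : ℝ) ≤ 2 * √n := by
  induction n with
  | zero => simp
  | succ n ih =>
    rw [Finset.sum_range_succ]
    have h0 := Real.sqrt_nonneg (n : ℝ)
    have h1 : (0 : ℝ) < √((n + 1 : ℕ) : ℝ) := Real.sqrt_pos.mpr (by positivity)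
    have h2 : √(n : ℝ) ^ 2 = n := Real.sq_sqrt (by positivity)
    have h3 : √((n + 1 : ℕ) : ℝ) ^ 2 = n + 1 := by
      rw [Real.sq_sqrt (by positivity)]; push_cast; ring
    have h4 : (1 / (n + 1) : ℝ) ≤ 2 * √((n + 1 : ℕ) : ℝ) - 2 * √(n : ℝ) := by
      rw [← h3, div_le_iff₀ (by positivity)]
      set s := √((n + 1 : ℕ) : ℝ)
      set q := √(n : ℝ)
      have hs1 : 1 ≤ s := by
        rw [← Real.sqrt_one]
        exact Real.sqrt_le_sqrt (by push_cast; linarith [(Nat.cast_nonneg n : (0 : ℝ) ≤ n)])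
      have hqs : q ≤ s := by nlinarith
      have hd : (s - q) * (s + q) = 1 := by nlinarith
      have : 1 ≤ (s - q) * (2 * s) := by nlinarith [mul_nonneg (sub_nonneg.mpr hqs) (sub_nonneg.mpr hqs)]
      nlinarith
    linarith

variable {d : ℕ}

theorem removalFactor_eq (b : ENNReal) (r : ℕ) :
    removalFactor d b r =
      b ^ (2 * d + (2 * (d * (2 * d + 1)) + 2 * d + 1 + d * (4 * d + 1)) + (d + r + 1)) *
        geomFactor (b ^ removalOps d) ((r + 1 : ℝ) / (d + r + 1)) := by
  have h : (1 - (r + 1 : ℝ) / (d + r + 1)) = (d : ℝ) / (d + r + 1) := by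
    field_simp
    ring
  have h1 : ENNReal.ofReal (d + r + 1) = d + r + 1 := by
    rw [ENNReal.ofReal_add (by positivity) zero_le_one,
      ENNReal.ofReal_add (by positivity) (by positivity)]
    simp
  have h2 : ENNReal.ofReal (r + 1) = r + 1 := by
    rw [ENNReal.ofReal_add (by positivity) zero_le_one]
    simp
  rw [removalFactor, geomFactor, h, ENNReal.ofReal_div_of_pos (by positivity),
    ENNReal.ofReal_div_of_pos (by positivity), h1, h2, ENNReal.ofReal_natCast]

theorem removalFactor_one (r : ℕ) : removalFactor d 1 r = 1 := by
  rw [removalFactor_eq, one_pow, one_pow, one_mul, geomFactor_one (by positivity)]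
  rw [div_le_one (by positivity)]
  linarith [(Nat.cast_nonneg d : (0 : ℝ) ≤ d)]

theorem leverageFactor_one {e : ℕ} {p : ℝ} (hp : 0 < p) (hp1 : p ≤ 1) :
    leverageFactor d e 1 p = 1 := by
  have h := geomFactor_one hp hp1
  rw [geomFactor] at h
  rw [leverageFactor, one_pow, one_pow, one_mul, h]

theorem roundsFactor_eq {g : ENNReal} {q : ℝ} (hq : 0 ≤ q) :
    roundsFactor g (ENNReal.ofReal q) = geomFactor g q := by
  rw [roundsFactor, geomFactor, ENNReal.ofReal_sub _ hq, ENNReal.ofReal_one]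

variable {D : Measure (Vec d)} {S : Mat d} {K : ℝ}

theorem costMoment_one {r e : ℕ} (hK : 0 < K) (hm : 0 < (S * secondMoment D).trace)
    (hmK : (S * secondMoment D).trace ≤ K) (hq : 0 < poolAcceptance D S (d + r))
    (hq1 : poolAcceptance D S (d + r) ≤ 1) : costMoment D S K r e 1 = 1 := by
  rw [costMoment, leverageFactor_one (by positivity) ((div_le_one hK).mpr hmK)]
  simp only [one_pow, one_mul, removalFactor_one, Finset.prod_const_one, mul_one]
  rw [roundsFactor_eq hq.le, geomFactor_one hq hq1]

/-- A trial costs at most `9 d ^ 2`, including `d ^ 2` for the draw, and about `2 K / d` trials are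
expected. At rate `c / (K d ^ 3)` this gives `18 c / d ^ 2`, doubled by `geomFactor_le`; rescaling
and storing the point add `12 c / d ^ 2`. The condition `c ≤ 1 / 36` ensures `a ≤ p / 2`. -/
theorem leverageFactor_le (hd : 1 ≤ d) {c p : ℝ} (hc : 0 < c) (hc1 : c ≤ 1 / 36) (hK : d / 2 ≤ K)
    (hp : d / (2 * K) ≤ p) (hp1 : p ≤ 1) :
    ENNReal.ofReal (Real.exp (c / (K * d ^ 3))) *
      leverageFactor d (d ^ 2) (ENNReal.ofReal (Real.exp (c / (K * d ^ 3)))) p ≤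
      ENNReal.ofReal (Real.exp (48 * c / d ^ 2)) := by
  have hd1 : (1 : ℝ) ≤ d := by exact_mod_cast hd
  have hK0 : 0 < K := by linarith
  set l := c / (K * d ^ 3) with hl
  have hl0 : 0 < l := by positivity
  have hlK : l * (K * d ^ 3) = c := by rw [hl]; field_simp
  have hp0 : 0 < p := lt_of_lt_of_le (by positivity) hp
  have hpK : d ≤ p * (2 * K) := by rwa [div_le_iff₀ (by positivity)] at hp
  have ha : 9 * d ^ 2 * l ≤ 18 * c / d ^ 2 * p := by
    rw [div_mul_eq_mul_div, le_div_iff₀ (by positivity), ← hlK]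
    have := mul_le_mul_of_nonneg_left hpK (by positivity : 0 ≤ 9 * l * d ^ 3)
    nlinarith
  have hcd : c / d ^ 2 ≤ 1 / 36 := by
    rw [div_le_iff₀ (by positivity)]; nlinarith
  have hg := geomFactor_le (g := ENNReal.ofReal (Real.exp l) ^ leverageOps d (d ^ 2))
    (a := 9 * d ^ 2 * l) (p := p) (by positivity) hp0 hp1 (by
      refine ha.trans ?_
      have : 18 * c / d ^ 2 = 18 * (c / d ^ 2) := by ring
      rw [this]; nlinarith) (ofReal_exp_pow_le (by
        simp only [leverageOps]
        push_cast
        refine mul_le_mul_of_nonneg_right ?_ hl0.le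
        nlinarith))
  have h2 : 2 * (9 * d ^ 2 * l / p) ≤ 36 * c / d ^ 2 := by
    have : 9 * d ^ 2 * l / p ≤ 18 * c / d ^ 2 := by rwa [div_le_iff₀ hp0]
    have h3 : 36 * c / d ^ 2 = 2 * (18 * c / d ^ 2) := by ring
    linarith
  have h3 : (2 * d + 4) * l ≤ 12 * c / d ^ 2 := by
    rw [le_div_iff₀ (by positivity), ← hlK]
    have : (2 * (d : ℝ) + 4) * d ^ 2 ≤ 12 * (K * d ^ 3) := by
      have h5 : (d : ℝ) ^ 3 * (d / 2) ≤ d ^ 3 * K := by gcongr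
      have h6 : (d : ℝ) ^ 2 * 1 ≤ d ^ 2 * d := by gcongr
      have h7 : (d : ℝ) ^ 3 * 1 ≤ d ^ 3 * d := by gcongr
      nlinarith
    nlinarith
  have hgl : leverageFactor d (d ^ 2) (ENNReal.ofReal (Real.exp l)) p =
      ENNReal.ofReal (Real.exp l) ^ (2 * d + 3) *
        geomFactor (ENNReal.ofReal (Real.exp l) ^ leverageOps d (d ^ 2)) p := rfl
  rw [hgl, ← mul_assoc, ← pow_succ']
  refine mul_le_ofReal_exp (ofReal_exp_pow_le (y := 12 * c / d ^ 2) ?_) (hg.trans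
    (ENNReal.ofReal_le_ofReal (Real.exp_le_exp.mpr h2))) (le_of_eq (by ring))
  push_cast
  linarith

/-- A trial costs at most `8 d ^ 2`, the update together with the array shift at most `18 d ^ 2`,
and the expected number of trials is `1 + d / (k + 1)`. Since that number is at most `2 d`, the
bound `u ≤ 1 / 32` makes `geomFactor_le` applicable. -/
theorem removalFactor_le (hd : 1 ≤ d) {l u : ℝ} (hl : 0 ≤ l) (hu : d ^ 4 * l ≤ u)
    (hu1 : u ≤ 1 / 32) {k : ℕ} (hk : d + k + 1 ≤ 2 * d ^ 2) :
    removalFactor d (ENNReal.ofReal (Real.exp l)) k ≤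
      ENNReal.ofReal (Real.exp (34 * u / d ^ 2 + 16 * u / d * (1 / (k + 1)))) := by
  have hd1 : (1 : ℝ) ≤ d := by exact_mod_cast hd
  have hk' : (d + k + 1 : ℝ) ≤ 2 * d ^ 2 := by exact_mod_cast hk
  have hu0 : 0 ≤ u := le_trans (by positivity) hu
  have hdl : d ^ 2 * l ≤ u / d ^ 2 := by
    rw [le_div_iff₀ (by positivity)]
    refine le_trans (le_of_eq ?_) hu
    ring
  set p : ℝ := (k + 1 : ℝ) / (d + k + 1) with hp
  have hp0 : 0 < p := by positivity
  have hp1 : p ≤ 1 := by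
    rw [hp, div_le_one (by positivity)]; linarith
  have hpinv : p⁻¹ = 1 + d * (1 / (k + 1)) := by
    rw [hp, inv_div]; field_simp; ring
  have hk1 : (1 : ℝ) / (k + 1) ≤ 1 := by
    rw [div_le_one (by positivity)]; linarith [(Nat.cast_nonneg k : (0 : ℝ) ≤ k)]
  have hpd : p⁻¹ ≤ 2 * d := by rw [hpinv]; nlinarith
  have hpd' : 1 ≤ 2 * d * p := by
    have := mul_le_mul_of_nonneg_right hpd hp0.le
    rwa [inv_mul_cancel₀ hp0.ne'] at this
  have hud : u / d ^ 2 ≤ 1 / (32 * d) := by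
    rw [div_le_div_iff₀ (by positivity) (by positivity)]
    nlinarith
  have hg := geomFactor_le (g := ENNReal.ofReal (Real.exp l) ^ removalOps d)
    (a := 8 * (u / d ^ 2)) (p := p) (by positivity) hp0 hp1 (by
      have : (1 : ℝ) / (32 * d) ≤ p / 16 := by
        rw [div_le_div_iff₀ (by positivity) (by positivity)]; linarith
      linarith) (ofReal_exp_pow_le (by
        simp only [removalOps]
        push_cast
        refine le_trans ?_ (mul_le_mul_of_nonneg_left hdl (by norm_num : (0 : ℝ) ≤ 8))
        rw [← mul_assoc]
        refine mul_le_mul_of_nonneg_right ?_ hl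
        nlinarith))
  rw [removalFactor_eq]
  refine mul_le_ofReal_exp (ofReal_exp_pow_le (y := 18 * (u / d ^ 2)) ?_) hg ?_
  · push_cast
    refine le_trans ?_ (mul_le_mul_of_nonneg_left hdl (by norm_num : (0 : ℝ) ≤ 18))
    rw [← mul_assoc (18 : ℝ)]
    refine mul_le_mul_of_nonneg_right ?_ hl
    nlinarith
  · rw [div_eq_mul_inv (8 * (u / d ^ 2)) p, hpinv]
    refine le_of_eq ?_
    field_simp
    ring

theorem prod_removalFactor_le (hd : 1 ≤ d) {l u : ℝ} (hl : 0 ≤ l) (hu : d ^ 4 * l ≤ u)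
    (hu1 : u ≤ 1 / 32) :
    ∏ k ∈ Finset.range (2 * d ^ 2 - d), removalFactor d (ENNReal.ofReal (Real.exp l)) k ≤
      ENNReal.ofReal (Real.exp (116 * u)) := by
  have hd1 : (1 : ℝ) ≤ d := by exact_mod_cast hd
  have hu0 : 0 ≤ u := le_trans (by positivity) hu
  refine (prod_le_ofReal_exp fun k hk => removalFactor_le hd hl hu hu1 (k := k) ?_).trans
    (ENNReal.ofReal_le_ofReal (Real.exp_le_exp.mpr ?_))
  · have := Finset.mem_range.mp hk
    omega
  · rw [Finset.sum_add_distrib, ← Finset.mul_sum, Finset.sum_const, Finset.card_range,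
      nsmul_eq_mul]
    have hr : ((2 * d ^ 2 - d : ℕ) : ℝ) ≤ 2 * d ^ 2 := by
      have : 2 * d ^ 2 - d ≤ 2 * d ^ 2 := Nat.sub_le _ _
      exact_mod_cast this
    have hs := sum_inv_le_sqrt (2 * d ^ 2 - d)
    have hsq : √((2 * d ^ 2 - d : ℕ) : ℝ) ≤ 3 / 2 * d := by
      rw [Real.sqrt_le_left (by positivity)]
      nlinarith
    have h1 : ((2 * d ^ 2 - d : ℕ) : ℝ) * (34 * u / d ^ 2) ≤ 68 * u := by
      rw [mul_div_assoc', div_le_iff₀ (by positivity)]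
      nlinarith
    have h2 : 16 * u / d * ∑ k ∈ Finset.range (2 * d ^ 2 - d), (1 / (k + 1) : ℝ) ≤ 48 * u := by
      have h3 : ∑ k ∈ Finset.range (2 * d ^ 2 - d), (1 / (k + 1) : ℝ) ≤ 3 * d := by linarith
      calc _ ≤ 16 * u / d * (3 * d) := by gcongr
        _ = 48 * u := by field_simp; ring
    linarith

theorem costMoment_le (hd : 1 ≤ d) (hK : d / 2 ≤ K)
    (hm : d / 2 ≤ (S * secondMoment D).trace) (hmK : (S * secondMoment D).trace ≤ K)
    (hq : 1 / 4 ≤ poolAcceptance D S (2 * d ^ 2)) (hq1 : poolAcceptance D S (2 * d ^ 2) ≤ 1) :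
    costMoment D S K (2 * d ^ 2 - d) (d ^ 2)
      (ENNReal.ofReal (Real.exp (1 / 2000 / (K * d ^ 3)))) ≤ ENNReal.ofReal (Real.exp 1) := by
  have hd1 : (1 : ℝ) ≤ d := by exact_mod_cast hd
  have hK0 : 0 < K := by linarith
  have ht : d + (2 * d ^ 2 - d) = 2 * d ^ 2 := by
    have : d ≤ 2 * d ^ 2 := by nlinarith
    omega
  have hlev := leverageFactor_le hd (c := 1 / 2000) (p := (S * secondMoment D).trace / K)
    (K := K) (by norm_num) (by norm_num) hK (by
      rw [div_le_div_iff₀ (by positivity) hK0]; nlinarith) ((div_le_one hK0).mpr hmK)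
  set l : ℝ := 1 / 2000 / (K * d ^ 3) with hl
  have hl0 : 0 < l := by positivity
  -- Since `K ≥ d / 2`, costs of order `d ^ 4` are within the budget `K d ^ 3`.
  have hu : d ^ 4 * l ≤ 1 / 1000 := by
    rw [hl, mul_div_assoc', div_le_iff₀ (by positivity)]
    have : (d : ℝ) ^ 3 * (d / 2) ≤ d ^ 3 * K := by gcongr
    nlinarith
  have h2d : (d : ℝ) ≤ d ^ 4 := le_self_pow₀ hd1 (by norm_num)
  have h3d : (d : ℝ) ^ 2 ≤ d ^ 4 := pow_le_pow_right₀ hd1 (by norm_num)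
  have h4d : (d : ℝ) ^ 3 ≤ d ^ 4 := pow_le_pow_right₀ hd1 (by norm_num)
  have h5d : (1 : ℝ) ≤ d ^ 4 := one_le_pow₀ hd1
  have hops : ∀ (n k : ℕ), ((n : ℝ) ≤ k * d ^ 4) →
      ENNReal.ofReal (Real.exp l) ^ n ≤ ENNReal.ofReal (Real.exp (k * (1 / 1000))) := by
    intro n k h
    refine ofReal_exp_pow_le ?_
    calc (n : ℝ) * l ≤ k * d ^ 4 * l := by gcongr
      _ = k * (d ^ 4 * l) := by ring
      _ ≤ k * (1 / 1000) := by gcongr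
  rw [costMoment, ht, roundsFactor_eq (by linarith)]
  -- One round in thousandths: `2 d ^ 2` points at `48 / (2000 d ^ 2)` each give `48`, the
  -- acceptance test at most `31`.
  have hpool : (ENNReal.ofReal (Real.exp l) * leverageFactor d (d ^ 2) (ENNReal.ofReal (Real.exp l))
      ((S * secondMoment D).trace / K)) ^ (2 * d ^ 2) *
        ENNReal.ofReal (Real.exp l) ^ poolOps d (2 * d ^ 2) ≤
      ENNReal.ofReal (Real.exp (79 / 1000)) := by
    refine mul_le_ofReal_exp (pow_le_ofReal_exp hlev (y := 48 / 1000) ?_)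
      (hops _ 31 ?_) (by norm_num)
    · push_cast
      refine le_of_eq ?_
      field_simp
      norm_num
    · simp only [poolOps]
      push_cast
      nlinarith
  have hround := geomFactor_le (by norm_num) (by linarith) hq1 (by linarith) hpool
  have hround' : 2 * (79 / 1000 / poolAcceptance D S (2 * d ^ 2)) ≤ 632 / 1000 := by
    have : 79 / 1000 / poolAcceptance D S (2 * d ^ 2) ≤ 316 / 1000 := by
      rw [div_le_iff₀ (by linarith)]; linarith
    linarith
  -- The whole budget in thousandths: `20` for inverting `Σ̂`, `632` for the rounds, `26` for
  -- preparing the removals and `116` for the removals, in total below `1000`.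
  refine mul_le_ofReal_exp (hops _ 20 ?_) (mul_le_ofReal_exp (hround.trans
    (ENNReal.ofReal_le_ofReal (Real.exp_le_exp.mpr hround'))) (mul_le_ofReal_exp (hops _ 26 ?_)
    (prod_removalFactor_le hd hl0.le hu (by norm_num)) (le_refl _)) (le_refl _)) (by norm_num)
  · push_cast
    nlinarith
  · simp only [prepareOps]
    push_cast
    nlinarith

end Cost

/-! ### Tail bounds -/

theorem poolAcceptance_le_one {d : ℕ} {D : Measure (Vec d)} {S : Mat d} [IsProbabilityMeasure D]
    (hd : 1 ≤ d) (hD : MemLp (fun x : Vec d => x) 2 D) (hS : S.PosDef)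
    (hm : 0 < (S * secondMoment D).trace) (hdet : 0 < (secondMoment D).det) (r : ℕ) :
    poolAcceptance D S (d + r) ≤ 1 := by
  have := isProbabilityMeasure_leverageLaw hD hS.posSemidef hm
  have h := lintegral_acceptProb hD hS hm hdet r
  rw [← ENNReal.ofReal_le_one, ← h]
  calc _ ≤ ∫⁻ _, 1 ∂(Measure.pi fun _ : Fin (d + r) => leverageLaw D S) :=
        lintegral_mono_ae ((leverageLaw_pool_ae hD hS.posSemidef hm (d + r)).mono fun z hz =>
          ENNReal.ofReal_le_one.mpr (acceptProb_le_one hd hS (by omega) hz))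
    _ = 1 := by simp

/-- **Markov's inequality** for the exponential moment of the cost. -/
theorem cost_tail {α : Type} [MeasurableSpace α] (m : RandProg α) (e : ℕ) {l s M : ℝ} (hl : 0 < l)
    (h : transform e (ENNReal.ofReal (Real.exp l)) m (fun _ => 1) ≤ ENNReal.ofReal (Real.exp M)) :
    m {z | s ≤ z.2.2 + e * z.2.1} ≤ ENNReal.ofReal (Real.exp (M - l * s)) := by
  have hb : ∀ z : α × (ℕ × ℕ), ENNReal.ofReal (Real.exp l) ^ (z.2.2 + e * z.2.1) * 1 =
      ENNReal.ofReal (Real.exp ((z.2.2 + e * z.2.1) * l)) := by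
    intro z
    rw [mul_one, ofReal_exp_pow]
    push_cast
    rfl
  have hm : Measurable fun z : α × (ℕ × ℕ) => ENNReal.ofReal (Real.exp ((z.2.2 + e * z.2.1) * l)) := by
    simp_rw [← hb]
    exact measurable_transformIntegrand e _ measurable_const
  unfold transform at h
  simp_rw [hb] at h
  have hmarkov := mul_meas_ge_le_lintegral (μ := m) hm (ENNReal.ofReal (Real.exp (l * s)))
  have hsub : {z : α × (ℕ × ℕ) | s ≤ z.2.2 + e * z.2.1} ⊆ {z | ENNReal.ofReal (Real.exp (l * s)) ≤
      ENNReal.ofReal (Real.exp ((z.2.2 + e * z.2.1) * l))} := by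
    intro z hz
    refine ENNReal.ofReal_le_ofReal (Real.exp_le_exp.mpr ?_)
    rw [mul_comm]
    exact mul_le_mul_of_nonneg_right hz hl.le
  have h1 := (mul_le_mul_right (measure_mono (μ := m) hsub)
    (ENNReal.ofReal (Real.exp (l * s)))).trans (hmarkov.trans h)
  rw [Real.exp_sub, ENNReal.ofReal_div_of_pos (Real.exp_pos _), ENNReal.le_div_iff_mul_le
    (Or.inl (ENNReal.ofReal_pos.mpr (Real.exp_pos _)).ne') (Or.inl ENNReal.ofReal_ne_top), mul_comm]
  exact h1

/-- Since `δ ≤ 1 / 2`, the logarithm is at least `ln 2`, beyond the positive root `(1 + √17) / 8` of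
`4 x ^ 2 - x - 1`. -/
theorem one_add_log_le {δ : ℝ} (hδ : 0 < δ) (hδ2 : δ ≤ 1 / 2) :
    1 + Real.log (1 / δ) ≤ 4 * Real.log (1 / δ) ^ 2 := by
  have h : Real.log 2 ≤ Real.log (1 / δ) := by
    refine Real.log_le_log (by norm_num) ?_
    rw [le_div_iff₀ hδ]; linarith
  have h2 := Real.log_two_gt_d9
  nlinarith

end VolumeSampling

end

/-! ### The main theorem: exactness and tail bounds -/

theorem theorem3 :
    ∃ C : ℝ, 0 < C ∧
      ∀ (d : ℕ) (_ : 1 ≤ d)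
        (D : MeasureTheory.Measure (VolumeSampling.Vec d))
        (_ : MeasureTheory.IsProbabilityMeasure D)
        (_ : MeasureTheory.MemLp (fun x : VolumeSampling.Vec d => x) 2 D)
        (_ : IsUnit (VolumeSampling.secondMoment D))
        (Shat : VolumeSampling.Mat d) (ε K : ℝ)
        (_ : ε = 1 / √(2 * (d : ℝ)))
        (_ : (Shat - (1 - ε) • VolumeSampling.secondMoment D).PosSemidef)
        (_ : ((1 + ε) • VolumeSampling.secondMoment D - Shat).PosSemidef)
        (_ : VolumeSampling.condNumber D / ENNReal.ofReal (1 - ε) ≤ ENNReal.ofReal K),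
        -- the returned points are distributed exactly as volume-rescaled sampling
        -- (pool size t = 2 d ^ 2), and the algorithm halts almost surely
        MeasureTheory.IsProbabilityMeasure
          (VolumeSampling.detRejectionSampling D Shat K (2 * d ^ 2 - d)) ∧
        (VolumeSampling.detRejectionSampling D Shat K (2 * d ^ 2 - d)).map Prod.fst =
          VolumeSampling.volumeRescaled D d ∧
        -- sample and time complexity
        ∀ δ : ℝ, 0 < δ → δ ≤ 1 / 2 →
          ENNReal.ofReal (1 - δ) ≤
            (VolumeSampling.detRejectionSampling D Shat K (2 * d ^ 2 - d))
              {z | (z.2.1 : ℝ) ≤ C * (K * d * Real.log (1 / δ) ^ 2) ∧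
                (z.2.2 : ℝ) ≤ C * (K * d ^ 3 * Real.log (1 / δ) ^ 2)} := by
  open VolumeSampling MeasureTheory in
  -- `8000 = 4 * 2000`: the factor `4` is that of `one_add_log_le`, and `1 / 2000` is the constant
  -- in the exponential rate of `costMoment_le`.
  refine ⟨8000, by norm_num, ?_⟩
  intro d hd D hDp hD hU Q ε K hε h1 h2 hcond
  have hd1 : (1 : ℝ) ≤ d := by exact_mod_cast hd
  have hs : 0 < √(2 * (d : ℝ)) := Real.sqrt_pos.mpr (by positivity)
  have hε0 : 0 < ε := by rw [hε]; positivity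
  have hε2 : ε ^ 2 = 1 / (2 * d) := by rw [hε, div_pow, Real.sq_sqrt (by positivity), one_pow]
  have hε1 : ε < 1 := by
    have h : ε ^ 2 ≤ 1 / 2 := by
      rw [hε2, div_le_div_iff₀ (by positivity) (by norm_num)]
      linarith
    nlinarith
  have hP := posDef_of_approx hU hε0 h1 h2
  have hQ := posDef_approx hP hε1 h1
  have hdet := hP.det_pos
  have hm2 : (d : ℝ) / 2 ≤ (Q⁻¹ * secondMoment D).trace := by
    refine le_trans ?_ (trace_approx_ge hP hε0 hQ h2)
    gcongr
    linarith
  have hm : 0 < (Q⁻¹ * secondMoment D).trace := by linarith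
  have hae := quad_inv_le_ae hP hε1 hQ h1 hcond
  have hmK' := trace_le_of_ae hD hae
  -- Otherwise `max K 0 = 0` would bound a trace that is at least `d / 2`.
  have hK0 : 0 < K := by
    by_contra h
    rw [max_eq_right (not_lt.mp h)] at hmK'
    linarith
  rw [max_eq_left hK0.le] at hmK' hae
  have ht : d + (2 * d ^ 2 - d) = 2 * d ^ 2 := by
    have : d ≤ 2 * d ^ 2 := by nlinarith
    omega
  have hq := poolAcceptance_ge hd hP hε0 hε1 hε2 hQ h1 h2
  have hq1 := poolAcceptance_le_one hd hD hQ.inv hm hdet (2 * d ^ 2 - d)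
  have hone : costMoment D Q⁻¹ K (2 * d ^ 2 - d) 0 1 = 1 :=
    costMoment_one hK0 hm hmK' (by rw [ht]; linarith) hq1
  rw [ht] at hq1
  -- At `b = 1` the cost is forgotten; total mass `1` is almost sure termination.
  have hlaw : ∀ f : (Fin d → Vec d) → ENNReal, Measurable f →
      transform 0 1 (detRejectionSampling D Q K (2 * d ^ 2 - d)) f =
        ∫⁻ x, f x ∂(volumeRescaled D d) := by
    intro f hf
    rw [transform_detRejectionSampling 0 1 hd hD hQ hm hdet hK0 hae _ hf, hone, one_mul]
  have huniv : detRejectionSampling D Q K (2 * d ^ 2 - d) Set.univ = 1 := by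
    rw [← transform_one_one 0, hlaw _ measurable_const, lintegral_one, volumeRescaled_univ hD hdet]
  refine ⟨⟨huniv⟩, ?_, ?_⟩
  · refine Measure.ext_of_lintegral _ fun f hf => ?_
    rw [lintegral_map hf measurable_fst, ← hlaw f hf]
    simp [transform]
  · intro δ hδ hδ2
    have hL := one_add_log_le hδ hδ2
    set L := Real.log (1 / δ) with hLdef
    have hlog : Real.exp (-L) = δ := by
      rw [hLdef, one_div, Real.log_inv, neg_neg, Real.exp_log hδ]
    -- Charging each sample `d ^ 2` extra operations puts samples and time on the same scale, so
    -- that one tail bound controls both without a union bound.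
    have hcost := transform_detRejectionSampling (d ^ 2)
      (ENNReal.ofReal (Real.exp (1 / 2000 / (K * d ^ 3)))) hd hD hQ hm hdet hK0 hae
      (2 * d ^ 2 - d) (f := fun _ => 1) measurable_const
    rw [lintegral_one, volumeRescaled_univ hD hdet, mul_one] at hcost
    have hM := hcost.le.trans (costMoment_le hd (hm2.trans hmK') hm2 hmK' hq hq1)
    have htail := cost_tail (s := 8000 * (K * d ^ 3 * L ^ 2)) _ (d ^ 2) (by positivity) hM
    have hexp : Real.exp (1 - 1 / 2000 / (K * d ^ 3) * (8000 * (K * d ^ 3 * L ^ 2))) ≤ δ := by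
      rw [← hlog]
      refine Real.exp_le_exp.mpr ?_
      have : 1 / 2000 / (K * d ^ 3) * (8000 * (K * d ^ 3 * L ^ 2)) = 4 * L ^ 2 := by
        field_simp
        ring
      rw [this]
      linarith
    have htail' := htail.trans (ENNReal.ofReal_le_ofReal hexp)
    rw [ENNReal.ofReal_sub _ hδ.le, ENNReal.ofReal_one, tsub_le_iff_right, ← huniv]
    refine le_trans ?_ (add_le_add_right htail' _)
    refine le_trans (measure_mono fun z _ => ?_) (measure_union_le _ _)
    -- Outside the tail event the weighted sum is below the threshold. Both summands are
    -- nonnegative, so each is below it too, and dividing by `d ^ 2` gives the sample bound.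
    by_contra hz
    rw [Set.mem_union, not_or] at hz
    obtain ⟨hz1, hz2⟩ := hz
    simp only [Set.mem_ofPred_eq, not_le] at hz1 hz2
    refine hz1 ⟨?_, ?_⟩
    · have h3 : (d : ℝ) ^ 2 * z.2.1 ≤ d ^ 2 * (8000 * (K * d * L ^ 2)) := by
        push_cast at hz2
        have : (0 : ℝ) ≤ z.2.2 := Nat.cast_nonneg _
        nlinarith
      exact le_of_mul_le_mul_left h3 (by positivity)
    · push_cast at hz2
      have : (0 : ℝ) ≤ (d : ℝ) ^ 2 * z.2.1 := by positivity
      linarith
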